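/- **Proposition 4 (action of $\widehat{\mathfrak{sl}}_4$ on complex Clifford forms).** Let $W$ be a real vector space of dimension $2n$ with a nondegenerate quadratic form, of any signature, with associated symmetric bilinear form $\eta$, and let $J:W\to W$ satisfy $J^2=-1$ and $\eta(Jv,Jw)=\eta(v,w)$. Write $W\otimes\mathbb C=V\oplus\bar V$ for the decomposition into the $i$- and $(-i)$-eigenspaces of $J$, and let $\mathit{Cl}$ be the Clifford algebra of $W\otimes\mathbb C$, with relations $vw+wv=2\eta(v,w)$, identified with $\Lambda(V\oplus\bar V)$ as a vector space in the canonical way (so that $v\wedge a=\frac12(va+(-1)^{\deg a}av)$ is exterior multiplication). Let $M$ be a smooth manifold with a vielbein, i.e. a smooth $W$-valued one-form $\theta^{\mathbb R}$ that is an isomorphism $T_mM\to W$ at every point $m$. It induces a metric, an almost complex structure and an orientation on $M$. Let $\Omega$ be the space of Clifford forms, i.e. of smooth sections of $\mathit{Cl}\otimes\Lambda(T^*M\otimes\mathbb C)$, with product $(a\otimes\alpha)(b\otimes\beta)=ab\otimes\alpha\wedge\beta$. It is $\mathbb Z^4$-graded, $\Omega=\bigoplus\Omega^{p\bar pq\bar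 q}$, where $(p,\bar p)$ is the bidegree in $\Lambda(V\oplus\bar V)$ and $(q,\bar q)$ is the type of the scalar form, and $\theta^{\mathbb R}=\theta+\bar\theta$ with $\theta\in\Omega^{1010}$ and $\bar\theta\in\Omega^{0101}$. Choose an element $\nu$ of top degree of $\mathit{Cl}$ with $\nu^2=1$. The Hodge star of $\mathit{Cl}$ is the unique linear automorphism $*$ with $*\nu=1$ and $v\wedge(*a)=*(v\vdash a)$ for all vectors $v$, where $v\vdash a=\frac12(va-(-1)^{\deg a}av)$. Let $*_1$ be this star acting on the factor $\mathit{Cl}$ of $\Omega$, and let $*_2$ be the corresponding star of $\Lambda(T^*M\otimes\mathbb C)$, for the metric and orientation induced by $\theta^{\mathbb R}$. For a Clifford form $t$ put $A_t^{\pm}x=\frac12\bigl(tx\pm(-1)^{p+\bar p+q+\bar q}xt\bigr)$ for $x\in\Omega^{p\bar pq\bar q}$, and define $$E_0=A^+_\theta,\quad E_1=*_2^{-1}A^+_{\bar\theta}*_2,\quad E_2=*_1^{-1}*_2^{-1}A^+_\theta *_2*_1,\quad E_3=A^-_{\bar\theta},$$ $$F_0=*_1^{-1}*_2^{-1}A^+_{\bar\theta}*_2*_1,\quad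 F_1=A^-_\theta,\quad F_2=A^+_{\bar\theta},\quad F_3=*_2^{-1}A^+_\theta *_2,$$ and let $H_0,H_1,H_2,H_3$ be multiplication on $\Omega^{p\bar pq\bar q}$ by $p+q-n$, $\bar p-q$, $n-\bar p-\bar q$ and $\bar q-p$, respectively. Then these operators preserve $\Omega$ and satisfy the Chevalley–Serre relations of the affine Cartan matrix $(a_{ij})$ of type $A_3^{(1)}$ (indices $i,j\in\mathbb Z/4$; $a_{ii}=2$, $a_{i,i\pm1}=-1$, $a_{i,i+2}=0$): $$[H_i,H_j]=0,\quad [E_i,F_j]=\delta_{ij}H_i,\quad [H_i,E_j]=a_{ij}E_j,\quad [H_i,F_j]=-a_{ij}F_j,$$ $$(\operatorname{ad}E_i)^{1-a_{ij}}E_j=0,\quad (\operatorname{ad}F_i)^{1-a_{ij}}F_j=0\qquad(i\ne j).$$ Hence there is an action $\rho$ on $\Omega$ of the affine Lie algebra $\widehat{\mathfrak{sl}}_4$ (with Chevalley generators $e_i,f_i,h_i$ and these relations) such that $e_i,f_i,h_i$ act by $E_i,F_i,H_i$. Moreover, consider the operators $E=A^+_{\theta^{\mathbb R}}$, $E'=*_1^{-1}E*_1$,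 $F=*_1^{-1}*_2^{-1}E*_2*_1$, $F'=*_2^{-1}E*_2$, and the operators $H,H'$ that multiply by $p+\bar p+q+\bar q-2n$ and $q+\bar q-p-\bar p$ on $\Omega^{p\bar pq\bar q}$. Then $$E=E_0+F_2,\quad F=F_0+E_2,\quad H=H_0-H_2,\quad E'=F_1+E_3,\quad F'=E_1+F_3,\quad H'=H_3-H_1 .$$ These six operators define an action of $\mathfrak{sl}_2\times\mathfrak{sl}_2$ on $\Omega$ (with $E,F,H$ for the first factor and $E',F',H'$ for the second) whose image lies in the image of $\widehat{\mathfrak{sl}}_4$ under $\rho$; if $n\ge1$ and $M\neq\emptyset$, it embeds $\mathfrak{sl}_2\times\mathfrak{sl}_2$ into $\rho(\widehat{\mathfrak{sl}}_4)$. -/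

import Mathlib

open scoped TensorProduct Manifold ContDiff

noncomputable section

namespace CliffordForms

/-! ### Clifford algebra of a complex quadratic space: exterior and interior multiplication, star -/

section Star

variable {X : Type*} [AddCommGroup X] [Module ℂ X] (Q : QuadraticForm ℂ X)

/-- Exterior multiplication by a vector on the Clifford algebra,
`v ∧ a = (v a + (-1)^(deg a) a v) / 2`. -/
def wedge (v : X) : Module.End ℂ (CliffordAlgebra Q) :=
  (1 / 2 : ℂ) • (LinearMap.mulLeft ℂ (CliffordAlgebra.ι Q v) +
    LinearMap.mulRight ℂ (CliffordAlgebra.ι Q v) ∘ₗ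
      (CliffordAlgebra.involute (Q := Q)).toLinearMap)

/-- Interior multiplication by a vector on the Clifford algebra,
`v ⊢ a = (v a - (-1)^(deg a) a v) / 2`. -/
def vdash (v : X) : Module.End ℂ (CliffordAlgebra Q) :=
  (1 / 2 : ℂ) • (LinearMap.mulLeft ℂ (CliffordAlgebra.ι Q v) -
    LinearMap.mulRight ℂ (CliffordAlgebra.ι Q v) ∘ₗ
      (CliffordAlgebra.involute (Q := Q)).toLinearMap)

/-- An element of top degree with square one (the choice of an orientation). Degrees in the
Clifford algebra are those of the exterior algebra, transported by the canonical isomorphism. -/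
structure UnitVolume where
  /-- the element of the Clifford algebra -/
  val : CliffordAlgebra Q
  top_degree : CliffordAlgebra.equivExterior Q val ∈
    (⋀[ℂ]^(Module.finrank ℂ X) X : Submodule ℂ (ExteriorAlgebra ℂ X))
  sq : val * val = 1

variable {Q}

theorem wedge_apply (v : X) (a : CliffordAlgebra Q) :
    wedge Q v a = (1 / 2 : ℂ) • (CliffordAlgebra.ι Q v * a +
      CliffordAlgebra.involute a * CliffordAlgebra.ι Q v) := rfl

theorem vdash_apply (v : X) (a : CliffordAlgebra Q) :
    vdash Q v a = (1 / 2 : ℂ) • (CliffordAlgebra.ι Q v * a -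
      CliffordAlgebra.involute a * CliffordAlgebra.ι Q v) := rfl

theorem equivExterior_ι_mul (v : X) (a : CliffordAlgebra Q) :
    CliffordAlgebra.equivExterior Q (CliffordAlgebra.ι Q v * a) =
      ExteriorAlgebra.ι ℂ v * CliffordAlgebra.equivExterior Q a +
      CliffordAlgebra.contractLeft (QuadraticMap.associated (R := ℂ) Q v)
        (CliffordAlgebra.equivExterior Q a) := by
  have := CliffordAlgebra.changeForm_ι_mul
    (CliffordAlgebra.changeForm.associated_neg_proof (Q := Q)) v a
  simpa using this

theorem equivExterior_involute_mul_ι (v : X) (a : CliffordAlgebra Q) :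
    CliffordAlgebra.equivExterior Q (CliffordAlgebra.involute a * CliffordAlgebra.ι Q v) =
      ExteriorAlgebra.ι ℂ v * CliffordAlgebra.equivExterior Q a -
      CliffordAlgebra.contractLeft (QuadraticMap.associated (R := ℂ) Q v)
        (CliffordAlgebra.equivExterior Q a) := by
  induction a using CliffordAlgebra.left_induction with
  | algebraMap r =>
    simp [Algebra.algebraMap_eq_smul_one]
  | add x y hx hy =>
    simp only [map_add, add_mul, hx, hy, mul_add]
    abel
  | ι_mul x w hx =>
    rw [map_mul (CliffordAlgebra.involute (Q := Q)), CliffordAlgebra.involute_ι, mul_assoc, neg_mul,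
      map_neg, equivExterior_ι_mul, hx,
      equivExterior_ι_mul]
    set y := CliffordAlgebra.equivExterior Q x
    have anti : ExteriorAlgebra.ι ℂ w * (ExteriorAlgebra.ι ℂ v * y) =
        - (ExteriorAlgebra.ι ℂ v * (ExteriorAlgebra.ι ℂ w * y)) := by
      rw [← mul_assoc, ← mul_assoc, ← neg_mul]
      congr 1
      exact eq_neg_of_add_eq_zero_left (ExteriorAlgebra.ι_add_mul_swap w v)
    have c1 : ∀ (d : Module.Dual ℂ X) (u : X) (z : ExteriorAlgebra ℂ X),
        CliffordAlgebra.contractLeft (Q := (0 : QuadraticForm ℂ X)) d (ExteriorAlgebra.ι ℂ u * z) =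
          d u • z - ExteriorAlgebra.ι ℂ u * CliffordAlgebra.contractLeft d z :=
      fun d u z => CliffordAlgebra.contractLeft_ι_mul d u z
    have sy : QuadraticMap.associated (R := ℂ) Q w v = QuadraticMap.associated (R := ℂ) Q v w :=
      QuadraticMap.associated_isSymm ℂ Q w v
    rw [map_sub, map_add, c1, c1, mul_sub, anti, mul_add, sy,
      CliffordAlgebra.contractLeft_comm (QuadraticMap.associated (R := ℂ) Q v)]
    abel

theorem equivExterior_wedge (v : X) (a : CliffordAlgebra Q) :
    CliffordAlgebra.equivExterior Q (wedge Q v a) =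
      ExteriorAlgebra.ι ℂ v * CliffordAlgebra.equivExterior Q a := by
  rw [wedge_apply, map_smul, map_add, equivExterior_ι_mul, equivExterior_involute_mul_ι]
  module

theorem wedge_volume [FiniteDimensional ℂ X] (ν : UnitVolume Q) (v : X) :
    wedge Q v ν.val = 0 := by
  apply (CliffordAlgebra.equivExterior Q).injective
  rw [equivExterior_wedge, map_zero]
  have h1 : ExteriorAlgebra.ι ℂ v * CliffordAlgebra.equivExterior Q ν.val ∈
      (⋀[ℂ]^(1 + Module.finrank ℂ X) X : Submodule ℂ (ExteriorAlgebra ℂ X)) := by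
    have := Submodule.mul_mem_mul (LinearMap.mem_range_self (ExteriorAlgebra.ι ℂ) v) ν.top_degree
    rw [ExteriorAlgebra.exteriorPower, pow_add, pow_one]
    exact this
  have h2 : Module.finrank ℂ (⋀[ℂ]^(1 + Module.finrank ℂ X) X) = 0 := by
    rw [exteriorPower.finrank_eq, Nat.choose_eq_zero_of_lt (by omega)]
  rw [Submodule.finrank_eq_zero] at h2
  rw [h2] at h1
  simpa using h1

theorem volume_comm [FiniteDimensional ℂ X] (ν : UnitVolume Q) (v : X) :
    CliffordAlgebra.involute ν.val * CliffordAlgebra.ι Q v = - (CliffordAlgebra.ι Q v * ν.val) := by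
  have h := wedge_volume ν v
  rw [wedge_apply, smul_eq_zero] at h
  rcases h with h | h
  · norm_num at h
  · exact eq_neg_of_add_eq_zero_right h

/-- There is exactly one linear automorphism `*` of the Clifford algebra that sends the volume
element to `1` and satisfies `v ∧ (* a) = * (v ⊢ a)`. -/
theorem existsUnique_star [FiniteDimensional ℂ X] (ν : UnitVolume Q) :
    ∃! s : CliffordAlgebra Q ≃ₗ[ℂ] CliffordAlgebra Q,
      s ν.val = 1 ∧ ∀ (v : X) (a : CliffordAlgebra Q), wedge Q v (s a) = s (vdash Q v a) := by
  let r := LinearMap.mulRight ℂ ν.val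
  have hr : r ∘ₗ r = LinearMap.id := by
    ext a
    simp [r, mul_assoc, ν.sq]
  refine ⟨LinearEquiv.ofLinearMap r r hr hr, ⟨by simpa [r] using ν.sq, fun v a => ?_⟩, ?_⟩
  · simp only [LinearEquiv.coe_ofLinearMap, r, LinearMap.mulRight_apply, wedge_apply, vdash_apply,
      map_mul, mul_assoc, volume_comm, smul_mul_assoc, sub_mul, mul_neg]
    rw [sub_eq_add_neg]
  · rintro s ⟨h1, h2⟩
    have key : ∀ y : ExteriorAlgebra ℂ X,
        s ((CliffordAlgebra.equivExterior Q).symm y * ν.val) =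
          (CliffordAlgebra.equivExterior Q).symm y := by
      intro y
      induction y using CliffordAlgebra.left_induction with
      | algebraMap c =>
        have : (CliffordAlgebra.equivExterior Q).symm (algebraMap ℂ _ c) = algebraMap ℂ _ c := by
          rw [LinearEquiv.symm_apply_eq]; simp
        erw [this]
        rw [← Algebra.smul_def, map_smul, h1, Algebra.algebraMap_eq_smul_one]
      | add x y hx hy => rw [map_add, add_mul, map_add, hx, hy]
      | ι_mul x v hx =>
        have hw : (CliffordAlgebra.equivExterior Q).symm (ExteriorAlgebra.ι ℂ v * x) =
            wedge Q v ((CliffordAlgebra.equivExterior Q).symm x) := by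
          rw [LinearEquiv.symm_apply_eq, equivExterior_wedge, LinearEquiv.apply_symm_apply]
        have hw' : wedge Q v ((CliffordAlgebra.equivExterior Q).symm x) * ν.val =
            vdash Q v ((CliffordAlgebra.equivExterior Q).symm x * ν.val) := by
          simp only [wedge_apply, vdash_apply, map_mul, mul_assoc, volume_comm, smul_mul_assoc,
            add_mul, mul_neg, sub_neg_eq_add]
        erw [hw]
        rw [hw', ← h2, hx]
    ext a
    have := key (CliffordAlgebra.equivExterior Q (a * ν.val))
    rw [LinearEquiv.symm_apply_apply, mul_assoc, ν.sq, mul_one] at this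
    simpa [r] using this

/-- The Hodge star of the Clifford algebra. -/
def hodgeStar [FiniteDimensional ℂ X] (ν : UnitVolume Q) :
    CliffordAlgebra Q ≃ₗ[ℂ] CliffordAlgebra Q :=
  (existsUnique_star ν).choose

theorem hodgeStar_spec [FiniteDimensional ℂ X] (ν : UnitVolume Q) :
    hodgeStar ν ν.val = 1 ∧
      ∀ (v : X) (a : CliffordAlgebra Q), wedge Q v (hodgeStar ν a) = hodgeStar ν (vdash Q v a) :=
  (existsUnique_star ν).choose_spec.1

end Star

/-! ### Bigrading of the exterior algebra by a splitting of the space of generators -/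

section Grading

variable {X : Type*} [AddCommGroup X] [Module ℂ X]

/-- For a projection `P` of `X`, the component `Λ^{r,s}` of the exterior algebra of
`X = range P ⊕ range (1 - P)`: the span of the products of `r` vectors of `range P` and
`s` vectors of `range (1 - P)`. -/
def bidegree (P : Module.End ℂ X) (r s : ℕ) : Submodule ℂ (ExteriorAlgebra ℂ X) :=
  (Submodule.map (ExteriorAlgebra.ι ℂ) (LinearMap.range P)) ^ r *
    (Submodule.map (ExteriorAlgebra.ι ℂ) (LinearMap.range (1 - P))) ^ s

/-- The algebra homomorphism `x ↦ x + ε D x` into the dual numbers over the exterior algebra, for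
the derivation `D` that extends `P`. -/
def derivationHom (P : Module.End ℂ X) :
    ExteriorAlgebra ℂ X →ₐ[ℂ] DualNumber (ExteriorAlgebra ℂ X) :=
  ExteriorAlgebra.lift ℂ
    ⟨(TrivSqZeroExt.inlAlgHom ℂ (ExteriorAlgebra ℂ X) (ExteriorAlgebra ℂ X)).toLinearMap ∘ₗ
        ExteriorAlgebra.ι ℂ +
      (TrivSqZeroExt.inrHom (ExteriorAlgebra ℂ X) (ExteriorAlgebra ℂ X)).restrictScalars ℂ ∘ₗ
        ExteriorAlgebra.ι ℂ ∘ₗ P, fun v => by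
      ext
      · simp
      · simp [ExteriorAlgebra.ι_add_mul_swap v (P v)]⟩

/-- The derivation of the exterior algebra that extends `P`. If `P` is a projection, it counts
the factors from `range P`: it is multiplication by `r` on `Λ^{r,s}`. -/
def count (P : Module.End ℂ X) : Module.End ℂ (ExteriorAlgebra ℂ X) where
  toFun x := (derivationHom P x).snd
  map_add' x y := by simp
  map_smul' c x := by simp

theorem derivationHom_fst (P : Module.End ℂ X) (x : ExteriorAlgebra ℂ X) :
    (derivationHom P x).fst = x := by
  have h : (TrivSqZeroExt.fstHom ℂ (ExteriorAlgebra ℂ X) (ExteriorAlgebra ℂ X)).comp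
      (derivationHom P) = AlgHom.id ℂ (ExteriorAlgebra ℂ X) := by
    apply ExteriorAlgebra.hom_ext
    ext v
    simp [derivationHom]
  exact DFunLike.congr_fun h x

theorem count_ι (P : Module.End ℂ X) (v : X) :
    count P (ExteriorAlgebra.ι ℂ v) = ExteriorAlgebra.ι ℂ (P v) := by
  simp [count, derivationHom]

theorem count_mul (P : Module.End ℂ X) (x y : ExteriorAlgebra ℂ X) :
    count P (x * y) = x * count P y + count P x * y := by
  simp [count, derivationHom_fst]

end Grading

/-! ### Clifford forms at a point

`W` is a real vector space with a quadratic form `Q` and a complex structure `J`, `T` is the tangent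
space at a point, and `θ : T ≃ W` is the value of the vielbein at this point. -/

section Point

variable {W : Type*} [AddCommGroup W] [Module ℝ W] (Q : QuadraticForm ℝ W) (J : Module.End ℝ W)
variable {T : Type*} [AddCommGroup T] [Module ℝ T] (θ : T ≃ₗ[ℝ] W)

/-- A complex structure that preserves the metric. -/
structure IsCompatibleComplexStructure : Prop where
  sq : ∀ w, J (J w) = -w
  isometry : ∀ w, Q (J w) = Q w

/-- The Clifford algebra of the complexification of `W`. -/
abbrev Cl : Type _ := CliffordAlgebra (Q.baseChange ℂ)

/-- The exterior algebra of the complexified cotangent space. -/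
abbrev Forms (T : Type*) [AddCommGroup T] [Module ℝ T] : Type _ :=
  ExteriorAlgebra ℂ (ℂ ⊗[ℝ] Module.Dual ℝ T)

/-- Values of Clifford forms at a point with tangent space `T`. Elements of the Clifford algebra
commute with scalar forms: `(a ⊗ α) (b ⊗ β) = a b ⊗ α β`. -/
abbrev CliffordFormAt (T : Type*) [AddCommGroup T] [Module ℝ T] : Type _ := Cl Q ⊗[ℂ] Forms T

/-- The projection `(1 - i K) / 2` of the complexification onto the `i`-eigenspace of a complex
structure `K`. -/
def projI {U : Type*} [AddCommGroup U] [Module ℝ U] (K : Module.End ℝ U) :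
    Module.End ℂ (ℂ ⊗[ℝ] U) :=
  (1 / 2 : ℂ) • (1 - Complex.I • K.baseChange ℂ)

/-- The complex structure on cotangent vectors induced by the vielbein,
`α ↦ α ∘ θ⁻¹ ∘ J ∘ θ`. -/
def cotangentJ : Module.End ℝ (Module.Dual ℝ T) :=
  (θ.symm.toLinearMap ∘ₗ J ∘ₗ θ.toLinearMap).dualMap

/-- The complexification of the vielbein at a point, with its values in `W ⊗ ℂ` projected by `P`.
It is independent of the basis of `W`. -/
def vielbeinPart [FiniteDimensional ℝ W] (P : Module.End ℂ (ℂ ⊗[ℝ] W)) : CliffordFormAt Q T :=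
  ∑ i, CliffordAlgebra.ι (Q.baseChange ℂ) (P (1 ⊗ₜ Module.finBasis ℝ W i)) ⊗ₜ[ℂ]
    ExteriorAlgebra.ι ℂ (1 ⊗ₜ[ℝ] ((Module.finBasis ℝ W).coord i ∘ₗ θ.toLinearMap))

/-- The parity operator: `(-1)^d` on elements of total degree `d`. -/
def parity : Module.End ℂ (CliffordFormAt Q T) :=
  TensorProduct.map (CliffordAlgebra.involute (Q := Q.baseChange ℂ)).toLinearMap
    (CliffordAlgebra.involute (Q := (0 : QuadraticForm ℂ (ℂ ⊗[ℝ] Module.Dual ℝ T)))).toLinearMap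

variable {Q} in
/-- `x ↦ (t x + (-1)^(deg x) x t) / 2`. -/
def halfPlus (t : CliffordFormAt Q T) : Module.End ℂ (CliffordFormAt Q T) :=
  (1 / 2 : ℂ) • (LinearMap.mulLeft ℂ t + LinearMap.mulRight ℂ t ∘ₗ parity Q)

variable {Q} in
/-- `x ↦ (t x - (-1)^(deg x) x t) / 2`. -/
def halfMinus (t : CliffordFormAt Q T) : Module.End ℂ (CliffordFormAt Q T) :=
  (1 / 2 : ℂ) • (LinearMap.mulLeft ℂ t - LinearMap.mulRight ℂ t ∘ₗ parity Q)

variable {Q} in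
/-- The isomorphism between cotangent and tangent vectors given by the metric, followed by the
vielbein: the image `w` of `α` satisfies `η(w, θ u) = α u` for all tangent vectors `u`. -/
def sharp [FiniteDimensional ℝ W] (hQ : (QuadraticMap.associated (R := ℝ) Q).Nondegenerate) :
    Module.Dual ℝ T ≃ₗ[ℝ] W :=
  θ.symm.dualMap.trans
    (LinearMap.BilinForm.toDual (QuadraticMap.associated (R := ℝ) Q) hQ).symm

/-- An isomorphism of vector spaces induces an isomorphism of exterior algebras. -/
def exteriorCongr {X Y : Type*} [AddCommGroup X] [Module ℂ X] [AddCommGroup Y] [Module ℂ Y]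
    (e : X ≃ₗ[ℂ] Y) : ExteriorAlgebra ℂ X ≃ₗ[ℂ] ExteriorAlgebra ℂ Y :=
  (AlgEquiv.ofAlgHom (ExteriorAlgebra.map e.toLinearMap) (ExteriorAlgebra.map e.symm.toLinearMap)
    (by rw [ExteriorAlgebra.map_comp_map]; simp)
    (by rw [ExteriorAlgebra.map_comp_map]; simp)).toLinearEquiv

variable {Q} in
/-- The identification of scalar forms at a point with the Clifford algebra, through the vielbein
and the metric. -/
def formsEquiv [FiniteDimensional ℝ W]
    (hQ : (QuadraticMap.associated (R := ℝ) Q).Nondegenerate) : Forms T ≃ₗ[ℂ] Cl Q :=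
  (exteriorCongr ((sharp θ hQ).baseChange ℝ ℂ _ _)).trans
    (CliffordAlgebra.equivExterior (Q.baseChange ℂ)).symm

variable {Q}
variable [FiniteDimensional ℝ W] (hQ : (QuadraticMap.associated (R := ℝ) Q).Nondegenerate)
variable (ν : UnitVolume (Q.baseChange ℂ))

variable (T) in
/-- The Hodge star acting on the Clifford algebra. -/
def star₁ : CliffordFormAt Q T ≃ₗ[ℂ] CliffordFormAt Q T :=
  TensorProduct.congr (hodgeStar ν) (LinearEquiv.refl ℂ (Forms T))

/-- The Hodge star acting on scalar forms, for the metric and orientation transported from `W` by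
the vielbein. -/
def star₂ : CliffordFormAt Q T ≃ₗ[ℂ] CliffordFormAt Q T :=
  TensorProduct.congr (LinearEquiv.refl ℂ (Cl Q))
    ((formsEquiv θ hQ).trans ((hodgeStar ν).trans (formsEquiv θ hQ).symm))

/-- `s⁻¹ A s`. -/
def conjBy (s : CliffordFormAt Q T ≃ₗ[ℂ] CliffordFormAt Q T)
    (A : Module.End ℂ (CliffordFormAt Q T)) : Module.End ℂ (CliffordFormAt Q T) :=
  s.symm.toLinearMap ∘ₗ A ∘ₗ s.toLinearMap

/-- The `(1,0,1,0)` component `θ` of the vielbein. -/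
def thetaHol : CliffordFormAt Q T := vielbeinPart Q θ (projI J)

/-- The `(0,1,0,1)` component `θ̄` of the vielbein. -/
def thetaAnti : CliffordFormAt Q T := vielbeinPart Q θ (1 - projI J)

/-- The operators `E_0, E_1, E_2, E_3`. -/
def opE : Fin 4 → Module.End ℂ (CliffordFormAt Q T) :=
  ![halfPlus (thetaHol J θ),
    conjBy (star₂ θ hQ ν) (halfPlus (thetaAnti J θ)),
    conjBy (star₁ T ν) (conjBy (star₂ θ hQ ν) (halfPlus (thetaHol J θ))),
    halfMinus (thetaAnti J θ)]

/-- The operators `F_0, F_1, F_2, F_3`. -/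
def opF : Fin 4 → Module.End ℂ (CliffordFormAt Q T) :=
  ![conjBy (star₁ T ν) (conjBy (star₂ θ hQ ν) (halfPlus (thetaAnti J θ))),
    halfMinus (thetaHol J θ),
    halfPlus (thetaAnti J θ),
    conjBy (star₂ θ hQ ν) (halfPlus (thetaHol J θ))]

variable (Q) in
/-- The operator that is multiplication by the degree counted by `P` in the Clifford algebra. -/
def cliffordDegree (P : Module.End ℂ (ℂ ⊗[ℝ] W)) : Module.End ℂ (CliffordFormAt Q T) :=
  LinearMap.rTensor (Forms T)
    ((CliffordAlgebra.equivExterior (Q.baseChange ℂ)).symm.toLinearMap ∘ₗ count P ∘ₗ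
      (CliffordAlgebra.equivExterior (Q.baseChange ℂ)).toLinearMap)

variable (Q) in
/-- The operator that is multiplication by the degree counted by `P` in the scalar forms. -/
def formDegree (P : Module.End ℂ (ℂ ⊗[ℝ] Module.Dual ℝ T)) : Module.End ℂ (CliffordFormAt Q T) :=
  LinearMap.lTensor (Cl Q) (count P)

variable (Q) in
/-- The operators `p`, `p̄`, `q`, `q̄` of multiplication by the components of the degree. -/
def degree : Fin 4 → Module.End ℂ (CliffordFormAt Q T) :=
  ![cliffordDegree Q (projI J), cliffordDegree Q (1 - projI J),
    formDegree Q (projI (cotangentJ J θ)), formDegree Q (1 - projI (cotangentJ J θ))]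

variable (Q) in
/-- The operators `H_0 = p + q - n`, `H_1 = p̄ - q`, `H_2 = n - p̄ - q̄`, `H_3 = q̄ - p`. -/
def opH (n : ℕ) : Fin 4 → Module.End ℂ (CliffordFormAt Q T) :=
  ![degree Q J θ 0 + degree Q J θ 2 - (n : ℂ) • 1,
    degree Q J θ 1 - degree Q J θ 2,
    (n : ℂ) • 1 - degree Q J θ 1 - degree Q J θ 3,
    degree Q J θ 3 - degree Q J θ 0]

variable (Q) in
/-- The component of degree `(p, p̄, q, q̄)`: the span of the `a ⊗ α` with `a` of bidegree `(p, p̄)`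
and `α` of bidegree `(q, q̄)`. -/
def component (p p' q q' : ℕ) : Submodule ℂ (CliffordFormAt Q T) :=
  Submodule.map₂ (TensorProduct.mk ℂ (Cl Q) (Forms T))
    ((bidegree (projI J) p p').comap (CliffordAlgebra.equivExterior (Q.baseChange ℂ)).toLinearMap)
    (bidegree (projI (cotangentJ J θ)) q q')

/-- The full vielbein `θ + θ̄`. -/
def thetaReal : CliffordFormAt Q T := vielbeinPart Q θ 1

/-- The operators `E`, `E'` (indices `0`, `1`) of the action of `sl₂ × sl₂`. -/
def realE : Fin 2 → Module.End ℂ (CliffordFormAt Q T) :=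
  ![halfPlus (thetaReal θ), conjBy (star₁ T ν) (halfPlus (thetaReal θ))]

/-- The operators `F`, `F'` (indices `0`, `1`) of the action of `sl₂ × sl₂`. -/
def realF : Fin 2 → Module.End ℂ (CliffordFormAt Q T) :=
  ![conjBy (star₁ T ν) (conjBy (star₂ θ hQ ν) (halfPlus (thetaReal θ))),
    conjBy (star₂ θ hQ ν) (halfPlus (thetaReal θ))]

variable (Q T) in
/-- The operators `H = (Clifford degree) + (form degree) - dim W` and
`H' = (form degree) - (Clifford degree)` (indices `0`, `1`) of the action of `sl₂ × sl₂`. -/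
def realH : Fin 2 → Module.End ℂ (CliffordFormAt Q T) :=
  ![cliffordDegree Q 1 + formDegree Q 1 - (Module.finrank ℝ W : ℂ) • 1,
    formDegree Q 1 - cliffordDegree Q 1]

end Point

/-! ### Clifford forms on a manifold -/

section Manifold

variable (E : Type*) [NormedAddCommGroup E] [NormedSpace ℝ E]
variable (M : Type*) [TopologicalSpace M] [ChartedSpace E M] [IsManifold 𝓘(ℝ, E) ∞ M]
variable {W : Type*} [AddCommGroup W] [Module ℝ W]

/-- The isomorphism of the model space with the tangent space at a point `m` near `m₀` given by the
preferred chart at `m₀`. -/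
def localFrame (m₀ m : M) : E →ₗ[ℝ] TangentSpace 𝓘(ℝ, E) m :=
  ((trivializationAt E (TangentSpace 𝓘(ℝ, E)) m₀).symmL ℝ m).toLinearMap

variable (W) in
/-- A smooth `W`-valued one-form that is an isomorphism at each point. -/
structure Vielbein where
  /-- the value at a point -/
  toEquiv : ∀ m : M, TangentSpace 𝓘(ℝ, E) m ≃ₗ[ℝ] W
  smooth : ∀ (m₀ : M) (u : E) (f : Module.Dual ℝ W),
    ContMDiffAt 𝓘(ℝ, E) 𝓘(ℝ, ℝ) ∞ (fun m => f (toEquiv m (localFrame E M m₀ m u))) m₀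

/-- Pullback of forms along a linear map. -/
def pullback {T T' : Type*} [AddCommGroup T] [Module ℝ T] [AddCommGroup T'] [Module ℝ T']
    (Q : QuadraticForm ℝ W) (f : T →ₗ[ℝ] T') : CliffordFormAt Q T' →ₗ[ℂ] CliffordFormAt Q T :=
  LinearMap.lTensor (Cl Q) (ExteriorAlgebra.map (f.dualMap.baseChange ℂ)).toLinearMap

/-- The space of Clifford forms on `M`: the smooth sections of the bundle with fibre
`CliffordFormAt Q (T_m M)`. Smoothness is that of all coefficients in the local frames. -/
def cliffordForms (Q : QuadraticForm ℝ W) :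
    Submodule ℂ (∀ m : M, CliffordFormAt Q (TangentSpace 𝓘(ℝ, E) m)) where
  carrier := {x | ∀ (m₀ : M) (f : Module.Dual ℂ (CliffordFormAt Q E)),
    ContMDiffAt 𝓘(ℝ, E) 𝓘(ℝ, ℂ) ∞ (fun m => f (pullback Q (localFrame E M m₀ m) (x m))) m₀}
  add_mem' hx hy m₀ f := by
    have h := (hx m₀ f).add (hy m₀ f)
    refine h.congr_of_eventuallyEq (Filter.Eventually.of_forall fun m => ?_)
    simp
  zero_mem' m₀ f := by
    simpa using contMDiffAt_const
  smul_mem' c x hx m₀ f := by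
    have h := ((contDiff_const_smul (𝕜 := ℝ) (F := ℂ) (n := ∞) c).contMDiff.contMDiffAt).comp m₀
      (hx m₀ f)
    refine h.congr_of_eventuallyEq (Filter.Eventually.of_forall fun m => ?_)
    simp

variable {E M}

/-- The operator `S` on Clifford forms acts at each point `m` through the operator `A m`. -/
def ActsBy {Q : QuadraticForm ℝ W} (S : Module.End ℂ (cliffordForms E M Q))
    (A : ∀ m : M, Module.End ℂ (CliffordFormAt Q (TangentSpace 𝓘(ℝ, E) m))) : Prop :=
  ∀ (x : cliffordForms E M Q) (m : M), (S x).1 m = A m (x.1 m)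

end Manifold

/-! ### The affine Lie algebra -/

section Affine

/-- The Cartan matrix of the affine Lie algebra of `sl₄` (type `A₃⁽¹⁾`). -/
def affineCartan : Matrix (Fin 4) (Fin 4) ℤ :=
  !![2, -1, 0, -1; -1, 2, -1, 0; 0, -1, 2, -1; -1, 0, -1, 2]

/-- The affine Lie algebra of `sl₄` (without the degree derivation), given by its Chevalley
generators and the Chevalley-Serre relations. -/
abbrev AffineSl4 : Type := Matrix.ToLieAlgebra ℂ affineCartan

/-- The image in `AffineSl4` of a Chevalley generator. -/
def AffineSl4.gen (g : CartanMatrix.Generators (Fin 4)) : AffineSl4 :=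
  LieSubmodule.Quotient.mk (N := CartanMatrix.Relations.toIdeal ℂ affineCartan)
    (FreeLieAlgebra.of ℂ g)

/-- The Chevalley generators `e_i`. -/
def AffineSl4.e (i : Fin 4) : AffineSl4 := AffineSl4.gen (.E i)

/-- The Chevalley generators `f_i`. -/
def AffineSl4.f (i : Fin 4) : AffineSl4 := AffineSl4.gen (.F i)

/-- The Chevalley generators `h_i`. -/
def AffineSl4.h (i : Fin 4) : AffineSl4 := AffineSl4.gen (.H i)

/-- The Chevalley-Serre relations for the Cartan matrix `A`. -/
structure ChevalleySerre {L : Type*} [LieRing L] {ι : Type*} (A : Matrix ι ι ℤ)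
    (e f h : ι → L) : Prop where
  lie_h_h : ∀ i j, ⁅h i, h j⁆ = 0
  lie_e_f_same : ∀ i, ⁅e i, f i⁆ = h i
  lie_e_f_ne : ∀ i j, i ≠ j → ⁅e i, f j⁆ = 0
  lie_h_e : ∀ i j, ⁅h i, e j⁆ = A i j • e j
  lie_h_f : ∀ i j, ⁅h i, f j⁆ = -(A i j • f j)
  serre_e : ∀ i j, i ≠ j → (fun x => ⁅e i, x⁆)^[(1 - A i j).toNat] (e j) = 0
  serre_f : ∀ i j, i ≠ j → (fun x => ⁅f i, x⁆)^[(1 - A i j).toNat] (f j) = 0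

/-- The Lie algebra `sl₂`. -/
abbrev Sl2 : Type := LieAlgebra.SpecialLinear.sl (Fin 2) ℂ

/-- The standard generator `e` of `sl₂`. -/
def Sl2.e : Sl2 := ⟨!![0, 1; 0, 0], by simp [LieAlgebra.SpecialLinear.sl, Matrix.trace]⟩

/-- The standard generator `f` of `sl₂`. -/
def Sl2.f : Sl2 := ⟨!![0, 0; 1, 0], by simp [LieAlgebra.SpecialLinear.sl, Matrix.trace]⟩

/-- The standard generator `h` of `sl₂`. -/
def Sl2.h : Sl2 := ⟨!![1, 0; 0, -1], by simp [LieAlgebra.SpecialLinear.sl, Matrix.trace]⟩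

end Affine

end CliffordForms
end

attribute [local instance 100] LieRing.ofAssociativeRing

/-! Everything reduces to quadratic expressions in fermionic operators. On the Clifford factor, `v ∧
·` and `v ⊢ ·` become exterior multiplication by `v` and contraction with `η(v, ·)` under the
canonical isomorphism with the exterior algebra. They therefore satisfy the canonical
anticommutation relations for `η`. The scalar forms carry a second such pair, indexed by the same
vectors through the vielbein and the metric, and operators on different factors commute. The
identity `v ∧ (* a) = * (v ⊢ a)` says that conjugation by a star exchanges creation for annihilation
on its factor and leaves the other factor alone.

Hence each `E_i` and `F_i` is a contraction `∑ a (A e_k) b (e^k)`, with `a` and `b` a creation or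
annihilation operator on the first and second factor, and `A` either `P = (1 - iJ)/2` or `1 - P`
(`opE_eq_carE`, `opF_eq_carF`). The degrees are number operators (`degree_eq_carDeg`). One
commutator formula, `lie_mul_mul`, summed over dual bases in `lie_casimir`, then yields all the
relations: - `[E_i, F_i]` contracts in both factors; normal ordering produces number operators and
the constant `tr P = n`. - For `i ≠ j`, `[E_i, F_j]` contracts in at most one factor. Since `P` has
adjoint `1 - P`, what is left contains `P (1 - P)` or `(1 - P) P`, which vanish. The same products
kill the brackets of opposite `E`s and of opposite `F`s. - Neighbouring `E`s, or `F`s, have the same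
kind of operator on one factor. Their bracket is a combination of products of two such operators,
and these commute with the `E`s or `F`s concerned: this is the Serre relation.

The real operators are the same contractions with `A = 1 = P + (1 - P)`. This gives the sum
formulas, and `isSl2Pair_car` gives the two commuting `sl₂`-triples.

On the manifold, the relations hold pointwise and pass to sections by `ActsBy.unique`. Preservation
of smoothness follows by expanding the contractions in a local frame; annihilation on forms needs
the smoothness of the inverse vielbein (`Vielbein.exists_smooth_symm`). The presentations of the Lie
algebras then give the homomorphisms. The embedding holds because `H` and `H'` are linearly
independent, as seen on the sections `1 ⊗ 1` and `v ⊗ 1`. -/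

noncomputable section

namespace CliffordForms

/-! ### Contractions over dual families and their commutators -/

section Casimir

variable {X ι R : Type*} [AddCommGroup X] [Module ℂ X] [Fintype ι] [Ring R] [Algebra ℂ R]

/-- Two families of vectors that are dual to each other for a symmetric bilinear form. -/
structure IsDualPair (η : LinearMap.BilinForm ℂ X) (e e' : ι → X) : Prop where
  symm : ∀ x y, η x y = η y x
  sum_left : ∀ x, ∑ i, η (e' i) x • e i = x
  sum_right : ∀ x, ∑ i, η (e i) x • e' i = x

variable {η : LinearMap.BilinForm ℂ X} {e e' : ι → X}

/-- The tensor `∑ e_i ⊗ e'_i` is the inverse of the form `η`, so it is symmetric because `η` is. -/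
theorem IsDualPair.sum_swap (h : IsDualPair η e e') {N : Type*} [AddCommGroup N] [Module ℂ N]
    (f : X →ₗ[ℂ] X →ₗ[ℂ] N) : ∑ i, f (e i) (e' i) = ∑ i, f (e' i) (e i) := by
  calc ∑ i, f (e i) (e' i) = ∑ i, ∑ j, η (e' j) (e' i) • f (e i) (e j) := by
        refine Finset.sum_congr rfl fun i _ => ?_
        conv_lhs => rw [← h.sum_left (e' i)]
        simp
    _ = ∑ j, ∑ i, η (e' i) (e' j) • f (e i) (e j) := by
        rw [Finset.sum_comm]
        simp_rw [h.symm]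
    _ = _ := by
        refine Finset.sum_congr rfl fun i _ => ?_
        conv_rhs => rw [← h.sum_left (e' i)]
        simp

/-- Expanding in the dual families turns an endomorphism on one leg of the canonical tensor into its
adjoint on the other leg. This makes contractions with `P` on either leg comparable. -/
theorem IsDualPair.sum_adjoint (h : IsDualPair η e e') {N : Type*} [AddCommGroup N] [Module ℂ N]
    (f : X →ₗ[ℂ] X →ₗ[ℂ] N) {A A' : Module.End ℂ X} (hA : ∀ x y, η (A x) y = η x (A' y)) :
    ∑ i, f (A (e i)) (e' i) = ∑ i, f (e i) (A' (e' i)) := by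
  calc ∑ i, f (A (e i)) (e' i) = ∑ i, ∑ j, η (e' j) (A (e i)) • f (e j) (e' i) := by
        refine Finset.sum_congr rfl fun i _ => ?_
        conv_lhs => rw [← h.sum_left (A (e i))]
        simp
    _ = ∑ j, ∑ i, η (e i) (A' (e' j)) • f (e j) (e' i) := by
        rw [Finset.sum_comm]
        simp_rw [h.symm (e' _) (A _), hA]
    _ = _ := by
        refine Finset.sum_congr rfl fun i _ => ?_
        conv_rhs => rw [← h.sum_right (A' (e' i))]
        simp

/-- The contraction `∑ a (A e_i) b (e^i)` of two operator-valued linear maps. -/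
def casimir (e e' : ι → X) (a b : X →ₗ[ℂ] R) : Module.End ℂ X →ₗ[ℂ] R :=
  ∑ i, LinearMap.mulRight ℂ (b (e' i)) ∘ₗ a ∘ₗ LinearMap.applyₗ (e i)

theorem casimir_apply (a b : X →ₗ[ℂ] R) (A : Module.End ℂ X) :
    casimir e e' a b A = ∑ i, a (A (e i)) * b (e' i) := by
  simp [casimir]

/-- The bilinear map `(x, y) ↦ a x * b y`. -/
def mulForm (a b : X →ₗ[ℂ] R) : X →ₗ[ℂ] X →ₗ[ℂ] R := (LinearMap.mul ℂ R).compl₁₂ a b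

@[simp] theorem mulForm_apply (a b : X →ₗ[ℂ] R) (x y : X) : mulForm a b x y = a x * b y := rfl

/-- The commutator of two quadratic expressions with anticommutators given by `s` and `t`. -/
theorem lie_mul_mul {a b c d : R} {s t : ℂ} (hac : a * c + c * a = algebraMap ℂ R s)
    (hbd : b * d + d * b = algebraMap ℂ R t) (had : Commute a d) (hcb : Commute c b) :
    ⁅a * b, c * d⁆ = algebraMap ℂ R (s * t) - t • (c * a) - s • (d * b) := by
  -- Both products are regrouped by factor. Substituting `a c = s - c a` and `b d = t - d b` then
  -- makes the quartic terms cancel.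
  have h1 : a * b * (c * d) = (a * c) * (b * d) := by
    rw [mul_assoc, ← mul_assoc b c d, ← hcb.eq, mul_assoc, mul_assoc]
  have h2 : c * d * (a * b) = (c * a) * (d * b) := by
    rw [mul_assoc, ← mul_assoc d a b, ← had.eq, mul_assoc, mul_assoc]
  rw [Ring.lie_def, h1, h2, eq_sub_of_add_eq hac, eq_sub_of_add_eq hbd, map_mul,
    Algebra.algebraMap_eq_smul_one, Algebra.algebraMap_eq_smul_one]
  simp only [sub_mul, mul_sub, smul_mul_assoc, mul_smul_comm, one_mul, mul_one]
  module

/-- Hypotheses: `a`, `c` act on one factor with anticommutator `s`, and `b`, `d` act on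
another factor with anticommutator `t`. -/
structure AntiPair (s t : LinearMap.BilinForm ℂ X) (a b c d : X →ₗ[ℂ] R) : Prop where
  left : ∀ x y, a x * c y + c y * a x = algebraMap ℂ R (s x y)
  right : ∀ x y, b x * d y + d y * b x = algebraMap ℂ R (t x y)
  comm_ad : ∀ x y, Commute (a x) (d y)
  comm_cb : ∀ x y, Commute (c x) (b y)

variable {s t : LinearMap.BilinForm ℂ X} {a b c d : X →ₗ[ℂ] R} {A A' B B' : Module.End ℂ X}

theorem lie_casimir (H : AntiPair s t a b c d) :
    ⁅casimir e e' a b A, casimir e e' c d B⁆ =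
      ∑ i, ∑ j, (algebraMap ℂ R (s (A (e i)) (B (e j)) * t (e' i) (e' j)) -
        t (e' i) (e' j) • (c (B (e j)) * a (A (e i))) -
        s (A (e i)) (B (e j)) • (d (e' j) * b (e' i))) := by
  rw [casimir_apply, casimir_apply, LieRing.of_associative_ring_bracket, Finset.sum_mul_sum,
    Finset.sum_mul_sum, Finset.sum_comm (f := fun i j => c (B (e i)) * d (e' i) * _),
    ← Finset.sum_sub_distrib]
  refine Finset.sum_congr rfl fun i _ => ?_
  rw [← Finset.sum_sub_distrib]
  refine Finset.sum_congr rfl fun j _ => ?_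
  exact lie_mul_mul (H.left _ _) (H.right _ _) (H.comm_ad _ _) (H.comm_cb _ _)

theorem lie_casimir_zero_zero (H : AntiPair 0 0 a b c d) :
    ⁅casimir e e' a b A, casimir e e' c d B⁆ = 0 := by
  rw [lie_casimir H]
  simp

/-- The inner sum collapses: `∑ j, η (A (e i)) (B (e j)) • e' j = B' (A (e i))`. -/
theorem IsDualPair.sum_first (h : IsDualPair η e e') (hB : ∀ x y, η (B x) y = η x (B' y)) :
    ∑ i, ∑ j, η (A (e i)) (B (e j)) • (d (e' j) * b (e' i)) = casimir e e' d b (B' * A) := by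
  rw [casimir_apply]
  refine Finset.sum_congr rfl fun i _ => ?_
  conv_rhs => rw [Module.End.mul_apply, ← h.sum_right (B' (A (e i)))]
  simp only [map_sum, map_smul, Finset.sum_mul, smul_mul_assoc]
  refine Finset.sum_congr rfl fun j _ => ?_
  rw [h.symm, hB]

/-- Here `∑ j, η (e' i) (e' j) • e j = e' i` leaves dual vectors under `c` and `A` under `a`. Moving
`A` across as its adjoint and swapping the two legs restores the standard order. -/
theorem IsDualPair.sum_second (h : IsDualPair η e e') (hA : ∀ x y, η (A x) y = η x (A' y)) :
    ∑ i, ∑ j, η (e' i) (e' j) • (c (B (e j)) * a (A (e i))) = casimir e e' c a (B * A') := by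
  have h1 := h.sum_adjoint (mulForm (c ∘ₗ B) a).flip hA
  have h2 := h.sum_swap (mulForm (c ∘ₗ B ∘ₗ A') a).flip
  simp only [LinearMap.flip_apply, mulForm_apply, LinearMap.comp_apply] at h1 h2
  rw [casimir_apply]
  simp only [Module.End.mul_apply]
  rw [← h2, ← h1]
  refine Finset.sum_congr rfl fun i _ => ?_
  conv_rhs => rw [← h.sum_left (e' i)]
  simp only [map_sum, map_smul, Finset.sum_mul, smul_mul_assoc]
  refine Finset.sum_congr rfl fun j _ => ?_
  rw [h.symm]

theorem IsDualPair.sum_trace (h : IsDualPair η e e') (hB : ∀ x y, η (B x) y = η x (B' y)) :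
    ∑ i, ∑ j, η (A (e i)) (B (e j)) * η (e' i) (e' j) = ∑ i, η ((B' * A) (e i)) (e' i) := by
  refine Finset.sum_congr rfl fun i _ => ?_
  conv_rhs => rw [Module.End.mul_apply, h.symm, ← hB, ← h.sum_left (e' i)]
  simp only [map_sum, map_smul, LinearMap.sum_apply, LinearMap.smul_apply, smul_eq_mul]
  refine Finset.sum_congr rfl fun j _ => ?_
  rw [h.symm (A _), h.symm (e' i), mul_comm]

theorem IsDualPair.lie_casimir_left (h : IsDualPair η e e') (H : AntiPair η 0 a b c d)
    (hB : ∀ x y, η (B x) y = η x (B' y)) :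
    ⁅casimir e e' a b A, casimir e e' c d B⁆ = -casimir e e' d b (B' * A) := by
  rw [lie_casimir H, ← h.sum_first hB]
  simp

theorem IsDualPair.lie_casimir_right (h : IsDualPair η e e') (H : AntiPair 0 η a b c d)
    (hA : ∀ x y, η (A x) y = η x (A' y)) :
    ⁅casimir e e' a b A, casimir e e' c d B⁆ = -casimir e e' c a (B * A') := by
  rw [lie_casimir H, ← h.sum_second hA]
  simp

/-- When both factors contract, the double contraction is a trace, and each single contraction
leaves a bilinear in the operators of one factor. The trace is the origin of the shifts by `n` in
the Cartan operators. -/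
theorem IsDualPair.lie_casimir_both (h : IsDualPair η e e') (H : AntiPair η η a b c d)
    (hA : ∀ x y, η (A x) y = η x (A' y)) (hB : ∀ x y, η (B x) y = η x (B' y)) :
    ⁅casimir e e' a b A, casimir e e' c d B⁆ =
      algebraMap ℂ R (∑ i, η ((B' * A) (e i)) (e' i)) - casimir e e' c a (B * A') -
        casimir e e' d b (B' * A) := by
  rw [lie_casimir H, ← h.sum_first hB, ← h.sum_second hA, ← h.sum_trace hB]
  simp [Finset.sum_sub_distrib]

theorem commute_mul_of_anticommute {S : Type*} [Ring S] {x y z : S} (hx : z * x + x * z = 0)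
    (hy : z * y + y * z = 0) :
    Commute z (x * y) := by
  have h1 := eq_neg_of_add_eq_zero_left hx
  have h2 := eq_neg_of_add_eq_zero_left hy
  rw [Commute, SemiconjBy, ← mul_assoc, h1, neg_mul, mul_assoc, h2, mul_neg, neg_neg, mul_assoc]

/-- The Serre relation for two operators that share their action on the first factor. -/
theorem serre_casimir_left (H : AntiPair 0 t a b a d) (hab : ∀ x y, Commute (a x) (b y)) :
    ⁅casimir e e' a b A, ⁅casimir e e' a b A, casimir e e' a d B⁆⁆ = 0 := by
  -- As the shared operators anticommute with each other, only the second factor contracts and the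
  -- inner bracket is a sum of multiples of products `a x * a y`. An even product of this kind
  -- commutes with every `a` and every `b`.
  have key : ∀ x y, Commute (casimir e e' a b A) (a x * a y) := fun x y => by
    rw [casimir_apply]
    refine Commute.sum_left _ _ _ fun i _ => Commute.mul_left ?_ ?_
    · exact commute_mul_of_anticommute (by simpa using H.left _ _) (by simpa using H.left _ _)
    · exact ((hab _ _).symm).mul_right (hab _ _).symm
  rw [lie_casimir H, ← commute_iff_lie_eq]
  refine Commute.sum_right _ _ _ fun i _ => Commute.sum_right _ _ _ fun j _ => ?_
  simp only [LinearMap.zero_apply, zero_mul, map_zero, zero_smul, sub_zero, zero_sub]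
  exact ((key _ _).smul_right _).neg_right

/-- The Serre relation for two operators that share their action on the second factor. -/
theorem serre_casimir_right (H : AntiPair s 0 a b c b) (hab : ∀ x y, Commute (a x) (b y)) :
    ⁅casimir e e' a b A, ⁅casimir e e' a b A, casimir e e' c b B⁆⁆ = 0 := by
  have key : ∀ x y, Commute (casimir e e' a b A) (b x * b y) := fun x y => by
    rw [casimir_apply]
    refine Commute.sum_left _ _ _ fun i _ => Commute.mul_left ?_ ?_
    · exact (hab _ _).mul_right (hab _ _)
    · exact commute_mul_of_anticommute (by simpa using H.right _ _) (by simpa using H.right _ _)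
  rw [lie_casimir H, ← commute_iff_lie_eq]
  refine Commute.sum_right _ _ _ fun i _ => Commute.sum_right _ _ _ fun j _ => ?_
  simp only [LinearMap.zero_apply, mul_zero, map_zero, zero_smul, sub_zero, zero_sub]
  exact ((key _ _).smul_right _).neg_right

/-- `⁅N, ·⁆` is a derivation, so an `N` that sees only the first factor acts through its
endomorphism `C` there. This and its mirror image compute the weights of the `E`s and `F`s. -/
theorem lie_casimir_of_lie_left {N : R} {C : Module.End ℂ X} (ha : ∀ x, ⁅N, a x⁆ = a (C x))
    (hb : ∀ x, ⁅N, b x⁆ = 0) : ⁅N, casimir e e' a b A⁆ = casimir e e' a b (C * A) := by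
  rw [casimir_apply, casimir_apply, lie_sum]
  refine Finset.sum_congr rfl fun i _ => ?_
  have h1 := ha (A (e i))
  have h2 := hb (e' i)
  rw [Ring.lie_def] at h1 h2 ⊢
  rw [Module.End.mul_apply, ← h1, sub_mul, mul_assoc (a _) N, sub_eq_zero.1 h2]
  simp only [mul_assoc]

theorem IsDualPair.lie_casimir_of_lie_right (h : IsDualPair η e e') {N : R}
    {C C' : Module.End ℂ X} (hC : ∀ x y, η (C' x) y = η x (C y)) (ha : ∀ x, ⁅N, a x⁆ = 0)
    (hb : ∀ x, ⁅N, b x⁆ = b (C x)) : ⁅N, casimir e e' a b A⁆ = casimir e e' a b (A * C') := by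
  have h3 := h.sum_adjoint (mulForm (a ∘ₗ A) b) hC
  simp only [mulForm_apply, LinearMap.comp_apply] at h3
  rw [casimir_apply, casimir_apply, lie_sum]
  simp only [Module.End.mul_apply]
  rw [h3]
  refine Finset.sum_congr rfl fun i _ => ?_
  have h1 := ha (A (e i))
  have h2 := hb (e' i)
  rw [Ring.lie_def] at h1 h2 ⊢
  rw [← h2, mul_sub, ← mul_assoc (a _) N, ← sub_eq_zero.1 h1]
  simp only [mul_assoc]

/-- The operators `w`, `i` satisfy the canonical anticommutation relations. -/
structure IsCAR (η : LinearMap.BilinForm ℂ X) (w i : X →ₗ[ℂ] R) : Prop where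
  ww : ∀ x y, w x * w y + w y * w x = 0
  ii : ∀ x y, i x * i y + i y * i x = 0
  wi : ∀ x y, w x * i y + i y * w x = algebraMap ℂ R (η x y)

variable {w i w' i' : X →ₗ[ℂ] R}

/-- `casimir e e' w i C` is the second quantization of `C`: commuting `w x` past `i (e' k)` leaves
`η`, and the dual expansion of `x` reassembles `w (C x)`. On annihilation operators it acts by minus
the adjoint. -/
theorem IsDualPair.lie_number_w (h : IsDualPair η e e') (H : IsCAR η w i) (C : Module.End ℂ X)
    (x : X) : ⁅casimir e e' w i C, w x⁆ = w (C x) := by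
  conv_rhs => rw [← h.sum_left x]
  rw [casimir_apply, sum_lie]
  simp only [map_sum, map_smul]
  refine Finset.sum_congr rfl fun k _ => ?_
  have h1 := H.wi x (e' k)
  have h2 := eq_neg_of_add_eq_zero_left (H.ww x (C (e k)))
  rw [Ring.lie_def, mul_assoc, eq_sub_of_add_eq' h1, ← mul_assoc (w x), h2, h.symm, mul_sub,
    Algebra.algebraMap_eq_smul_one, mul_smul_comm, mul_one, neg_mul, mul_assoc]
  abel

theorem IsDualPair.lie_number_i (h : IsDualPair η e e') (H : IsCAR η w i) {C C' : Module.End ℂ X}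
    (hC : ∀ x y, η (C x) y = η x (C' y)) (x : X) :
    ⁅casimir e e' w i C, i x⁆ = -i (C' x) := by
  conv_rhs => rw [← h.sum_right (C' x)]
  rw [casimir_apply, sum_lie]
  simp only [map_sum, map_smul, ← Finset.sum_neg_distrib]
  refine Finset.sum_congr rfl fun k _ => ?_
  have h1 := H.wi (C (e k)) x
  have h2 := eq_neg_of_add_eq_zero_left (H.ii (e' k) x)
  rw [Ring.lie_def, mul_assoc, h2, mul_neg, ← mul_assoc, ← mul_assoc, eq_sub_of_add_eq h1, ← hC,
    sub_mul, Algebra.algebraMap_eq_smul_one, smul_mul_assoc, one_mul]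
  abel

/-- Two pairs of operators with canonical anticommutation relations, acting on the two factors
of a tensor product. -/
structure IsDoubleCAR (η : LinearMap.BilinForm ℂ X) (w i w' i' : X →ₗ[ℂ] R) : Prop where
  fst : IsCAR η w i
  snd : IsCAR η w' i'
  ww : ∀ x y, Commute (w x) (w' y)
  wi : ∀ x y, Commute (w x) (i' y)
  iw : ∀ x y, Commute (i x) (w' y)
  ii : ∀ x y, Commute (i x) (i' y)

end Casimir

/-! ### The affine relations for two commuting fermionic systems -/

section DoubleCAR

variable {X ι R : Type*} [AddCommGroup X] [Module ℂ X] [Fintype ι] [Ring R] [Algebra ℂ R]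
variable {η : LinearMap.BilinForm ℂ X} {e e' : ι → X} {w i w' i' : X →ₗ[ℂ] R}
  {A A' B B' P : Module.End ℂ X}

theorem IsCAR.anti_ww (H : IsCAR η w i) (x y : X) :
    w x * w y + w y * w x = algebraMap ℂ R ((0 : LinearMap.BilinForm ℂ X) x y) := by
  simpa using H.ww x y

theorem IsCAR.anti_ii (H : IsCAR η w i) (x y : X) :
    i x * i y + i y * i x = algebraMap ℂ R ((0 : LinearMap.BilinForm ℂ X) x y) := by
  simpa using H.ii x y

theorem IsCAR.anti_iw (H : IsCAR η w i) (h : IsDualPair η e e') (x y : X) :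
    i x * w y + w y * i x = algebraMap ℂ R (η x y) := by
  rw [add_comm, H.wi, h.symm]

/-- Normal ordering: interchanging the operators under each term costs `η (A (e k)) (e' k)`, whose
sum is the trace of `A`, while `A` passes to its adjoint on the other leg. -/
theorem IsDualPair.casimir_iw (h : IsDualPair η e e') (H : IsCAR η w i)
    (hA : ∀ x y, η (A' x) y = η x (A y)) :
    casimir e e' i w A = algebraMap ℂ R (∑ k, η (A (e k)) (e' k)) - casimir e e' w i A' := by
  have h1 := h.sum_adjoint (mulForm w i) hA
  have h2 := h.sum_swap (mulForm w (i ∘ₗ A))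
  simp only [mulForm_apply, LinearMap.comp_apply] at h1 h2
  rw [casimir_apply, casimir_apply, h1, h2, map_sum, ← Finset.sum_sub_distrib]
  refine Finset.sum_congr rfl fun k _ => ?_
  rw [← H.anti_iw h]
  abel

/-- An expression antisymmetric in its two arguments vanishes when contracted with the symmetric
tensor `∑ e_k ⊗ e'_k`. -/
theorem IsDualPair.casimir_one_eq_zero (h : IsDualPair η e e') {a : X →ₗ[ℂ] R}
    (ha : ∀ x y, a x * a y + a y * a x = 0) : casimir e e' a a 1 = 0 := by
  have h2 := h.sum_swap (mulForm a a)
  simp only [mulForm_apply] at h2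
  rw [casimir_apply]
  simp only [Module.End.one_apply]
  have h3 : (2 : ℂ) • ∑ k, a (e k) * a (e' k) = 0 := by
    rw [two_smul]
    conv_lhs => rw [h2]
    conv_lhs => arg 1; rw [← h2]
    rw [← Finset.sum_add_distrib]
    exact Finset.sum_eq_zero fun k _ => ha _ _
  exact (smul_eq_zero.1 h3).resolve_left two_ne_zero

/-- A projection whose image and kernel are isotropic for `η`. -/
structure IsPolarization (η : LinearMap.BilinForm ℂ X) (P : Module.End ℂ X) : Prop where
  idem : P * P = P
  adjoint : ∀ x y, η (P x) y = η x ((1 - P) y)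

theorem IsPolarization.adjoint' (hP : IsPolarization η P) (x y : X) :
    η ((1 - P) x) y = η x (P y) := by
  have h := hP.adjoint x y
  simp only [LinearMap.sub_apply, Module.End.one_apply, map_sub] at h ⊢
  rw [h]
  ring

theorem IsPolarization.mul_compl (hP : IsPolarization η P) : P * (1 - P) = 0 := by
  rw [mul_sub, mul_one, hP.idem, sub_self]

theorem IsPolarization.compl_mul (hP : IsPolarization η P) : (1 - P) * P = 0 := by
  rw [sub_mul, one_mul, hP.idem, sub_self]

theorem IsPolarization.compl_idem (hP : IsPolarization η P) : (1 - P) * (1 - P) = 1 - P := by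
  rw [mul_sub, hP.compl_mul, mul_one, sub_zero]

/-- `P` and `1 - P` are adjoint, hence have equal traces, and these add up to `2 n`. -/
theorem IsPolarization.trace (hP : IsPolarization η P) (h : IsDualPair η e e') {n : ℕ}
    (hn : ∑ k, η (e k) (e' k) = 2 * n) : ∑ k, η (P (e k)) (e' k) = n := by
  have h1 := h.sum_adjoint η hP.adjoint
  have h2 := h.sum_swap (η.compl₁₂ LinearMap.id (1 - P))
  simp only [LinearMap.compl₁₂_apply, LinearMap.id_apply] at h2
  have h3 : ∑ k, η (P (e k)) (e' k) = ∑ k, η ((1 - P) (e k)) (e' k) := by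
    rw [h1, h2]
    exact Finset.sum_congr rfl fun k _ => h.symm _ _
  have h4 : ∑ k, η (P (e k)) (e' k) + ∑ k, η ((1 - P) (e k)) (e' k) = 2 * n := by
    rw [← hn, ← Finset.sum_add_distrib]
    exact Finset.sum_congr rfl fun k _ => by simp
  rw [← h3] at h4
  linear_combination h4 / 2

theorem IsPolarization.trace' (hP : IsPolarization η P) (h : IsDualPair η e e') {n : ℕ}
    (hn : ∑ k, η (e k) (e' k) = 2 * n) : ∑ k, η ((1 - P) (e k)) (e' k) = n := by
  have h1 := hP.trace h hn
  simp only [LinearMap.sub_apply, Module.End.one_apply, map_sub, Finset.sum_sub_distrib, hn, h1]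
  ring

variable (e e' w i w' i' P) in
/-- The raising operators, in terms of creation and annihilation operators. -/
def carE : Fin 4 → R :=
  ![casimir e e' w w' P, casimir e e' w i' (1 - P), casimir e e' i i' P, casimir e e' i w' (1 - P)]

variable (e e' w i w' i' P) in
/-- The lowering operators, in terms of creation and annihilation operators. -/
def carF : Fin 4 → R :=
  ![casimir e e' i i' (1 - P), casimir e e' i w' P, casimir e e' w w' (1 - P), casimir e e' w i' P]

variable (e e' w i w' i' P) in
/-- The number operators. -/
def carDeg : Fin 4 → R :=
  ![casimir e e' w i P, casimir e e' w i (1 - P), casimir e e' w' i' (1 - P), casimir e e' w' i' P]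

variable (e e' w i w' i' P) in
/-- The Cartan operators. -/
def carH (n : ℕ) : Fin 4 → R :=
  let d := carDeg e e' w i w' i' P
  ![d 0 + d 2 - (n : ℂ) • 1, d 1 - d 2, (n : ℂ) • 1 - d 1 - d 3, d 3 - d 0]

/-- Both factors contract for each pair. Terms that come out as annihilation times creation are
normal ordered, and their traces `n` combine with the double contraction: the constants add up to
`-n`, `0`, `n`, `0` for the four nodes. -/
theorem lie_carE_carF_same (H : IsDoubleCAR η w i w' i') (h : IsDualPair η e e')
    (hP : IsPolarization η P) {n : ℕ} (hn : ∑ k, η (e k) (e' k) = 2 * n) (j : Fin 4) :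
    ⁅carE e e' w i w' i' P j, carF e e' w i w' i' P j⁆ = carH e e' w i w' i' P n j := by
  have t := hP.trace h hn
  have t' := hP.trace' h hn
  have a := hP.adjoint
  have a' := hP.adjoint'
  fin_cases j
  · change ⁅casimir e e' w w' P, casimir e e' i i' (1 - P)⁆ =
      casimir e e' w i P + casimir e e' w' i' (1 - P) - (n : ℂ) • 1
    rw [h.lie_casimir_both ⟨H.fst.wi, H.snd.wi, H.wi, H.iw⟩ a a', hP.compl_idem, hP.idem,
      h.casimir_iw H.fst a, h.casimir_iw H.snd a', t, t', Algebra.algebraMap_eq_smul_one]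
    abel
  · change ⁅casimir e e' w i' (1 - P), casimir e e' i w' P⁆ =
      casimir e e' w i (1 - P) - casimir e e' w' i' (1 - P)
    rw [h.lie_casimir_both ⟨H.fst.wi, H.snd.anti_iw h, H.ww, H.ii⟩ a' a, hP.compl_idem, hP.idem,
      h.casimir_iw H.fst a', t, t']
    abel
  · change ⁅casimir e e' i i' P, casimir e e' w w' (1 - P)⁆ =
      (n : ℂ) • 1 - casimir e e' w i (1 - P) - casimir e e' w' i' P
    rw [h.lie_casimir_both ⟨H.fst.anti_iw h, H.snd.anti_iw h, H.iw, H.wi⟩ a a', hP.compl_idem,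
      hP.idem, t, Algebra.algebraMap_eq_smul_one]
  · change ⁅casimir e e' i w' (1 - P), casimir e e' w i' P⁆ =
      casimir e e' w' i' P - casimir e e' w i P
    rw [h.lie_casimir_both ⟨H.fst.anti_iw h, H.snd.wi, H.ii, H.ww⟩ a' a, hP.compl_idem, hP.idem,
      h.casimir_iw H.snd a, t']
    abel

theorem lie_carE_carF_ne (H : IsDoubleCAR η w i w' i') (h : IsDualPair η e e')
    (hP : IsPolarization η P) (j k : Fin 4) (hjk : j ≠ k) :
    ⁅carE e e' w i w' i' P j, carF e e' w i w' i' P k⁆ = 0 := by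
  have a := hP.adjoint
  have a' := hP.adjoint'
  have m := hP.mul_compl
  have m' := hP.compl_mul
  -- For neighbouring nodes exactly one factor contracts, and the residual endomorphism is `P * (1 -
  -- P)` or `(1 - P) * P`. For opposite nodes the operators are of the same kinds on both factors,
  -- so nothing contracts.
  have l : ∀ {Z : R} {D : Module.End ℂ X} {b c : X →ₗ[ℂ] R},
      Z = -casimir e e' b c D → D = 0 → Z = 0 := fun h1 h2 => by rw [h1, h2, map_zero, neg_zero]
  match j, k, hjk with
  | 0, 1, _ => exact l (h.lie_casimir_left ⟨H.fst.wi, H.snd.anti_ww, H.ww, H.iw⟩ a) m'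
  | 0, 2, _ => exact lie_casimir_zero_zero ⟨H.fst.anti_ww, H.snd.anti_ww, H.ww, H.ww⟩
  | 0, 3, _ => exact l (h.lie_casimir_right ⟨H.fst.anti_ww, H.snd.wi, H.wi, H.ww⟩ a) m
  | 1, 0, _ => exact l (h.lie_casimir_left ⟨H.fst.wi, H.snd.anti_ii, H.wi, H.ii⟩ a') m
  | 1, 2, _ => exact l (h.lie_casimir_right ⟨H.fst.anti_ww, H.snd.anti_iw h, H.ww, H.wi⟩ a') m'
  | 1, 3, _ => exact lie_casimir_zero_zero ⟨H.fst.anti_ww, H.snd.anti_ii, H.wi, H.wi⟩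
  | 2, 0, _ => exact lie_casimir_zero_zero ⟨H.fst.anti_ii, H.snd.anti_ii, H.ii, H.ii⟩
  | 2, 1, _ => exact l (h.lie_casimir_right ⟨H.fst.anti_ii, H.snd.anti_iw h, H.iw, H.ii⟩ a) m
  | 2, 3, _ => exact l (h.lie_casimir_left ⟨H.fst.anti_iw h, H.snd.anti_ii, H.ii, H.wi⟩ a) m'
  | 3, 0, _ => exact l (h.lie_casimir_right ⟨H.fst.anti_ii, H.snd.wi, H.ii, H.iw⟩ a') m'
  | 3, 1, _ => exact lie_casimir_zero_zero ⟨H.fst.anti_ii, H.snd.anti_ww, H.iw, H.iw⟩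
  | 3, 2, _ => exact l (h.lie_casimir_left ⟨H.fst.anti_iw h, H.snd.anti_ww, H.iw, H.ww⟩ a') m
  | 3, 3, hjk => exact absurd rfl hjk

/-- The Serre relations between raising operators that are opposite nodes of the diagram. -/
theorem lie_carE_carE_opposite (H : IsDoubleCAR η w i w' i') (h : IsDualPair η e e')
    (hP : IsPolarization η P) (j : Fin 4) :
    ⁅carE e e' w i w' i' P j, carE e e' w i w' i' P (j + 2)⁆ = 0 := by
  have a := hP.adjoint
  have a' := hP.adjoint'
  fin_cases j
  -- Opposite nodes carry the same projection, so both single contractions and the trace contain a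
  -- projection times its adjoint, which is zero.
  · refine (h.lie_casimir_both ⟨H.fst.wi, H.snd.wi, H.wi, H.iw⟩ a a).trans ?_
    simp only [hP.mul_compl, hP.compl_mul]
    simp
  · refine (h.lie_casimir_both ⟨H.fst.wi, H.snd.anti_iw h, H.ww, H.ii⟩ a' a').trans ?_
    simp only [hP.mul_compl, hP.compl_mul]
    simp
  · refine (h.lie_casimir_both ⟨H.fst.anti_iw h, H.snd.anti_iw h, H.iw, H.wi⟩ a a).trans ?_
    simp only [hP.mul_compl, hP.compl_mul]
    simp
  · refine (h.lie_casimir_both ⟨H.fst.anti_iw h, H.snd.wi, H.ii, H.ww⟩ a' a').trans ?_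
    simp only [hP.mul_compl, hP.compl_mul]
    simp

theorem lie_carF_carF_opposite (H : IsDoubleCAR η w i w' i') (h : IsDualPair η e e')
    (hP : IsPolarization η P) (j : Fin 4) :
    ⁅carF e e' w i w' i' P j, carF e e' w i w' i' P (j + 2)⁆ = 0 := by
  have a := hP.adjoint
  have a' := hP.adjoint'
  fin_cases j
  · refine (h.lie_casimir_both ⟨H.fst.anti_iw h, H.snd.anti_iw h, H.iw, H.wi⟩ a' a').trans ?_
    simp only [hP.mul_compl, hP.compl_mul]
    simp
  · refine (h.lie_casimir_both ⟨H.fst.anti_iw h, H.snd.wi, H.ii, H.ww⟩ a a).trans ?_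
    simp only [hP.mul_compl, hP.compl_mul]
    simp
  · refine (h.lie_casimir_both ⟨H.fst.wi, H.snd.wi, H.wi, H.iw⟩ a' a').trans ?_
    simp only [hP.mul_compl, hP.compl_mul]
    simp
  · refine (h.lie_casimir_both ⟨H.fst.wi, H.snd.anti_iw h, H.ww, H.ii⟩ a a).trans ?_
    simp only [hP.mul_compl, hP.compl_mul]
    simp

/-- The kinds of operators `(w, w')`, `(w, i')`, `(i, i')`, `(i, w')` form a 4-cycle in which
neighbours differ on exactly one factor. This cycle is the affine Dynkin diagram: the factor shared
by neighbours gives the double bracket relation, and opposite nodes commute. -/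
theorem serre_carE (H : IsDoubleCAR η w i w' i') (h : IsDualPair η e e')
    (hP : IsPolarization η P) (j k : Fin 4) (hjk : j ≠ k) :
    (fun x => ⁅carE e e' w i w' i' P j, x⁆)^[(1 - affineCartan j k).toNat]
      (carE e e' w i w' i' P k) = 0 := by
  match j, k, hjk with
  | 0, 2, _ => exact lie_carE_carE_opposite H h hP 0
  | 1, 3, _ => exact lie_carE_carE_opposite H h hP 1
  | 2, 0, _ => exact lie_carE_carE_opposite H h hP 2
  | 3, 1, _ => exact lie_carE_carE_opposite H h hP 3
  | 0, 1, _ => exact serre_casimir_left ⟨H.fst.anti_ww, H.snd.wi, H.wi, H.ww⟩ H.ww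
  | 1, 0, _ => exact serre_casimir_left ⟨H.fst.anti_ww, H.snd.anti_iw h, H.ww, H.wi⟩ H.wi
  | 1, 2, _ => exact serre_casimir_right ⟨H.fst.wi, H.snd.anti_ii, H.wi, H.ii⟩ H.wi
  | 2, 1, _ => exact serre_casimir_right ⟨H.fst.anti_iw h, H.snd.anti_ii, H.ii, H.wi⟩ H.ii
  | 2, 3, _ => exact serre_casimir_left ⟨H.fst.anti_ii, H.snd.anti_iw h, H.iw, H.ii⟩ H.ii
  | 3, 2, _ => exact serre_casimir_left ⟨H.fst.anti_ii, H.snd.wi, H.ii, H.iw⟩ H.iw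
  | 3, 0, _ => exact serre_casimir_right ⟨H.fst.anti_iw h, H.snd.anti_ww, H.iw, H.ww⟩ H.iw
  | 0, 3, _ => exact serre_casimir_right ⟨H.fst.wi, H.snd.anti_ww, H.ww, H.iw⟩ H.ww
  | 3, 3, hjk => exact absurd rfl hjk

theorem serre_carF (H : IsDoubleCAR η w i w' i') (h : IsDualPair η e e')
    (hP : IsPolarization η P) (j k : Fin 4) (hjk : j ≠ k) :
    (fun x => ⁅carF e e' w i w' i' P j, x⁆)^[(1 - affineCartan j k).toNat]
      (carF e e' w i w' i' P k) = 0 := by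
  match j, k, hjk with
  | 0, 2, _ => exact lie_carF_carF_opposite H h hP 0
  | 1, 3, _ => exact lie_carF_carF_opposite H h hP 1
  | 2, 0, _ => exact lie_carF_carF_opposite H h hP 2
  | 3, 1, _ => exact lie_carF_carF_opposite H h hP 3
  | 2, 3, _ => exact serre_casimir_left ⟨H.fst.anti_ww, H.snd.wi, H.wi, H.ww⟩ H.ww
  | 3, 2, _ => exact serre_casimir_left ⟨H.fst.anti_ww, H.snd.anti_iw h, H.ww, H.wi⟩ H.wi
  | 3, 0, _ => exact serre_casimir_right ⟨H.fst.wi, H.snd.anti_ii, H.wi, H.ii⟩ H.wi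
  | 0, 3, _ => exact serre_casimir_right ⟨H.fst.anti_iw h, H.snd.anti_ii, H.ii, H.wi⟩ H.ii
  | 0, 1, _ => exact serre_casimir_left ⟨H.fst.anti_ii, H.snd.anti_iw h, H.iw, H.ii⟩ H.ii
  | 1, 0, _ => exact serre_casimir_left ⟨H.fst.anti_ii, H.snd.wi, H.ii, H.iw⟩ H.iw
  | 1, 2, _ => exact serre_casimir_right ⟨H.fst.anti_iw h, H.snd.anti_ww, H.iw, H.ww⟩ H.iw
  | 2, 1, _ => exact serre_casimir_right ⟨H.fst.wi, H.snd.anti_ww, H.ww, H.iw⟩ H.ww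
  | 3, 3, hjk => exact absurd rfl hjk

/-! ### Number operators acting on contractions -/

section Number

variable {C C' : Module.End ℂ X} {a b : X →ₗ[ℂ] R}

theorem lie_casimir_eq_zero {z : R} (ha : ∀ x, Commute (a x) z) (hb : ∀ x, Commute (b x) z) :
    ⁅casimir e e' a b C, z⁆ = 0 := by
  rw [casimir_apply, sum_lie]
  exact Finset.sum_eq_zero fun k _ => commute_iff_lie_eq.1 ((ha _).mul_left (hb _))

theorem IsDoubleCAR.lie_number_fst_w (H : IsDoubleCAR η w i w' i') (h : IsDualPair η e e')
    (hb : b = w' ∨ b = i') :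
    ⁅casimir e e' w i C, casimir e e' w b A⁆ = casimir e e' w b (C * A) := by
  refine lie_casimir_of_lie_left (h.lie_number_w H.fst C) fun x => ?_
  rcases hb with rfl | rfl
  · exact lie_casimir_eq_zero (fun y => H.ww y x) (fun y => H.iw y x)
  · exact lie_casimir_eq_zero (fun y => H.wi y x) (fun y => H.ii y x)

theorem IsDoubleCAR.lie_number_fst_i (H : IsDoubleCAR η w i w' i') (h : IsDualPair η e e')
    (hb : b = w' ∨ b = i') (hC : ∀ x y, η (C x) y = η x (C' y)) :
    ⁅casimir e e' w i C, casimir e e' i b A⁆ = -casimir e e' i b (C' * A) := by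
  rw [← map_neg, ← neg_mul]
  refine lie_casimir_of_lie_left (fun x => ?_) fun x => ?_
  · rw [h.lie_number_i H.fst hC]
    simp
  rcases hb with rfl | rfl
  · exact lie_casimir_eq_zero (fun y => H.ww y x) (fun y => H.iw y x)
  · exact lie_casimir_eq_zero (fun y => H.wi y x) (fun y => H.ii y x)

theorem IsDoubleCAR.lie_number_snd_w (H : IsDoubleCAR η w i w' i') (h : IsDualPair η e e')
    (ha : a = w ∨ a = i) (hC : ∀ x y, η (C' x) y = η x (C y)) :
    ⁅casimir e e' w' i' C, casimir e e' a w' A⁆ = casimir e e' a w' (A * C') := by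
  refine h.lie_casimir_of_lie_right hC (fun x => ?_) (h.lie_number_w H.snd C)
  rcases ha with rfl | rfl
  · exact lie_casimir_eq_zero (fun y => (H.ww x y).symm) (fun y => (H.wi x y).symm)
  · exact lie_casimir_eq_zero (fun y => (H.iw x y).symm) (fun y => (H.ii x y).symm)

theorem IsDoubleCAR.lie_number_snd_i (H : IsDoubleCAR η w i w' i') (h : IsDualPair η e e')
    (ha : a = w ∨ a = i) (hC : ∀ x y, η (C x) y = η x (C' y)) :
    ⁅casimir e e' w' i' C, casimir e e' a i' A⁆ = -casimir e e' a i' (A * C) := by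
  rw [← map_neg, ← mul_neg]
  refine h.lie_casimir_of_lie_right (C := -C') (fun x y => ?_) (fun x => ?_) (fun x => ?_)
  · simp [hC]
  · rcases ha with rfl | rfl
    · exact lie_casimir_eq_zero (fun y => (H.ww x y).symm) (fun y => (H.wi x y).symm)
    · exact lie_casimir_eq_zero (fun y => (H.iw x y).symm) (fun y => (H.ii x y).symm)
  · rw [h.lie_number_i H.snd hC]
    simp

/-- Second quantization respects brackets, so commuting endomorphisms have commuting number
operators; the adjoint on the annihilation leg is moved back to the creation leg. -/
theorem IsDualPair.lie_number_number (h : IsDualPair η e e') (H : IsCAR η w i)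
    {D : Module.End ℂ X} (hC : ∀ x y, η (C x) y = η x (C' y)) (hCD : C * D = D * C) :
    ⁅casimir e e' w i C, casimir e e' w i D⁆ = 0 := by
  have h1 : ∀ x, ⁅casimir e e' w i C, w x⁆ = w (C x) := h.lie_number_w H C
  have h2 : ∀ x, ⁅casimir e e' w i C, i x⁆ = -i (C' x) := h.lie_number_i H hC
  have h3 := h.sum_adjoint (mulForm (w ∘ₗ D) i) hC
  simp only [mulForm_apply, LinearMap.comp_apply] at h3
  rw [casimir_apply (A := D), lie_sum]
  have h4 : ∀ k, ⁅casimir e e' w i C, w (D (e k)) * i (e' k)⁆ =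
      w ((C * D) (e k)) * i (e' k) - w (D (e k)) * i (C' (e' k)) := fun k => by
    have h5 := h1 (D (e k))
    have h6 := h2 (e' k)
    rw [Ring.lie_def] at h5 h6 ⊢
    rw [Module.End.mul_apply, ← h5, ← neg_eq_iff_eq_neg.2 h6]
    noncomm_ring
  simp_rw [h4, Finset.sum_sub_distrib, ← h3, hCD]
  exact sub_self _

end Number

/-- The degrees of the raising operators. -/
def raisingDegree : Matrix (Fin 4) (Fin 4) ℤ :=
  !![1, 0, 0, -1; 0, 1, -1, 0; 1, -1, 0, 0; 0, 0, -1, 1]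

theorem lie_carDeg_carE (H : IsDoubleCAR η w i w' i') (h : IsDualPair η e e')
    (hP : IsPolarization η P) (j k : Fin 4) :
    ⁅carDeg e e' w i w' i' P j, carE e e' w i w' i' P k⁆ =
      raisingDegree j k • carE e e' w i w' i' P k := by
  -- `1 - P` is kept as an atom; otherwise linearity of `casimir` would split it and the products
  -- with `P` would no longer be recognized.
  obtain ⟨P', hP'⟩ : ∃ P', P' = 1 - P := ⟨_, rfl⟩
  have a := hP.adjoint
  have a' := hP.adjoint'
  have m := hP.mul_compl
  have m' := hP.compl_mul
  have s := hP.idem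
  have s' := hP.compl_idem
  simp only [carDeg, carE, ← hP'] at a a' m m' s s' ⊢
  fin_cases j <;> fin_cases k <;>
  simp [raisingDegree, H.lie_number_fst_w h, H.lie_number_fst_i h (hC := a),
    H.lie_number_fst_i h (hC := a'), H.lie_number_snd_i h (hC := a),
    H.lie_number_snd_i h (hC := a'), H.lie_number_snd_w h (hC := a),
    H.lie_number_snd_w h (hC := a'), m, m', s, s']

theorem lie_carDeg_carF (H : IsDoubleCAR η w i w' i') (h : IsDualPair η e e')
    (hP : IsPolarization η P) (j k : Fin 4) :
    ⁅carDeg e e' w i w' i' P j, carF e e' w i w' i' P k⁆ =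
      -(raisingDegree j k • carF e e' w i w' i' P k) := by
  obtain ⟨P', hP'⟩ : ∃ P', P' = 1 - P := ⟨_, rfl⟩
  have a := hP.adjoint
  have a' := hP.adjoint'
  have m := hP.mul_compl
  have m' := hP.compl_mul
  have s := hP.idem
  have s' := hP.compl_idem
  simp only [carDeg, carF, ← hP'] at a a' m m' s s' ⊢
  fin_cases j <;> fin_cases k <;>
  simp [raisingDegree, H.lie_number_fst_w h, H.lie_number_fst_i h (hC := a),
    H.lie_number_fst_i h (hC := a'), H.lie_number_snd_i h (hC := a),
    H.lie_number_snd_i h (hC := a'), H.lie_number_snd_w h (hC := a),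
    H.lie_number_snd_w h (hC := a'), m, m', s, s']

theorem lie_carDeg_carDeg (H : IsDoubleCAR η w i w' i') (h : IsDualPair η e e')
    (hP : IsPolarization η P) (j k : Fin 4) :
    ⁅carDeg e e' w i w' i' P j, carDeg e e' w i w' i' P k⁆ = 0 := by
  have a := hP.adjoint
  have a' := hP.adjoint'
  have m : P * (1 - P) = (1 - P) * P := by rw [hP.mul_compl, hP.compl_mul]
  have c : ∀ A B : Module.End ℂ X, ⁅casimir e e' w i A, casimir e e' w' i' B⁆ = 0 := fun A B => by
    rw [casimir_apply (A := B)]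
    refine lie_casimir_eq_zero (fun x => ?_) fun x => ?_
    · exact Commute.sum_right _ _ _ fun k _ => (H.ww _ _).mul_right (H.wi _ _)
    · exact Commute.sum_right _ _ _ fun k _ => (H.iw _ _).mul_right (H.ii _ _)
  have c' : ∀ A B : Module.End ℂ X, ⁅casimir e e' w' i' A, casimir e e' w i B⁆ = 0 := fun A B => by
    rw [← lie_skew, c, neg_zero]
  match j, k with
  | 0, 0 => exact lie_self _
  | 0, 1 => exact h.lie_number_number H.fst a m
  | 1, 0 => exact h.lie_number_number H.fst a' m.symm
  | 1, 1 => exact lie_self _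
  | 2, 2 => exact lie_self _
  | 2, 3 => exact h.lie_number_number H.snd a' m.symm
  | 3, 2 => exact h.lie_number_number H.snd a m
  | 3, 3 => exact lie_self _
  | 0, 2 => exact c _ _
  | 0, 3 => exact c _ _
  | 1, 2 => exact c _ _
  | 1, 3 => exact c _ _
  | 2, 0 => exact c' _ _
  | 2, 1 => exact c' _ _
  | 3, 0 => exact c' _ _
  | 3, 1 => exact c' _ _

/-- The Chevalley-Serre relations for the quadratic expressions in creation and annihilation
operators. -/
theorem chevalleySerre_car (H : IsDoubleCAR η w i w' i') (h : IsDualPair η e e')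
    (hP : IsPolarization η P) {n : ℕ} (hn : ∑ k, η (e k) (e' k) = 2 * n) :
    ChevalleySerre affineCartan (carE e e' w i w' i' P) (carF e e' w i w' i' P)
      (carH e e' w i w' i' P n) where
  lie_h_h j k := by
    have o : ∀ x : R, ⁅(1 : R), x⁆ = 0 := fun x => by simp [Ring.lie_def]
    have o' : ∀ x : R, ⁅x, (1 : R)⁆ = 0 := fun x => by simp [Ring.lie_def]
    have d := lie_carDeg_carDeg H h hP
    fin_cases j <;> fin_cases k <;> simp [carH, d, o, o']
  lie_e_f_same := lie_carE_carF_same H h hP hn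
  lie_e_f_ne := lie_carE_carF_ne H h hP
  lie_h_e j k := by
    have o : ∀ x : R, ⁅(1 : R), x⁆ = 0 := fun x => by simp [Ring.lie_def]
    have d := lie_carDeg_carE H h hP
    fin_cases j <;> simp only [carH, Fin.zero_eta, Fin.mk_one, Fin.reduceFinMk, Matrix.cons_val,
      add_lie, sub_lie, smul_lie, d, o] <;>
    fin_cases k <;> simp [raisingDegree, affineCartan, two_smul]
  lie_h_f j k := by
    have o : ∀ x : R, ⁅(1 : R), x⁆ = 0 := fun x => by simp [Ring.lie_def]
    have d := lie_carDeg_carF H h hP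
    fin_cases j <;> simp only [carH, Fin.zero_eta, Fin.mk_one, Fin.reduceFinMk, Matrix.cons_val,
      add_lie, sub_lie, smul_lie, d, o] <;>
    fin_cases k <;> simp [raisingDegree, affineCartan, two_smul] <;> abel
  serre_e := serre_carE H h hP
  serre_f := serre_carF H h hP

end DoubleCAR

/-! ### Transport along algebra homomorphisms -/

section Hom

variable {X ι R S : Type*} [AddCommGroup X] [Module ℂ X] [Fintype ι] [Ring R] [Algebra ℂ R]
  [Ring S] [Algebra ℂ S] {η : LinearMap.BilinForm ℂ X} {e e' : ι → X}

theorem IsCAR.map {w i : X →ₗ[ℂ] R} (H : IsCAR η w i) (φ : R →ₐ[ℂ] S) :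
    IsCAR η (φ.toLinearMap ∘ₗ w) (φ.toLinearMap ∘ₗ i) where
  ww x y := by simpa using congrArg φ (H.ww x y)
  ii x y := by simpa using congrArg φ (H.ii x y)
  wi x y := by simpa using congrArg φ (H.wi x y)

theorem map_casimir (φ : R →ₐ[ℂ] S) {a b : X →ₗ[ℂ] R} {c d : X →ₗ[ℂ] S}
    (ha : ∀ x, φ (a x) = c x) (hb : ∀ x, φ (b x) = d x) (A : Module.End ℂ X) :
    φ (casimir e e' a b A) = casimir e e' c d A := by
  simp [casimir_apply, ha, hb]

end Hom

/-! ### Creation and annihilation on an exterior algebra -/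

section Exterior

variable {Y : Type*} [AddCommGroup Y] [Module ℂ Y]

theorem contractLeft_exterior_ι_mul (d : Module.Dual ℂ Y) (u : Y) (z : ExteriorAlgebra ℂ Y) :
    CliffordAlgebra.contractLeft (Q := (0 : QuadraticForm ℂ Y)) d (ExteriorAlgebra.ι ℂ u * z) =
      d u • z - ExteriorAlgebra.ι ℂ u *
        CliffordAlgebra.contractLeft (Q := (0 : QuadraticForm ℂ Y)) d z :=
  CliffordAlgebra.contractLeft_ι_mul d u z

theorem exterior_ι_anticomm (u v : Y) (z : ExteriorAlgebra ℂ Y) :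
    ExteriorAlgebra.ι ℂ u * (ExteriorAlgebra.ι ℂ v * z) +
      ExteriorAlgebra.ι ℂ v * (ExteriorAlgebra.ι ℂ u * z) = 0 := by
  rw [← mul_assoc, ← mul_assoc, ← add_mul, ExteriorAlgebra.ι_add_mul_swap, zero_mul]

/-- Left multiplication of the exterior algebra by vectors. -/
def extMul : Y →ₗ[ℂ] Module.End ℂ (ExteriorAlgebra ℂ Y) :=
  LinearMap.mul ℂ (ExteriorAlgebra ℂ Y) ∘ₗ ExteriorAlgebra.ι ℂ

/-- Contraction of the exterior algebra by covectors. -/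
def extContract : Module.Dual ℂ Y →ₗ[ℂ] Module.End ℂ (ExteriorAlgebra ℂ Y) :=
  CliffordAlgebra.contractLeft (Q := (0 : QuadraticForm ℂ Y))

theorem extMul_apply (y : Y) (z : ExteriorAlgebra ℂ Y) :
    extMul y z = ExteriorAlgebra.ι ℂ y * z := rfl

theorem extContract_apply (d : Module.Dual ℂ Y) (z : ExteriorAlgebra ℂ Y) :
    extContract d z = CliffordAlgebra.contractLeft (Q := (0 : QuadraticForm ℂ Y)) d z := rfl

theorem isCAR_exterior {X : Type*} [AddCommGroup X] [Module ℂ X] {η : LinearMap.BilinForm ℂ X}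
    (hη : ∀ x y, η x y = η y x) (g : X ≃ₗ[ℂ] Y) :
    IsCAR η (extMul ∘ₗ g.toLinearMap) (extContract ∘ₗ g.symm.toLinearMap.dualMap ∘ₗ η) where
  ww x y := LinearMap.ext fun z => exterior_ι_anticomm _ _ z
  ii x y := LinearMap.ext fun z => by
    change extContract _ (extContract _ z) + extContract _ (extContract _ z) = 0
    simp only [extContract_apply]
    rw [CliffordAlgebra.contractLeft_comm]
    exact neg_add_cancel _
  wi x y := LinearMap.ext fun z => by
    change extMul (g x) (extContract (g.symm.toLinearMap.dualMap (η y)) z) +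
      extContract (g.symm.toLinearMap.dualMap (η y)) (extMul (g x) z) = _
    simp [extContract_apply, extMul_apply, contractLeft_exterior_ι_mul,
      Module.algebraMap_end_apply, hη x y]

/-- The operator `∑ k, y k ∧ (d k ⌟ ·)` kills scalars and, contraction being an antiderivation,
obeys the same recursion under left multiplication by vectors as the derivation `count C`. This
exhibits the degrees as number operators. -/
theorem count_eq_sum {κ : Type*} [Fintype κ] (C : Module.End ℂ Y) (y : κ → Y)
    (d : κ → Module.Dual ℂ Y) (h : ∀ v, ∑ k, d k v • y k = C v) :
    count C = ∑ k, extMul (y k) * extContract (d k) := by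
  refine LinearMap.ext fun z => ?_
  induction z using CliffordAlgebra.left_induction with
  | algebraMap r =>
    have : count C 1 = 0 := by
      have h := count_mul C 1 1
      simpa using h
    rw [Algebra.algebraMap_eq_smul_one, map_smul, map_smul]
    erw [this]
    simp only [LinearMap.sum_apply, Module.End.mul_apply, extContract_apply, extMul_apply]
    erw [Finset.sum_eq_zero fun k _ => by
      rw [CliffordAlgebra.contractLeft_one, mul_zero]]
  | add x y hx hy => rw [map_add, map_add, hx, hy]
  | ι_mul z v hz =>
    change count C (ExteriorAlgebra.ι ℂ v * z) = (∑ k, extMul (y k) * extContract (d k))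
      (ExteriorAlgebra.ι ℂ v * z)
    rw [count_mul, count_ι, hz, ← h v]
    simp only [LinearMap.sum_apply, Module.End.mul_apply, extContract_apply, extMul_apply,
      contractLeft_exterior_ι_mul, map_sum, map_smul, Finset.mul_sum, Finset.sum_mul,
      ← Finset.sum_add_distrib]
    refine Finset.sum_congr rfl fun k _ => ?_
    have := exterior_ι_anticomm v (y k) (CliffordAlgebra.contractLeft (Q := (0 : QuadraticForm ℂ Y))
      (d k) z)
    rw [eq_neg_of_add_eq_zero_left this, mul_sub, smul_mul_assoc, mul_smul_comm]
    abel

end Exterior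

/-! ### Transport to the Clifford algebra -/

section Clifford

variable {X : Type*} [AddCommGroup X] [Module ℂ X] {Q : QuadraticForm ℂ X}

theorem equivExterior_vdash (v : X) (a : CliffordAlgebra Q) :
    CliffordAlgebra.equivExterior Q (vdash Q v a) =
      CliffordAlgebra.contractLeft (Q := (0 : QuadraticForm ℂ X))
        (QuadraticMap.associated (R := ℂ) Q v) (CliffordAlgebra.equivExterior Q a) := by
  rw [vdash_apply, map_smul, map_sub, equivExterior_ι_mul, equivExterior_involute_mul_ι]
  module

/-- Conjugation by the canonical isomorphism of the Clifford and exterior algebras. -/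
def conjExterior (Q : QuadraticForm ℂ X) :
    Module.End ℂ (ExteriorAlgebra ℂ X) →ₐ[ℂ] Module.End ℂ (CliffordAlgebra Q) :=
  ((CliffordAlgebra.equivExterior Q).symm.conjAlgEquiv ℂ : _ →ₐ[ℂ] _)

theorem conjExterior_extMul (v : X) : conjExterior Q (extMul v) = wedge Q v := by
  ext a
  exact (LinearEquiv.symm_apply_eq _).2 (equivExterior_wedge v a).symm

theorem conjExterior_extContract (v : X) :
    conjExterior Q (extContract (QuadraticMap.associated (R := ℂ) Q v)) = vdash Q v := by
  ext a
  exact (LinearEquiv.symm_apply_eq _).2 (equivExterior_vdash v a).symm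

theorem hodgeStar_apply [FiniteDimensional ℂ X] (ν : UnitVolume Q) (a : CliffordAlgebra Q) :
    hodgeStar ν a = a * ν.val := by
  let r := LinearMap.mulRight ℂ ν.val
  have hr : r ∘ₗ r = LinearMap.id := by
    ext a
    simp [r, mul_assoc, ν.sq]
  have h : hodgeStar ν = LinearEquiv.ofLinearMap r r hr hr := by
    refine (existsUnique_star ν).unique (hodgeStar_spec ν) ⟨by simpa [r] using ν.sq, fun v a => ?_⟩
    simp only [LinearEquiv.coe_ofLinearMap, r, LinearMap.mulRight_apply, wedge_apply, vdash_apply,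
      map_mul, mul_assoc, volume_comm, smul_mul_assoc, sub_mul, mul_neg]
    rw [sub_eq_add_neg]
  rw [h]
  rfl

theorem hodgeStar_symm_wedge [FiniteDimensional ℂ X] (ν : UnitVolume Q) (v : X)
    (a : CliffordAlgebra Q) : (hodgeStar ν).symm (wedge Q v (hodgeStar ν a)) = vdash Q v a := by
  rw [(hodgeStar_spec ν).2, LinearEquiv.symm_apply_apply]

end Clifford

/-! ### Two commuting `sl₂`-triples from full contractions -/

section Sl2Pair

/-- Two commuting triples that satisfy the relations of the standard generators of `sl₂`. -/
structure IsSl2Pair {L : Type*} [LieRing L] (e f h : Fin 2 → L) : Prop where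
  ef : ∀ i, ⁅e i, f i⁆ = h i
  he : ∀ i, ⁅h i, e i⁆ = (2 : ℤ) • e i
  hf : ∀ i, ⁅h i, f i⁆ = -((2 : ℤ) • f i)
  ee : ⁅e 0, e 1⁆ = 0
  ef' : ⁅e 0, f 1⁆ = 0
  fe' : ⁅f 0, e 1⁆ = 0
  ff' : ⁅f 0, f 1⁆ = 0

variable {X ι R : Type*} [AddCommGroup X] [Module ℂ X] [Fintype ι] [Ring R] [Algebra ℂ R]
variable {η : LinearMap.BilinForm ℂ X} {e e' : ι → X} {w i w' i' : X →ₗ[ℂ] R}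

theorem isSl2Pair_car (H : IsDoubleCAR η w i w' i') (h : IsDualPair η e e')
    {n : ℂ} (hn : ∑ k, η (e k) (e' k) = n) :
    IsSl2Pair ![casimir e e' w w' 1, casimir e e' i w' 1]
      ![casimir e e' i i' 1, casimir e e' w i' 1]
      ![casimir e e' w i 1 + casimir e e' w' i' 1 - n • 1,
        casimir e e' w' i' 1 - casimir e e' w i 1] := by
  have a : ∀ x y, η ((1 : Module.End ℂ X) x) y = η x ((1 : Module.End ℂ X) y) := fun _ _ => rfl
  have t : ∑ k, η ((1 : Module.End ℂ X) (e k)) (e' k) = n := hn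
  have o : ∀ x : R, ⁅(1 : R), x⁆ = 0 := fun x => by simp [Ring.lie_def]
  -- Between the two triples exactly one factor contracts. The residue contracts anticommuting
  -- operators of one kind with each other, so it vanishes by symmetry of the dual tensor; no
  -- projection is involved.
  have l : ∀ {Z : R} {b : X →ₗ[ℂ] R}, Z = -casimir e e' b b (1 * 1) →
      (∀ x y, b x * b y + b y * b x = 0) → Z = 0 := fun h1 h2 => by
    rw [h1, mul_one, h.casimir_one_eq_zero h2, neg_zero]
  refine ⟨fun j => ?_, fun j => ?_, fun j => ?_, ?_, ?_, ?_, ?_⟩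
  · fin_cases j
    · change ⁅casimir e e' w w' 1, casimir e e' i i' 1⁆ =
        casimir e e' w i 1 + casimir e e' w' i' 1 - n • 1
      rw [h.lie_casimir_both ⟨H.fst.wi, H.snd.wi, H.wi, H.iw⟩ a a, mul_one,
        h.casimir_iw H.fst a, h.casimir_iw H.snd a, t, Algebra.algebraMap_eq_smul_one]
      abel
    · change ⁅casimir e e' i w' 1, casimir e e' w i' 1⁆ =
        casimir e e' w' i' 1 - casimir e e' w i 1
      rw [h.lie_casimir_both ⟨H.fst.anti_iw h, H.snd.wi, H.ii, H.ww⟩ a a, mul_one,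
        h.casimir_iw H.snd a, t]
      abel
  · fin_cases j <;>
    simp [sub_lie, add_lie, o, H.lie_number_fst_w h, H.lie_number_fst_i h (hC := a),
      H.lie_number_snd_w h (hC := a), two_smul]
  · fin_cases j <;>
    simp [sub_lie, add_lie, o, H.lie_number_fst_w h, H.lie_number_fst_i h (hC := a),
      H.lie_number_snd_i h (hC := a), two_smul]
    abel
  · exact l (h.lie_casimir_left ⟨H.fst.wi, H.snd.anti_ww, H.ww, H.iw⟩ a) H.snd.ww
  · exact l (h.lie_casimir_right ⟨H.fst.anti_ww, H.snd.wi, H.wi, H.ww⟩ a) H.fst.ww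
  · exact l (h.lie_casimir_right ⟨H.fst.anti_ii, H.snd.anti_iw h, H.iw, H.ii⟩ a) H.fst.ii
  · exact l (h.lie_casimir_left ⟨H.fst.anti_iw h, H.snd.anti_ii, H.ii, H.wi⟩ a) H.snd.ii

end Sl2Pair

/-- Naturality of contraction, by induction on products of vectors. It serves both to identify forms
with the Clifford algebra and to pull contractions back to local frames. -/
theorem exteriorMap_contractLeft {Y Z : Type*} [AddCommGroup Y] [Module ℂ Y] [AddCommGroup Z]
    [Module ℂ Z] (f : Y →ₗ[ℂ] Z) (d : Module.Dual ℂ Z) (z : ExteriorAlgebra ℂ Y) :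
    ExteriorAlgebra.map f (extContract (f.dualMap d) z) =
      extContract d (ExteriorAlgebra.map f z) := by
  simp only [extContract_apply]
  induction z using CliffordAlgebra.left_induction with
  | algebraMap r =>
    rw [CliffordAlgebra.contractLeft_algebraMap, map_zero]
    erw [AlgHom.commutes]
    rw [CliffordAlgebra.contractLeft_algebraMap]
  | add x y hx hy => simp only [map_add, hx, hy]
  | ι_mul z v hz =>
    change ExteriorAlgebra.map f (CliffordAlgebra.contractLeft (Q := (0 : QuadraticForm ℂ Y)) _
      (ExteriorAlgebra.ι ℂ v * z)) = CliffordAlgebra.contractLeft (Q := (0 : QuadraticForm ℂ Z)) _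
      (ExteriorAlgebra.map f (ExteriorAlgebra.ι ℂ v * z))
    rw [contractLeft_exterior_ι_mul, map_mul, ExteriorAlgebra.map_apply_ι,
      contractLeft_exterior_ι_mul, map_sub, map_mul, hz, ExteriorAlgebra.map_apply_ι, map_smul]
    rfl

/-! ### Anticommutation relations on the Clifford algebra and on tensor products -/

section Clifford

variable {X : Type*} [AddCommGroup X] [Module ℂ X]

/-- Exterior multiplication on the Clifford algebra, as a linear function of the vector. -/
def wedgeHom (Q : QuadraticForm ℂ X) : X →ₗ[ℂ] Module.End ℂ (CliffordAlgebra Q) :=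
  (conjExterior Q).toLinearMap ∘ₗ extMul

/-- Interior multiplication on the Clifford algebra, as a linear function of the vector. -/
def vdashHom (Q : QuadraticForm ℂ X) : X →ₗ[ℂ] Module.End ℂ (CliffordAlgebra Q) :=
  (conjExterior Q).toLinearMap ∘ₗ extContract ∘ₗ QuadraticMap.associated (R := ℂ) Q

theorem wedgeHom_apply (Q : QuadraticForm ℂ X) (v : X) : wedgeHom Q v = wedge Q v :=
  conjExterior_extMul v

theorem vdashHom_apply (Q : QuadraticForm ℂ X) (v : X) : vdashHom Q v = vdash Q v :=
  conjExterior_extContract v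

theorem isCAR_clifford (Q : QuadraticForm ℂ X) :
    IsCAR (QuadraticMap.associated (R := ℂ) Q) (wedgeHom Q) (vdashHom Q) :=
  (isCAR_exterior (QuadraticMap.associated_isSymm ℂ Q) (LinearEquiv.refl ℂ X)).map (conjExterior Q)

/-- The tensor product is the ungraded one, so operators on different factors commute rather than
anticommute. -/
theorem isDoubleCAR_tensor {C D : Type*} [AddCommGroup C] [Module ℂ C] [AddCommGroup D]
    [Module ℂ D] {η : LinearMap.BilinForm ℂ X} {w i : X →ₗ[ℂ] Module.End ℂ C}
    {w' i' : X →ₗ[ℂ] Module.End ℂ D} (H : IsCAR η w i) (H' : IsCAR η w' i') :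
    IsDoubleCAR η ((Module.End.rTensorAlgHom ℂ C D).toLinearMap ∘ₗ w)
      ((Module.End.rTensorAlgHom ℂ C D).toLinearMap ∘ₗ i)
      ((Module.End.lTensorAlgHom ℂ D C).toLinearMap ∘ₗ w')
      ((Module.End.lTensorAlgHom ℂ D C).toLinearMap ∘ₗ i') := by
  have h : ∀ (A : Module.End ℂ C) (B : Module.End ℂ D),
      Commute (Module.End.rTensorAlgHom ℂ C D A) (Module.End.lTensorAlgHom ℂ D C B) :=
    fun A B => TensorProduct.ext' fun _ _ => rfl
  exact ⟨H.map _, H'.map _, fun _ _ => h _ _, fun _ _ => h _ _, fun _ _ => h _ _,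
    fun _ _ => h _ _⟩

end Clifford

/-! ### The pointwise model: metric, polarization and the two fermionic systems -/

section Point

variable {W : Type*} [AddCommGroup W] [Module ℝ W] {Q : QuadraticForm ℝ W} {J : Module.End ℝ W}
variable {T : Type*} [AddCommGroup T] [Module ℝ T] (θ : T ≃ₗ[ℝ] W)

variable (Q) in
/-- The complex bilinear form associated with the complexified quadratic form. -/
def metric : LinearMap.BilinForm ℂ (ℂ ⊗[ℝ] W) :=
  QuadraticMap.associated (R := ℂ) (Q.baseChange ℂ)

theorem metric_tmul (a b : ℂ) (v w : W) : metric Q (a ⊗ₜ v) (b ⊗ₜ w) =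
    (QuadraticMap.associated (R := ℝ) Q v w : ℝ) • (a * b) := by
  rw [metric, QuadraticForm.associated_baseChange]
  rfl

theorem metric_symm (x y : ℂ ⊗[ℝ] W) : metric Q x y = metric Q y x :=
  QuadraticMap.associated_isSymm ℂ (Q.baseChange ℂ) x y

variable (W) in
/-- The complexification of a basis of `W`. -/
def complexBasis [FiniteDimensional ℝ W] (k : Fin (Module.finrank ℝ W)) : ℂ ⊗[ℝ] W :=
  1 ⊗ₜ Module.finBasis ℝ W k

/-- The basis of `W` that is dual to `Module.finBasis ℝ W` for the metric. -/
def dualVector [FiniteDimensional ℝ W]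
    (hQ : (QuadraticMap.associated (R := ℝ) Q).Nondegenerate) (k : Fin (Module.finrank ℝ W)) : W :=
  (LinearMap.BilinForm.toDual (QuadraticMap.associated (R := ℝ) Q) hQ).symm
    ((Module.finBasis ℝ W).coord k)

/-- The complexification of the dual basis. -/
def complexDualBasis [FiniteDimensional ℝ W]
    (hQ : (QuadraticMap.associated (R := ℝ) Q).Nondegenerate) (k : Fin (Module.finrank ℝ W)) :
    ℂ ⊗[ℝ] W :=
  1 ⊗ₜ dualVector hQ k

theorem associated_dualVector [FiniteDimensional ℝ W]
    (hQ : (QuadraticMap.associated (R := ℝ) Q).Nondegenerate) (k : Fin (Module.finrank ℝ W))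
    (v : W) : QuadraticMap.associated (R := ℝ) Q (dualVector hQ k) v =
      (Module.finBasis ℝ W).coord k v :=
  LinearMap.BilinForm.apply_toDual_symm_apply _ _

theorem isDualPair_complexBasis [FiniteDimensional ℝ W]
    (hQ : (QuadraticMap.associated (R := ℝ) Q).Nondegenerate) :
    IsDualPair (metric Q) (complexBasis W) (complexDualBasis hQ) where
  symm := metric_symm
  sum_left x := by
    induction x with
    | zero => simp
    | add x y hx hy => 
      simp only [map_add, add_smul, Finset.sum_add_distrib, hx, hy]
    | tmul c v =>
      simp only [complexBasis, complexDualBasis, metric_tmul, associated_dualVector, one_mul,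
        TensorProduct.smul_tmul', smul_eq_mul, mul_one, TensorProduct.smul_tmul]
      rw [← TensorProduct.tmul_sum]
      congr 1
      exact (Module.finBasis ℝ W).sum_repr v
  sum_right x := by
    induction x with
    | zero => simp
    | add x y hx hy => 
      simp only [map_add, add_smul, Finset.sum_add_distrib, hx, hy]
    | tmul c v =>
      simp only [complexBasis, complexDualBasis, metric_tmul, one_mul,
        TensorProduct.smul_tmul', smul_eq_mul, mul_one, TensorProduct.smul_tmul]
      rw [← TensorProduct.tmul_sum]
      congr 1
      apply (LinearMap.BilinForm.toDual (QuadraticMap.associated (R := ℝ) Q) hQ).injective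
      ext w
      rw [LinearMap.BilinForm.toDual_def, LinearMap.BilinForm.toDual_def]
      simp only [map_sum, map_smul, LinearMap.sum_apply, LinearMap.smul_apply,
        associated_dualVector, smul_eq_mul]
      conv_rhs => rw [← (Module.finBasis ℝ W).sum_repr w]
      simp only [map_sum, map_smul, smul_eq_mul]
      refine Finset.sum_congr rfl fun k _ => ?_
      rw [mul_comm, Module.Basis.coord_apply]
      congr 1
      exact QuadraticMap.associated_isSymm ℝ Q _ _

theorem sum_metric_complexBasis [FiniteDimensional ℝ W]
    (hQ : (QuadraticMap.associated (R := ℝ) Q).Nondegenerate) :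
    ∑ k, metric Q (complexBasis W k) (complexDualBasis hQ k) = (Module.finrank ℝ W : ℂ) := by
  simp_rw [metric_symm (complexBasis W _), complexBasis, complexDualBasis, metric_tmul,
    associated_dualVector]
  simp

theorem projI_mul_self {U : Type*} [AddCommGroup U] [Module ℝ U] {K : Module.End ℝ U}
    (hK : ∀ u, K (K u) = -u) : projI K * projI K = projI K := by
  have h : K.baseChange ℂ * K.baseChange ℂ = -1 := by
    ext u
    simp [hK, TensorProduct.tmul_neg]
  rw [projI, smul_mul_smul, sub_mul, mul_sub, mul_sub, one_mul, one_mul, mul_one, smul_mul_smul,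
    h, Complex.I_mul_I]
  module

/-- An isometry with square `-1` is skew: polarizing the isometry condition gives `η(Jv, Jw) = η(v,
w)`, and `w` is replaced by `Jw`. -/
theorem metric_J (hJ : IsCompatibleComplexStructure Q J) (x y : ℂ ⊗[ℝ] W) :
    metric Q (J.baseChange ℂ x) y = -metric Q x (J.baseChange ℂ y) := by
  have hr : ∀ v w, QuadraticMap.associated (R := ℝ) Q (J v) w =
      -QuadraticMap.associated (R := ℝ) Q v (J w) := fun v w => by
    have h : ∀ v w, QuadraticMap.associated (R := ℝ) Q (J v) (J w) =
        QuadraticMap.associated (R := ℝ) Q v w := fun v w => by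
      simp only [QuadraticMap.associated_apply, ← map_add, hJ.isometry]
    rw [← h v (J w), hJ.sq, map_neg, neg_neg]
  induction x with
  | zero => simp
  | add x y hx hy => simp only [map_add, LinearMap.add_apply, hx, hy]; ring
  | tmul a v =>
    induction y with
    | zero => simp
    | add x y hx hy => simp only [map_add, hx, hy]; ring
    | tmul b w => simp [metric_tmul, hr]

/-- The metric is complex bilinear, not Hermitian, so passing to the adjoint changes the sign of `J`
but not of `i`; thus `(1 - iJ)/2` becomes `(1 + iJ)/2`. -/
theorem isPolarization_projI (hJ : IsCompatibleComplexStructure Q J) :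
    IsPolarization (metric Q) (projI J) where
  idem := projI_mul_self hJ.sq
  adjoint x y := by
    simp only [projI, LinearMap.smul_apply, LinearMap.sub_apply, Module.End.one_apply, map_smul,
      map_sub, metric_J hJ, smul_eq_mul]
    ring

variable (Q T) in
/-- Exterior multiplication on the Clifford factor. -/
def wedge₁ : (ℂ ⊗[ℝ] W) →ₗ[ℂ] Module.End ℂ (CliffordFormAt Q T) :=
  (Module.End.rTensorAlgHom ℂ (Cl Q) (Forms T)).toLinearMap ∘ₗ wedgeHom (Q.baseChange ℂ)

variable (Q T) in
/-- Interior multiplication on the Clifford factor. -/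
def vdash₁ : (ℂ ⊗[ℝ] W) →ₗ[ℂ] Module.End ℂ (CliffordFormAt Q T) :=
  (Module.End.rTensorAlgHom ℂ (Cl Q) (Forms T)).toLinearMap ∘ₗ vdashHom (Q.baseChange ℂ)

theorem wedge₁_tmul (x : ℂ ⊗[ℝ] W) (a : Cl Q) (α : Forms T) :
    wedge₁ Q T x (a ⊗ₜ α) = wedge (Q.baseChange ℂ) x a ⊗ₜ α := by
  rw [← wedgeHom_apply]
  rfl

theorem vdash₁_tmul (x : ℂ ⊗[ℝ] W) (a : Cl Q) (α : Forms T) :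
    vdash₁ Q T x (a ⊗ₜ α) = vdash (Q.baseChange ℂ) x a ⊗ₜ α := by
  rw [← vdashHom_apply]
  rfl

variable [FiniteDimensional ℝ W] (hQ : (QuadraticMap.associated (R := ℝ) Q).Nondegenerate)

variable {θ} in
/-- The complexification of the isomorphism `sharp`. -/
def sharpC (θ : T ≃ₗ[ℝ] W) (hQ : (QuadraticMap.associated (R := ℝ) Q).Nondegenerate) :
    (ℂ ⊗[ℝ] Module.Dual ℝ T) ≃ₗ[ℂ] (ℂ ⊗[ℝ] W) :=
  (sharp θ hQ).baseChange ℝ ℂ _ _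

theorem sharpC_tmul (c : ℂ) (α : Module.Dual ℝ T) :
    sharpC θ hQ (c ⊗ₜ α) = c ⊗ₜ sharp θ hQ α := rfl

theorem sharp_coord (k : Fin (Module.finrank ℝ W)) :
    sharp θ hQ ((Module.finBasis ℝ W).coord k ∘ₗ θ.toLinearMap) = dualVector hQ k := by
  simp only [sharp, dualVector, LinearEquiv.trans_apply]
  congr 1
  ext w
  simp

theorem sharpC_symm_complexDualBasis (k : Fin (Module.finrank ℝ W)) :
    (sharpC θ hQ).symm (complexDualBasis hQ k) =
      1 ⊗ₜ ((Module.finBasis ℝ W).coord k ∘ₗ θ.toLinearMap) := by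
  rw [LinearEquiv.symm_apply_eq, sharpC_tmul, sharp_coord, complexDualBasis]

theorem associated_sharp (α : Module.Dual ℝ T) (w : W) :
    QuadraticMap.associated (R := ℝ) Q (sharp θ hQ α) w = α (θ.symm w) :=
  LinearMap.BilinForm.apply_toDual_symm_apply (hB := hQ) _ _

/-- The induced complex structure on covectors is the transpose of `J`, and the metric turns the
transpose into the adjoint `-J`. -/
theorem sharp_cotangentJ (hJ : IsCompatibleComplexStructure Q J) (α : Module.Dual ℝ T) :
    sharp θ hQ (cotangentJ J θ α) = -J (sharp θ hQ α) := by
  apply (LinearMap.BilinForm.toDual (QuadraticMap.associated (R := ℝ) Q) hQ).injective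
  ext w
  have hr : ∀ v w, QuadraticMap.associated (R := ℝ) Q (J v) w =
      -QuadraticMap.associated (R := ℝ) Q v (J w) := fun v w => by
    have h := metric_J hJ (1 ⊗ₜ v) (1 ⊗ₜ w)
    simp only [LinearMap.baseChange_tmul, metric_tmul] at h
    simpa using congrArg Complex.re h
  rw [LinearMap.BilinForm.toDual_def, LinearMap.BilinForm.toDual_def, map_neg,
    LinearMap.neg_apply, hr, associated_sharp, associated_sharp]
  simp [cotangentJ]

/-- Because of that sign, the metric carries forms of type `(1,0)` to vectors of type `(0,1)`. This
is why the degree `q` is counted by `1 - P` in `carDeg`. -/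
theorem sharpC_projI (hJ : IsCompatibleComplexStructure Q J) (y : ℂ ⊗[ℝ] Module.Dual ℝ T) :
    sharpC θ hQ (projI (cotangentJ J θ) y) = (1 - projI J) (sharpC θ hQ y) := by
  induction y with
  | zero => simp
  | add x y hx hy => simp only [map_add, hx, hy]
  | tmul c α =>
    simp only [projI, LinearMap.smul_apply, LinearMap.sub_apply, Module.End.one_apply, map_smul,
      map_sub, LinearMap.baseChange_tmul, sharpC_tmul, sharp_cotangentJ _ _ hJ,
      TensorProduct.tmul_neg]
    module

/-- Exterior multiplication on the factor of scalar forms, indexed by vectors. -/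
def wedge₂ : (ℂ ⊗[ℝ] W) →ₗ[ℂ] Module.End ℂ (CliffordFormAt Q T) :=
  (Module.End.lTensorAlgHom ℂ (Forms T) (Cl Q)).toLinearMap ∘ₗ extMul ∘ₗ
    (sharpC θ hQ).symm.toLinearMap

/-- Interior multiplication on the factor of scalar forms, indexed by vectors. -/
def vdash₂ : (ℂ ⊗[ℝ] W) →ₗ[ℂ] Module.End ℂ (CliffordFormAt Q T) :=
  (Module.End.lTensorAlgHom ℂ (Forms T) (Cl Q)).toLinearMap ∘ₗ extContract ∘ₗ
    (sharpC θ hQ).toLinearMap.dualMap ∘ₗ metric Q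

theorem wedge₂_tmul (x : ℂ ⊗[ℝ] W) (a : Cl Q) (α : Forms T) :
    wedge₂ θ hQ x (a ⊗ₜ α) = a ⊗ₜ (ExteriorAlgebra.ι ℂ ((sharpC θ hQ).symm x) * α) := rfl

theorem vdash₂_tmul (x : ℂ ⊗[ℝ] W) (a : Cl Q) (α : Forms T) :
    vdash₂ θ hQ x (a ⊗ₜ α) =
      a ⊗ₜ extContract ((sharpC θ hQ).toLinearMap.dualMap (metric Q x)) α := rfl

theorem isDoubleCAR_cliffordForm :
    IsDoubleCAR (metric Q) (wedge₁ Q T) (vdash₁ Q T) (wedge₂ θ hQ) (vdash₂ θ hQ) :=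
  isDoubleCAR_tensor (isCAR_clifford (Q.baseChange ℂ))
    (isCAR_exterior metric_symm (sharpC θ hQ).symm)

end Point

/-- Graded commutativity of the exterior algebra: the involution absorbs the sign of moving a
covector across. -/
theorem involute_mul_exterior_ι {Y : Type*} [AddCommGroup Y] [Module ℂ Y] (y : Y)
    (z : ExteriorAlgebra ℂ Y) :
    CliffordAlgebra.involute (Q := (0 : QuadraticForm ℂ Y)) z * ExteriorAlgebra.ι ℂ y =
      ExteriorAlgebra.ι ℂ y * z := by
  induction z using CliffordAlgebra.left_induction with
  | algebraMap r => rw [AlgHom.commutes]; exact Algebra.commutes _ _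
  | add a b ha hb => rw [map_add, add_mul, mul_add, ha, hb]
  | ι_mul a v ha =>
    rw [map_mul, CliffordAlgebra.involute_ι, mul_assoc]
    erw [ha]
    rw [neg_mul]
    exact (eq_neg_of_add_eq_zero_left (exterior_ι_anticomm y v a)).symm

/-! ### The geometric operators as fermionic contractions -/

section Point

variable {W : Type*} [AddCommGroup W] [Module ℝ W] {Q : QuadraticForm ℝ W} {J : Module.End ℝ W}
variable {T : Type*} [AddCommGroup T] [Module ℝ T] (θ : T ≃ₗ[ℝ] W)
variable [FiniteDimensional ℝ W] (hQ : (QuadraticMap.associated (R := ℝ) Q).Nondegenerate)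
variable (ν : UnitVolume (Q.baseChange ℂ))

variable (Q) in
theorem vielbeinPart_mul_tmul (A : Module.End ℂ (ℂ ⊗[ℝ] W)) (a : Cl Q) (α : Forms T) :
    vielbeinPart Q θ A * a ⊗ₜ α = ∑ k, (CliffordAlgebra.ι (Q.baseChange ℂ) (A (complexBasis W k)) * a)
      ⊗ₜ (ExteriorAlgebra.ι ℂ (1 ⊗ₜ[ℝ] ((Module.finBasis ℝ W).coord k ∘ₗ θ.toLinearMap)) * α) := by
  rw [vielbeinPart, Finset.sum_mul]
  exact Finset.sum_congr rfl fun k _ => Algebra.TensorProduct.tmul_mul_tmul _ _ _ _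

variable (Q) in
theorem parity_tmul_mul_vielbeinPart (A : Module.End ℂ (ℂ ⊗[ℝ] W)) (a : Cl Q) (α : Forms T) :
    parity Q (a ⊗ₜ α) * vielbeinPart Q θ A = ∑ k,
      (CliffordAlgebra.involute a * CliffordAlgebra.ι (Q.baseChange ℂ) (A (complexBasis W k)))
      ⊗ₜ (ExteriorAlgebra.ι ℂ (1 ⊗ₜ[ℝ] ((Module.finBasis ℝ W).coord k ∘ₗ θ.toLinearMap)) * α) := by
  rw [vielbeinPart, Finset.mul_sum]
  refine Finset.sum_congr rfl fun k _ => ?_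
  rw [← involute_mul_exterior_ι]
  exact Algebra.TensorProduct.tmul_mul_tmul _ _ _ _

/-- On the form factor, left multiplication and sign-corrected right multiplication by a covector
agree. The average is thus felt only on the Clifford factor, where it is exterior multiplication; in
the difference it becomes interior multiplication. -/
theorem halfPlus_vielbeinPart (A : Module.End ℂ (ℂ ⊗[ℝ] W)) :
    halfPlus (vielbeinPart Q θ A) =
      casimir (complexBasis W) (complexDualBasis hQ) (wedge₁ Q T) (wedge₂ θ hQ) A := by
  refine TensorProduct.ext' fun a α => ?_
  simp only [halfPlus, casimir_apply, LinearMap.smul_apply, LinearMap.add_apply,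
    LinearMap.comp_apply, LinearMap.mulLeft_apply, LinearMap.mulRight_apply, LinearMap.sum_apply,
    Module.End.mul_apply, vielbeinPart_mul_tmul, parity_tmul_mul_vielbeinPart, wedge₂_tmul,
    wedge₁_tmul, sharpC_symm_complexDualBasis, wedge_apply, ← Finset.sum_add_distrib,
    Finset.smul_sum, ← TensorProduct.add_tmul, TensorProduct.smul_tmul']

theorem halfMinus_vielbeinPart (A : Module.End ℂ (ℂ ⊗[ℝ] W)) :
    halfMinus (vielbeinPart Q θ A) =
      casimir (complexBasis W) (complexDualBasis hQ) (vdash₁ Q T) (wedge₂ θ hQ) A := by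
  refine TensorProduct.ext' fun a α => ?_
  simp only [halfMinus, casimir_apply, LinearMap.smul_apply, LinearMap.sub_apply,
    LinearMap.comp_apply, LinearMap.mulLeft_apply, LinearMap.mulRight_apply, LinearMap.sum_apply,
    Module.End.mul_apply, vielbeinPart_mul_tmul, parity_tmul_mul_vielbeinPart, wedge₂_tmul,
    vdash₁_tmul, sharpC_symm_complexDualBasis, vdash_apply, ← Finset.sum_sub_distrib,
    Finset.smul_sum, ← TensorProduct.sub_tmul, TensorProduct.smul_tmul']

theorem conjBy_star₁_wedge₁ (x : ℂ ⊗[ℝ] W) :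
    conjBy (star₁ T ν) (wedge₁ Q T x) = vdash₁ Q T x := by
  refine TensorProduct.ext' fun a α => ?_
  rw [vdash₁_tmul, ← hodgeStar_symm_wedge ν x a]
  change (star₁ T ν).symm (wedge₁ Q T x (hodgeStar ν a ⊗ₜ α)) = _
  rw [wedge₁_tmul]
  rfl

theorem conjBy_star₁_wedge₂ (x : ℂ ⊗[ℝ] W) :
    conjBy (star₁ T ν) (wedge₂ θ hQ x) = wedge₂ θ hQ x := by
  refine TensorProduct.ext' fun a α => ?_
  change (star₁ T ν).symm (wedge₂ θ hQ x (hodgeStar ν a ⊗ₜ α)) = _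
  rw [wedge₂_tmul, wedge₂_tmul]
  exact congrArg (· ⊗ₜ[ℂ] _) (LinearEquiv.symm_apply_apply _ a)

theorem conjBy_star₁_vdash₂ (x : ℂ ⊗[ℝ] W) :
    conjBy (star₁ T ν) (vdash₂ θ hQ x) = vdash₂ θ hQ x := by
  refine TensorProduct.ext' fun a α => ?_
  change (star₁ T ν).symm (vdash₂ θ hQ x (hodgeStar ν a ⊗ₜ α)) = _
  rw [vdash₂_tmul, vdash₂_tmul]
  exact congrArg (· ⊗ₜ[ℂ] _) (LinearEquiv.symm_apply_apply _ a)

theorem equivExterior_formsEquiv (α : Forms T) :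
    CliffordAlgebra.equivExterior (Q.baseChange ℂ) (formsEquiv θ hQ α) =
      ExteriorAlgebra.map (sharpC θ hQ).toLinearMap α :=
  LinearEquiv.apply_symm_apply _ _

theorem formsEquiv_ι_mul (y : ℂ ⊗[ℝ] Module.Dual ℝ T) (α : Forms T) :
    formsEquiv θ hQ (ExteriorAlgebra.ι ℂ y * α) =
      wedge (Q.baseChange ℂ) (sharpC θ hQ y) (formsEquiv θ hQ α) := by
  apply (CliffordAlgebra.equivExterior (Q.baseChange ℂ)).injective
  rw [equivExterior_wedge, equivExterior_formsEquiv, equivExterior_formsEquiv, map_mul,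
    ExteriorAlgebra.map_apply_ι]
  rfl

theorem formsEquiv_extContract (x : ℂ ⊗[ℝ] W) (α : Forms T) :
    formsEquiv θ hQ (extContract ((sharpC θ hQ).toLinearMap.dualMap (metric Q x)) α) =
      vdash (Q.baseChange ℂ) x (formsEquiv θ hQ α) := by
  apply (CliffordAlgebra.equivExterior (Q.baseChange ℂ)).injective
  rw [equivExterior_vdash, equivExterior_formsEquiv, equivExterior_formsEquiv,
    exteriorMap_contractLeft]
  rfl

theorem conjBy_star₂_wedge₁ (x : ℂ ⊗[ℝ] W) :
    conjBy (star₂ θ hQ ν) (wedge₁ Q T x) = wedge₁ Q T x := by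
  refine TensorProduct.ext' fun a α => ?_
  change (star₂ θ hQ ν).symm (wedge₁ Q T x (a ⊗ₜ ((formsEquiv θ hQ).trans
    ((hodgeStar ν).trans (formsEquiv θ hQ).symm)) α)) = _
  rw [wedge₁_tmul, wedge₁_tmul]
  exact congrArg (_ ⊗ₜ[ℂ] ·) (LinearEquiv.symm_apply_apply _ α)

/-- Through `formsEquiv` this is the defining identity of the Clifford star, with exterior
multiplication and contraction of forms matched to `wedge` and `vdash`. -/
theorem conjBy_star₂_wedge₂ (x : ℂ ⊗[ℝ] W) :
    conjBy (star₂ θ hQ ν) (wedge₂ θ hQ x) = vdash₂ θ hQ x := by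
  refine TensorProduct.ext' fun a α => ?_
  change (star₂ θ hQ ν).symm (wedge₂ θ hQ x (a ⊗ₜ ((formsEquiv θ hQ).trans
    ((hodgeStar ν).trans (formsEquiv θ hQ).symm)) α)) = _
  rw [wedge₂_tmul, vdash₂_tmul]
  refine congrArg (a ⊗ₜ[ℂ] ·) ?_
  refine (LinearEquiv.symm_apply_eq _).2 ?_
  simp only [LinearEquiv.trans_apply]
  apply (formsEquiv θ hQ).injective
  rw [formsEquiv_ι_mul, LinearEquiv.apply_symm_apply, LinearEquiv.apply_symm_apply,
    LinearEquiv.apply_symm_apply, formsEquiv_extContract, (hodgeStar_spec ν).2]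

/-- Conjugation is an algebra automorphism, so a star acts on a contraction by acting on the
operators in it. -/
theorem conjBy_casimir {s : CliffordFormAt Q T ≃ₗ[ℂ] CliffordFormAt Q T}
    {a b c d : (ℂ ⊗[ℝ] W) →ₗ[ℂ] Module.End ℂ (CliffordFormAt Q T)}
    (ha : ∀ x, conjBy s (a x) = c x) (hb : ∀ x, conjBy s (b x) = d x)
    (A : Module.End ℂ (ℂ ⊗[ℝ] W)) :
    conjBy s (casimir (complexBasis W) (complexDualBasis hQ) a b A) =
      casimir (complexBasis W) (complexDualBasis hQ) c d A := by
  exact map_casimir (AlgEquiv.toAlgHom (s.symm.conjAlgEquiv ℂ)) ha hb A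

theorem opE_eq_carE (i : Fin 4) : opE J θ hQ ν i = carE (complexBasis W) (complexDualBasis hQ)
    (wedge₁ Q T) (vdash₁ Q T) (wedge₂ θ hQ) (vdash₂ θ hQ) (projI J) i := by
  have h2 := fun A => conjBy_casimir hQ (conjBy_star₂_wedge₁ θ hQ ν) (conjBy_star₂_wedge₂ θ hQ ν) A
  have h1 := fun A => conjBy_casimir hQ (conjBy_star₁_wedge₁ (T := T) ν)
    (conjBy_star₁_vdash₂ θ hQ ν) A
  fin_cases i <;>
  simp [opE, carE, thetaHol, thetaAnti, halfPlus_vielbeinPart θ hQ, halfMinus_vielbeinPart θ hQ,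
    h1, h2, -map_sub]

theorem opF_eq_carF (i : Fin 4) : opF J θ hQ ν i = carF (complexBasis W) (complexDualBasis hQ)
    (wedge₁ Q T) (vdash₁ Q T) (wedge₂ θ hQ) (vdash₂ θ hQ) (projI J) i := by
  have h2 := fun A => conjBy_casimir hQ (conjBy_star₂_wedge₁ θ hQ ν) (conjBy_star₂_wedge₂ θ hQ ν) A
  have h1 := fun A => conjBy_casimir hQ (conjBy_star₁_wedge₁ (T := T) ν)
    (conjBy_star₁_vdash₂ θ hQ ν) A
  fin_cases i <;>
  simp [opF, carF, thetaHol, thetaAnti, halfPlus_vielbeinPart θ hQ, halfMinus_vielbeinPart θ hQ,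
    h1, h2, -map_sub]

theorem realE_eq (i : Fin 2) : realE θ ν i =
    ![casimir (complexBasis W) (complexDualBasis hQ) (wedge₁ Q T) (wedge₂ θ hQ) 1,
      casimir (complexBasis W) (complexDualBasis hQ) (vdash₁ Q T) (wedge₂ θ hQ) 1] i := by
  have h1 := fun A => conjBy_casimir hQ (conjBy_star₁_wedge₁ (T := T) ν)
    (conjBy_star₁_wedge₂ θ hQ ν) A
  fin_cases i <;> simp [realE, thetaReal, halfPlus_vielbeinPart θ hQ, h1]

theorem realF_eq (i : Fin 2) : realF θ hQ ν i =
    ![casimir (complexBasis W) (complexDualBasis hQ) (vdash₁ Q T) (vdash₂ θ hQ) 1,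
      casimir (complexBasis W) (complexDualBasis hQ) (wedge₁ Q T) (vdash₂ θ hQ) 1] i := by
  have h2 := fun A => conjBy_casimir hQ (conjBy_star₂_wedge₁ θ hQ ν) (conjBy_star₂_wedge₂ θ hQ ν) A
  have h1 := fun A => conjBy_casimir hQ (conjBy_star₁_wedge₁ (T := T) ν)
    (conjBy_star₁_vdash₂ θ hQ ν) A
  fin_cases i <;> simp [realF, thetaReal, halfPlus_vielbeinPart θ hQ, h1, h2]

theorem cliffordDegree_eq (P : Module.End ℂ (ℂ ⊗[ℝ] W)) : cliffordDegree (T := T) Q P =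
    casimir (complexBasis W) (complexDualBasis hQ) (wedge₁ Q T) (vdash₁ Q T) P := by
  have h : count P = ∑ k, extMul (P (complexBasis W k)) *
      extContract (metric Q (complexDualBasis hQ k)) := by
    refine count_eq_sum P _ _ fun v => ?_
    conv_rhs => rw [← (isDualPair_complexBasis hQ).sum_left v]
    simp
  have h' : cliffordDegree (T := T) Q P = Module.End.rTensorAlgHom ℂ (Cl Q) (Forms T)
      (conjExterior (Q.baseChange ℂ) (count P)) := rfl
  rw [h', h, casimir_apply]
  simp only [map_sum, map_mul]
  rfl

/-- The endomorphism counting degrees of covectors is translated by the metric into one of `ℂ ⊗ W`,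
so that both degrees are number operators over the same dual bases. -/
theorem formDegree_eq {C : Module.End ℂ (ℂ ⊗[ℝ] Module.Dual ℝ T)} {P : Module.End ℂ (ℂ ⊗[ℝ] W)}
    (hC : ∀ y, sharpC θ hQ (C y) = P (sharpC θ hQ y)) : formDegree Q C =
    casimir (complexBasis W) (complexDualBasis hQ) (wedge₂ θ hQ) (vdash₂ θ hQ) P := by
  have h : count C = ∑ k, extMul ((sharpC θ hQ).symm (P (complexBasis W k))) *
      extContract ((sharpC θ hQ).toLinearMap.dualMap (metric Q (complexDualBasis hQ k))) := by
    refine count_eq_sum C _ _ fun v => ?_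
    apply (sharpC θ hQ).injective
    rw [hC]
    conv_rhs => rw [← (isDualPair_complexBasis hQ).sum_left (sharpC θ hQ v)]
    simp
  have h' : formDegree Q C = Module.End.lTensorAlgHom ℂ (Forms T) (Cl Q) (count C) := rfl
  rw [h', h, casimir_apply]
  simp only [map_sum, map_mul]
  rfl

theorem degree_eq_carDeg (hJ : IsCompatibleComplexStructure Q J) (i : Fin 4) :
    degree Q J θ i = carDeg (complexBasis W) (complexDualBasis hQ)
      (wedge₁ Q T) (vdash₁ Q T) (wedge₂ θ hQ) (vdash₂ θ hQ) (projI J) i := by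
  have h := sharpC_projI θ hQ hJ
  fin_cases i
  · exact cliffordDegree_eq hQ _
  · exact cliffordDegree_eq hQ _
  · exact formDegree_eq θ hQ h
  · refine formDegree_eq θ hQ fun y => ?_
    rw [LinearMap.sub_apply, map_sub, h]
    simp

theorem opH_eq_carH (hJ : IsCompatibleComplexStructure Q J) (n : ℕ) (i : Fin 4) :
    opH Q J θ n i = carH (complexBasis W) (complexDualBasis hQ)
      (wedge₁ Q T) (vdash₁ Q T) (wedge₂ θ hQ) (vdash₂ θ hQ) (projI J) n i := by
  simp only [opH, carH, degree_eq_carDeg θ hQ hJ]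

theorem realH_eq (i : Fin 2) : realH Q T i =
    ![casimir (complexBasis W) (complexDualBasis hQ) (wedge₁ Q T) (vdash₁ Q T) 1 +
        casimir (complexBasis W) (complexDualBasis hQ) (wedge₂ θ hQ) (vdash₂ θ hQ) 1 -
        (Module.finrank ℝ W : ℂ) • 1,
      casimir (complexBasis W) (complexDualBasis hQ) (wedge₂ θ hQ) (vdash₂ θ hQ) 1 -
        casimir (complexBasis W) (complexDualBasis hQ) (wedge₁ Q T) (vdash₁ Q T) 1] i := by
  rw [realH, cliffordDegree_eq hQ, formDegree_eq θ hQ (P := 1) fun y => rfl]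

theorem chevalleySerre_op (hJ : IsCompatibleComplexStructure Q J) {n : ℕ}
    (hn : Module.finrank ℝ W = 2 * n) :
    ChevalleySerre affineCartan (opE J θ hQ ν) (opF J θ hQ ν) (opH Q J θ n) := by
  rw [funext (opE_eq_carE θ hQ ν), funext (opF_eq_carF θ hQ ν), funext (opH_eq_carH θ hQ hJ n)]
  refine chevalleySerre_car (isDoubleCAR_cliffordForm θ hQ) (isDualPair_complexBasis hQ)
    (isPolarization_projI hJ) ?_
  rw [sum_metric_complexBasis, hn]
  push_cast
  rfl

theorem isSl2Pair_real : IsSl2Pair (realE θ ν) (realF θ hQ ν) (realH Q T) := by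
  rw [funext (realE_eq θ hQ ν), funext (realF_eq θ hQ ν), funext (realH_eq θ hQ)]
  exact isSl2Pair_car (isDoubleCAR_cliffordForm θ hQ) (isDualPair_complexBasis hQ)
    (sum_metric_complexBasis hQ)

theorem real_eq_op (hJ : IsCompatibleComplexStructure Q J) {n : ℕ}
    (hn : Module.finrank ℝ W = 2 * n) :
    realE θ ν 0 = opE J θ hQ ν 0 + opF J θ hQ ν 2 ∧
    realF θ hQ ν 0 = opF J θ hQ ν 0 + opE J θ hQ ν 2 ∧
    realH Q T 0 = opH Q J θ n 0 - opH Q J θ n 2 ∧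
    realE θ ν 1 = opF J θ hQ ν 1 + opE J θ hQ ν 3 ∧
    realF θ hQ ν 1 = opE J θ hQ ν 1 + opF J θ hQ ν 3 ∧
    realH Q T 1 = opH Q J θ n 3 - opH Q J θ n 1 := by
  simp only [realE_eq θ hQ ν, realF_eq θ hQ ν, realH_eq θ hQ, opE_eq_carE, opF_eq_carF,
    opH_eq_carH θ hQ hJ, hn, carE, carF, carH, carDeg, Matrix.cons_val, map_sub]
  push_cast
  refine ⟨?_, ?_, ?_, ?_, ?_, ?_⟩ <;> module

end Point

/-! ### Complexified evaluation at tangent vectors -/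

section Evaluation

variable {T : Type*} [AddCommGroup T] [Module ℝ T]

/-- The complexification of the evaluation of cotangent vectors at a tangent vector. -/
def evalC (u : T) : Module.Dual ℂ (ℂ ⊗[ℝ] Module.Dual ℝ T) :=
  (Module.Dual.eval ℝ T u).baseChange ℂ

theorem evalC_tmul (u : T) (c : ℂ) (α : Module.Dual ℝ T) : evalC u (c ⊗ₜ α) = α u • c := rfl

theorem evalC_sum {κ : Type*} (s : Finset κ) (c : κ → ℝ) (u : κ → T) :
    evalC (∑ k ∈ s, c k • u k) = ∑ k ∈ s, (c k : ℂ) • evalC (u k) := by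
  ext α
  simp [evalC_tmul, LinearMap.sum_apply]

theorem one_tmul_sum {U κ : Type*} [AddCommGroup U] [Module ℝ U] (s : Finset κ) (c : κ → ℝ)
    (u : κ → U) :
    (1 : ℂ) ⊗ₜ[ℝ] (∑ k ∈ s, c k • u k) = ∑ k ∈ s, (c k : ℂ) • ((1 : ℂ) ⊗ₜ[ℝ] u k) := by
  rw [TensorProduct.tmul_sum]
  refine Finset.sum_congr rfl fun k _ => ?_
  rw [TensorProduct.tmul_smul, TensorProduct.smul_tmul', TensorProduct.smul_tmul']
  simp

end Evaluation

/-! ### Compatibility of the operators with pullback -/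

section Pullback

variable {W : Type*} [AddCommGroup W] [Module ℝ W] {Q : QuadraticForm ℝ W}
variable {T T' : Type*} [AddCommGroup T] [Module ℝ T] [AddCommGroup T'] [Module ℝ T']

variable (Q) in
/-- Exterior multiplication of Clifford forms by a complex cotangent vector. -/
def formMul (y : ℂ ⊗[ℝ] Module.Dual ℝ T) : Module.End ℂ (CliffordFormAt Q T) :=
  Module.End.lTensorAlgHom ℂ (Forms T) (Cl Q) (extMul y)

variable (Q) in
/-- Contraction of Clifford forms with a covector of the complex cotangent space. -/
def formContract (d : Module.Dual ℂ (ℂ ⊗[ℝ] Module.Dual ℝ T)) :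
    Module.End ℂ (CliffordFormAt Q T) :=
  Module.End.lTensorAlgHom ℂ (Forms T) (Cl Q) (extContract d)

variable (Q) in
theorem pullback_tmul (f : T →ₗ[ℝ] T') (a : Cl Q) (α : Forms T') :
    pullback Q f (a ⊗ₜ α) = a ⊗ₜ ExteriorAlgebra.map (f.dualMap.baseChange ℂ) α := rfl

theorem formMul_tmul (y : ℂ ⊗[ℝ] Module.Dual ℝ T) (a : Cl Q) (α : Forms T) :
    formMul Q y (a ⊗ₜ α) = a ⊗ₜ (ExteriorAlgebra.ι ℂ y * α) := rfl

theorem formContract_tmul (d : Module.Dual ℂ (ℂ ⊗[ℝ] Module.Dual ℝ T)) (a : Cl Q) (α : Forms T) :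
    formContract Q d (a ⊗ₜ α) = a ⊗ₜ extContract d α := rfl

theorem pullback_wedge₁ (f : T →ₗ[ℝ] T') (x : ℂ ⊗[ℝ] W) (z : CliffordFormAt Q T') :
    pullback Q f (wedge₁ Q T' x z) = wedge₁ Q T x (pullback Q f z) := by
  induction z using TensorProduct.induction_on with
  | zero => simp
  | add a b ha hb => simp only [map_add, ha, hb]
  | tmul a α =>
    rw [wedge₁_tmul, pullback_tmul, pullback_tmul, wedge₁_tmul]

theorem pullback_vdash₁ (f : T →ₗ[ℝ] T') (x : ℂ ⊗[ℝ] W) (z : CliffordFormAt Q T') :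
    pullback Q f (vdash₁ Q T' x z) = vdash₁ Q T x (pullback Q f z) := by
  induction z using TensorProduct.induction_on with
  | zero => simp
  | add a b ha hb => simp only [map_add, ha, hb]
  | tmul a α =>
    rw [vdash₁_tmul, pullback_tmul, pullback_tmul, vdash₁_tmul]

theorem pullback_formMul (f : T →ₗ[ℝ] T') (α : Module.Dual ℝ T') (z : CliffordFormAt Q T') :
    pullback Q f (formMul Q (1 ⊗ₜ α) z) = formMul Q (1 ⊗ₜ (α ∘ₗ f)) (pullback Q f z) := by
  induction z using TensorProduct.induction_on with
  | zero => simp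
  | add a b ha hb => simp only [map_add, ha, hb]
  | tmul a β =>
    rw [formMul_tmul, pullback_tmul, pullback_tmul, formMul_tmul, map_mul,
      ExteriorAlgebra.map_apply_ι]
    rfl

/-- Contracting with a pushed-forward vector and then pulling back is contracting the pullback with
the original vector. In a local frame, contraction therefore becomes a combination of fixed
operators with varying coefficients. -/
theorem pullback_formContract (f : T →ₗ[ℝ] T') (u : T) (z : CliffordFormAt Q T') :
    pullback Q f (formContract Q (evalC (f u)) z) =
      formContract Q (evalC u) (pullback Q f z) := by
  have h : evalC (f u) = (f.dualMap.baseChange ℂ).dualMap (evalC u) := by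
    ext α
    simp [evalC_tmul]
  induction z using TensorProduct.induction_on with
  | zero => simp
  | add a b ha hb => simp only [map_add, ha, hb]
  | tmul a β =>
    rw [formContract_tmul, pullback_tmul, pullback_tmul, formContract_tmul, h,
      exteriorMap_contractLeft]

theorem formMul_sum {κ : Type*} (s : Finset κ) (c : κ → ℝ) (α : κ → Module.Dual ℝ T)
    (z : CliffordFormAt Q T) :
    formMul Q (1 ⊗ₜ (∑ k ∈ s, c k • α k)) z = ∑ k ∈ s, (c k : ℂ) • formMul Q (1 ⊗ₜ α k) z := by
  simp only [formMul, one_tmul_sum, map_sum, map_smul]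
  exact LinearMap.sum_apply _ _ _

theorem formContract_sum {κ : Type*} (s : Finset κ) (c : κ → ℝ) (u : κ → T)
    (z : CliffordFormAt Q T) :
    formContract Q (evalC (∑ k ∈ s, c k • u k)) z =
      ∑ k ∈ s, (c k : ℂ) • formContract Q (evalC (u k)) z := by
  simp only [formContract, evalC_sum, map_sum, map_smul]
  exact LinearMap.sum_apply _ _ _

variable [FiniteDimensional ℝ W] (hQ : (QuadraticMap.associated (R := ℝ) Q).Nondegenerate)

theorem wedge₂_complexDualBasis (θ : T ≃ₗ[ℝ] W) (k : Fin (Module.finrank ℝ W)) :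
    wedge₂ θ hQ (complexDualBasis hQ k) =
      formMul Q (1 ⊗ₜ ((Module.finBasis ℝ W).coord k ∘ₗ θ.toLinearMap)) := by
  rw [← sharpC_symm_complexDualBasis θ hQ]
  rfl

theorem vdash₂_complexDualBasis (θ : T ≃ₗ[ℝ] W) (k : Fin (Module.finrank ℝ W)) :
    vdash₂ θ hQ (complexDualBasis hQ k) =
      formContract Q (evalC (θ.symm (dualVector hQ k))) := by
  have h : evalC (θ.symm (dualVector hQ k)) =
      (sharpC θ hQ).toLinearMap.dualMap (metric Q (complexDualBasis hQ k)) := by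
    ext α
    simp only [TensorProduct.AlgebraTensorModule.curry_apply, 
      TensorProduct.curry_apply, LinearMap.coe_restrictScalars, evalC_tmul,
      LinearMap.dualMap_apply, LinearEquiv.coe_coe, sharpC_tmul]
    rw [metric_symm, complexDualBasis, metric_tmul, associated_sharp, mul_one]
  rw [h]
  rfl

end Pullback

/-! ### Coordinatewise smoothness -/

section Smooth

variable {E : Type*} [NormedAddCommGroup E] [NormedSpace ℝ E]
variable {M : Type*} [TopologicalSpace M] [ChartedSpace E M]
variable {V : Type*} [AddCommGroup V] [Module ℂ V]

variable (E) in
/-- A function with values in a complex vector space is weakly smooth at a point if all its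
coordinates are smooth there. -/
def WeaklySmoothAt (z : M → V) (m₀ : M) : Prop :=
  ∀ f : Module.Dual ℂ V, ContMDiffAt 𝓘(ℝ, E) 𝓘(ℝ, ℂ) ∞ (fun m => f (z m)) m₀

variable {m₀ : M}

theorem WeaklySmoothAt.map {V' : Type*} [AddCommGroup V'] [Module ℂ V'] {z : M → V}
    (hz : WeaklySmoothAt E z m₀) (L : V →ₗ[ℂ] V') : WeaklySmoothAt E (fun m => L (z m)) m₀ :=
  fun f => hz (f ∘ₗ L)

theorem WeaklySmoothAt.sum {κ : Type*} {s : Finset κ} {z : κ → M → V}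
    (hz : ∀ k ∈ s, WeaklySmoothAt E (z k) m₀) :
    WeaklySmoothAt E (fun m => ∑ k ∈ s, z k m) m₀ := fun f => by
  simp only [map_sum]
  exact ContMDiffAt.sum fun k hk => hz k hk f

theorem WeaklySmoothAt.smul {z : M → V} (hz : WeaklySmoothAt E z m₀) {c : M → ℝ}
    (hc : ContMDiffAt 𝓘(ℝ, E) 𝓘(ℝ, ℝ) ∞ c m₀) :
    WeaklySmoothAt E (fun m => (c m : ℂ) • z m) m₀ := fun f => by
  have h := hc.smul (hz f)
  refine h.congr_of_eventuallyEq (Filter.Eventually.of_forall fun m => ?_)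
  simp

theorem WeaklySmoothAt.congr {z z' : M → V} (hz : WeaklySmoothAt E z m₀)
    (h : z' =ᶠ[nhds m₀] z) : WeaklySmoothAt E z' m₀ := fun f =>
  (hz f).congr_of_eventuallyEq (h.mono fun m hm => by simp only [hm])

end Smooth

/-! ### Local frames and the smoothness of the inverse vielbein -/

section Manifold

variable {E : Type*} [NormedAddCommGroup E] [NormedSpace ℝ E]
variable {M : Type*} [TopologicalSpace M] [ChartedSpace E M] [IsManifold 𝓘(ℝ, E) ∞ M]
variable {W : Type*} [AddCommGroup W] [Module ℝ W]

/-- The local frame as a linear equivalence. -/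
def frameEquiv (m₀ m : M)
    (hm : m ∈ (trivializationAt E (TangentSpace 𝓘(ℝ, E)) m₀).baseSet) :
    E ≃ₗ[ℝ] TangentSpace 𝓘(ℝ, E) m :=
  ((trivializationAt E (TangentSpace 𝓘(ℝ, E)) m₀).continuousLinearEquivAt ℝ m hm).symm.toLinearEquiv

theorem frameEquiv_coe (m₀ m : M)
    (hm : m ∈ (trivializationAt E (TangentSpace 𝓘(ℝ, E)) m₀).baseSet) :
    (frameEquiv m₀ m hm).toLinearMap = localFrame E M m₀ m := by
  ext v
  exact DFunLike.congr_fun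
    ((trivializationAt E (TangentSpace 𝓘(ℝ, E)) m₀).symm_continuousLinearEquivAt_eq' hm) v

theorem eventually_mem_baseSet (m₀ : M) :
    ∀ᶠ m in nhds m₀, m ∈ (trivializationAt E (TangentSpace 𝓘(ℝ, E)) m₀).baseSet :=
  (trivializationAt E (TangentSpace 𝓘(ℝ, E)) m₀).open_baseSet.mem_nhds
    (FiberBundle.mem_baseSet_trivializationAt' m₀)

/-- The inverse of a vielbein is smooth. -/
theorem Vielbein.exists_smooth_symm [FiniteDimensional ℝ E] [FiniteDimensional ℝ W]
    (θ : Vielbein E M W) (m₀ : M) (w : W) : ∃ u : M → E,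
      ContMDiffAt 𝓘(ℝ, E) 𝓘(ℝ, E) ∞ u m₀ ∧
      ∀ᶠ m in nhds m₀, (θ.toEquiv m).symm w = localFrame E M m₀ m (u m) := by
  have h₀ := FiberBundle.mem_baseSet_trivializationAt' (F := E) (E := TangentSpace 𝓘(ℝ, E)) m₀
  -- `W` carries no norm, so the vielbein in the frame is compared with its value `φ` at `m₀`. This
  -- gives a smooth family `g` of endomorphisms of the normed space `E`, to which smoothness of
  -- operator inversion applies.
  let φ : E ≃ₗ[ℝ] W := (frameEquiv m₀ m₀ h₀).trans (θ.toEquiv m₀)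
  let b := Module.finBasis ℝ E
  let e := Module.finBasis ℝ W
  let c : Fin (Module.finrank ℝ E) → Fin (Module.finrank ℝ W) → M → ℝ := fun i k m =>
    e.coord k (θ.toEquiv m (localFrame E M m₀ m (b i)))
  let g : M → E →L[ℝ] E := fun m => ∑ i, ∑ k, c i k m •
    LinearMap.toContinuousLinearMap ((b.coord i).smulRight (φ.symm (e k)))
  have hg : ContMDiffAt 𝓘(ℝ, E) 𝓘(ℝ, E →L[ℝ] E) ∞ g m₀ :=
    ContMDiffAt.sum fun i _ => ContMDiffAt.sum fun k _ =>
      (θ.smooth m₀ (b i) (e.coord k)).smul contMDiffAt_const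
  have hgv : ∀ m v, g m v = φ.symm (θ.toEquiv m (localFrame E M m₀ m v)) := fun m v => by
    conv_rhs => rw [← b.sum_repr v]
    simp only [g, sum_apply, smul_apply,
      LinearMap.coe_toContinuousLinearMap', LinearMap.smulRight_apply, map_sum, map_smul]
    refine Finset.sum_congr rfl fun i _ => ?_
    conv_rhs => rw [← e.sum_repr (θ.toEquiv m (localFrame E M m₀ m (b i)))]
    simp only [map_sum, map_smul, Finset.smul_sum, Module.Basis.coord_apply, c]
    exact Finset.sum_congr rfl fun k _ => smul_comm _ _ _
  have hge : ∀ m (hm : m ∈ (trivializationAt E (TangentSpace 𝓘(ℝ, E)) m₀).baseSet),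
      g m = (((frameEquiv m₀ m hm).trans ((θ.toEquiv m).trans φ.symm)).toContinuousLinearEquiv :
        E →L[ℝ] E) := fun m hm => by
    ext v
    rw [hgv, ← frameEquiv_coe m₀ m hm]
    rfl
  -- `ContinuousLinearMap.inverse` is total with a default value; it is the true inverse on the base
  -- set of the trivialization, where `g m` is invertible, and this is a neighbourhood of `m₀`.
  refine ⟨fun m => ContinuousLinearMap.inverse (g m) (φ.symm w), ?_, ?_⟩
  · have h1 : ContDiffAt ℝ ∞ ContinuousLinearMap.inverse (g m₀) := by
      rw [hge m₀ h₀]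
      exact contDiffAt_map_inverse _
    have h2 := h1.contMDiffAt.comp m₀ hg
    exact h2.clm_apply contMDiffAt_const
  · filter_upwards [eventually_mem_baseSet (E := E) m₀] with m hm
    rw [hge m hm, ContinuousLinearMap.inverse_equiv, ← frameEquiv_coe m₀ m hm]
    simp

end Manifold

/-! ### The operators preserve smooth Clifford forms -/

section Preserves

variable {E : Type*} [NormedAddCommGroup E] [NormedSpace ℝ E]
variable {M : Type*} [TopologicalSpace M] [ChartedSpace E M] [IsManifold 𝓘(ℝ, E) ∞ M]
variable {W : Type*} [AddCommGroup W] [Module ℝ W] {Q : QuadraticForm ℝ W}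

/-- A family of pointwise operators preserves smooth Clifford forms. -/
def Preserves (A : ∀ m : M, Module.End ℂ (CliffordFormAt Q (TangentSpace 𝓘(ℝ, E) m))) : Prop :=
  ∀ x ∈ cliffordForms E M Q, (fun m => A m (x m)) ∈ cliffordForms E M Q

theorem mem_cliffordForms {x : ∀ m : M, CliffordFormAt Q (TangentSpace 𝓘(ℝ, E) m)} :
    x ∈ cliffordForms E M Q ↔
      ∀ m₀, WeaklySmoothAt E (fun m => pullback Q (localFrame E M m₀ m) (x m)) m₀ := Iff.rfl

variable {A B : ∀ m : M, Module.End ℂ (CliffordFormAt Q (TangentSpace 𝓘(ℝ, E) m))}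

theorem Preserves.mul (hA : Preserves A) (hB : Preserves B) : Preserves fun m => A m * B m :=
  fun x hx => hA _ (hB x hx)

theorem Preserves.sum {κ : Type*} {s : Finset κ}
    {A : κ → ∀ m : M, Module.End ℂ (CliffordFormAt Q (TangentSpace 𝓘(ℝ, E) m))}
    (hA : ∀ k ∈ s, Preserves (A k)) : Preserves fun m => ∑ k ∈ s, A k m := fun x hx => by
  have h := Submodule.sum_mem _ fun k hk => hA k hk x hx
  convert h using 1
  ext m
  simp [LinearMap.sum_apply]

theorem Preserves.lie (hA : Preserves A) (hB : Preserves B) : Preserves fun m => ⁅A m, B m⁆ :=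
  fun x hx => Submodule.sub_mem _ (hA.mul hB x hx) (hB.mul hA x hx)

variable (Q) in
theorem preserves_wedge₁ (y : ℂ ⊗[ℝ] W) :
    Preserves fun m : M => wedge₁ Q (TangentSpace 𝓘(ℝ, E) m) y := fun x hx m₀ => by
  simp only [pullback_wedge₁]
  exact WeaklySmoothAt.map (hx m₀) _

variable (Q) in
theorem preserves_vdash₁ (y : ℂ ⊗[ℝ] W) :
    Preserves fun m : M => vdash₁ Q (TangentSpace 𝓘(ℝ, E) m) y := fun x hx m₀ => by
  simp only [pullback_vdash₁]
  exact WeaklySmoothAt.map (hx m₀) _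

/-- The second operator is only ever evaluated on the fixed dual basis, so smoothness of its
dependence on `m` has to be checked only there. -/
theorem Preserves.casimir [FiniteDimensional ℝ W]
    (hQ : (QuadraticMap.associated (R := ℝ) Q).Nondegenerate)
    {a b : ∀ m : M, (ℂ ⊗[ℝ] W) →ₗ[ℂ] Module.End ℂ (CliffordFormAt Q (TangentSpace 𝓘(ℝ, E) m))}
    (ha : ∀ y, Preserves fun m => a m y)
    (hb : ∀ k, Preserves fun m => b m (complexDualBasis hQ k)) (P : Module.End ℂ (ℂ ⊗[ℝ] W)) :
    Preserves fun m => casimir (complexBasis W) (complexDualBasis hQ) (a m) (b m) P := by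
  simp only [casimir_apply]
  exact Preserves.sum fun k _ => (ha _).mul (hb k)

variable [FiniteDimensional ℝ E] [FiniteDimensional ℝ W]
  (hQ : (QuadraticMap.associated (R := ℝ) Q).Nondegenerate) (θ : Vielbein E M W)

theorem preserves_wedge₂ (k : Fin (Module.finrank ℝ W)) :
    Preserves fun m : M => wedge₂ (θ.toEquiv m) hQ (complexDualBasis hQ k) := fun x hx => by
  rw [mem_cliffordForms]
  intro m₀
  let b := Module.finBasis ℝ E
  let c : Fin (Module.finrank ℝ E) → M → ℝ := fun i m =>
    (Module.finBasis ℝ W).coord k (θ.toEquiv m (localFrame E M m₀ m (b i)))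
  -- In the frame, the covector is a combination of fixed coordinate covectors, with coefficients
  -- that are smooth by the definition of a vielbein.
  have hc : ∀ m, ((Module.finBasis ℝ W).coord k ∘ₗ (θ.toEquiv m).toLinearMap) ∘ₗ
      localFrame E M m₀ m = ∑ i, c i m • b.coord i := fun m => by
    refine b.ext fun j => ?_
    simp [LinearMap.sum_apply, c, Finsupp.single_apply]
  simp only [wedge₂_complexDualBasis, pullback_formMul, hc, formMul_sum]
  exact WeaklySmoothAt.sum fun i _ => (WeaklySmoothAt.map (hx m₀) _).smul (θ.smooth m₀ _ _)

theorem preserves_vdash₂ (k : Fin (Module.finrank ℝ W)) :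
    Preserves fun m : M => vdash₂ (θ.toEquiv m) hQ (complexDualBasis hQ k) := fun x hx => by
  rw [mem_cliffordForms]
  intro m₀
  let b := Module.finBasis ℝ E
  obtain ⟨u, hu, hu'⟩ := θ.exists_smooth_symm m₀ (dualVector hQ k)
  have h : WeaklySmoothAt E (fun m => ∑ i, ((b.coord i (u m) : ℝ) : ℂ) •
      formContract Q (evalC (b i)) (pullback Q (localFrame E M m₀ m) (x m))) m₀ := by
    refine WeaklySmoothAt.sum fun i _ => (WeaklySmoothAt.map (hx m₀) _).smul ?_
    exact (LinearMap.toContinuousLinearMap (b.coord i)).contDiff.contMDiff.contMDiffAt.comp m₀ hu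
  refine h.congr (hu'.mono fun m hm => ?_)
  dsimp only
  rw [vdash₂_complexDualBasis, hm, pullback_formContract, ← formContract_sum]
  simp only [Module.Basis.coord_apply, b.sum_repr]

variable (J : Module.End ℝ W) (ν : UnitVolume (Q.baseChange ℂ))

theorem preserves_opE (i : Fin 4) : Preserves fun m : M => opE J (θ.toEquiv m) hQ ν i := by
  have w := fun y => preserves_wedge₁ (E := E) (M := M) Q y
  have v := fun y => preserves_vdash₁ (E := E) (M := M) Q y
  have w' := preserves_wedge₂ hQ θ
  have v' := preserves_vdash₂ hQ θ
  simp only [opE_eq_carE]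
  fin_cases i
  · exact Preserves.casimir hQ w w' _
  · exact Preserves.casimir hQ w v' _
  · exact Preserves.casimir hQ v v' _
  · exact Preserves.casimir hQ v w' _

theorem preserves_opF (i : Fin 4) : Preserves fun m : M => opF J (θ.toEquiv m) hQ ν i := by
  have w := fun y => preserves_wedge₁ (E := E) (M := M) Q y
  have v := fun y => preserves_vdash₁ (E := E) (M := M) Q y
  have w' := preserves_wedge₂ hQ θ
  have v' := preserves_vdash₂ hQ θ
  simp only [opF_eq_carF]
  fin_cases i
  · exact Preserves.casimir hQ v v' _
  · exact Preserves.casimir hQ v w' _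
  · exact Preserves.casimir hQ w w' _
  · exact Preserves.casimir hQ w v' _

end Preserves

/-! ### From pointwise relations to relations on sections -/

section ActsBy

variable {E : Type*} [NormedAddCommGroup E] [NormedSpace ℝ E]
variable {M : Type*} [TopologicalSpace M] [ChartedSpace E M] [IsManifold 𝓘(ℝ, E) ∞ M]
variable {W : Type*} [AddCommGroup W] [Module ℝ W] {Q : QuadraticForm ℝ W}
variable {A B : ∀ m : M, Module.End ℂ (CliffordFormAt Q (TangentSpace 𝓘(ℝ, E) m))}
variable {S S' : Module.End ℂ (cliffordForms E M Q)}

theorem Preserves.exists_actsBy (h : Preserves A) :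
    ∃ S : Module.End ℂ (cliffordForms E M Q), ActsBy S A :=
  ⟨{ toFun := fun x => ⟨fun m => A m (x.1 m), h x.1 x.2⟩
     map_add' := fun _ _ => Subtype.ext (funext fun m => map_add (A m) _ _)
     map_smul' := fun c _ => Subtype.ext (funext fun m => map_smul (A m) c _) }, fun _ _ => rfl⟩

/-- An operator on sections is determined by its values at points. This is what transfers every
pointwise identity to sections. -/
theorem ActsBy.unique (h : ActsBy S A) (h' : ActsBy S' A) : S = S' :=
  LinearMap.ext fun x => Subtype.ext (funext fun m => (h x m).trans (h' x m).symm)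

theorem ActsBy.add (h : ActsBy S A) (h' : ActsBy S' B) : ActsBy (S + S') fun m => A m + B m :=
  fun x m => congrArg₂ (· + ·) (h x m) (h' x m)

theorem ActsBy.sub (h : ActsBy S A) (h' : ActsBy S' B) : ActsBy (S - S') fun m => A m - B m :=
  fun x m => congrArg₂ (· - ·) (h x m) (h' x m)

theorem ActsBy.neg (h : ActsBy S A) : ActsBy (-S) fun m => -A m :=
  fun x m => congrArg (- ·) (h x m)

theorem ActsBy.zsmul (h : ActsBy S A) (c : ℤ) : ActsBy (c • S) fun m => c • A m :=
  fun x m => congrArg (c • ·) (h x m)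

theorem ActsBy.zero : ActsBy (0 : Module.End ℂ (cliffordForms E M Q)) fun _ => 0 :=
  fun _ _ => rfl

theorem ActsBy.lie (h : ActsBy S A) (h' : ActsBy S' B) : ActsBy ⁅S, S'⁆ fun m => ⁅A m, B m⁆ :=
  fun x m => by
    change (S (S' x)).1 m - (S' (S x)).1 m = A m (B m (x.1 m)) - B m (A m (x.1 m))
    rw [h, h', h', h]

theorem ActsBy.iterate_lie (h : ActsBy S A) (h' : ActsBy S' B) (k : ℕ) :
    ActsBy ((fun x => ⁅S, x⁆)^[k] S') fun m => (fun x => ⁅A m, x⁆)^[k] (B m) := by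
  induction k with
  | zero => exact h'
  | succ k ih =>
    simp only [Function.iterate_succ_apply']
    exact h.lie ih

theorem ActsBy.congr (h : ActsBy S A) (hS : S' = S) (hA : ∀ m, B m = A m) : ActsBy S' B :=
  fun x m => by rw [hS, hA, h x m]

theorem ActsBy.eq_of_forall_eq (h : ActsBy S A) (h' : ActsBy S' B) (hAB : ∀ m, A m = B m) :
    S = S' :=
  h.unique (funext hAB ▸ h')

theorem ChevalleySerre.of_actsBy {ι : Type*} {C : Matrix ι ι ℤ}
    {e f h : ι → Module.End ℂ (cliffordForms E M Q)}
    {e' f' h' : ∀ m : M, ι → Module.End ℂ (CliffordFormAt Q (TangentSpace 𝓘(ℝ, E) m))}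
    (he : ∀ i, ActsBy (e i) fun m => e' m i) (hf : ∀ i, ActsBy (f i) fun m => f' m i)
    (hh : ∀ i, ActsBy (h i) fun m => h' m i) (H : ∀ m, ChevalleySerre C (e' m) (f' m) (h' m)) :
    ChevalleySerre C e f h where
  lie_h_h i j := ((hh i).lie (hh j)).eq_of_forall_eq ActsBy.zero fun m => (H m).lie_h_h i j
  lie_e_f_same i := ((he i).lie (hf i)).eq_of_forall_eq (hh i) fun m => (H m).lie_e_f_same i
  lie_e_f_ne i j hij := ((he i).lie (hf j)).eq_of_forall_eq ActsBy.zero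
    fun m => (H m).lie_e_f_ne i j hij
  lie_h_e i j := ((hh i).lie (he j)).eq_of_forall_eq ((he j).zsmul _) fun m => (H m).lie_h_e i j
  lie_h_f i j := ((hh i).lie (hf j)).eq_of_forall_eq ((hf j).zsmul _).neg
    fun m => (H m).lie_h_f i j
  serre_e i j hij := ((he i).iterate_lie (he j) _).eq_of_forall_eq ActsBy.zero
    fun m => (H m).serre_e i j hij
  serre_f i j hij := ((hf i).iterate_lie (hf j) _).eq_of_forall_eq ActsBy.zero
    fun m => (H m).serre_f i j hij

theorem IsSl2Pair.of_actsBy {e f h : Fin 2 → Module.End ℂ (cliffordForms E M Q)}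
    {e' f' h' : ∀ m : M, Fin 2 → Module.End ℂ (CliffordFormAt Q (TangentSpace 𝓘(ℝ, E) m))}
    (he : ∀ i, ActsBy (e i) fun m => e' m i) (hf : ∀ i, ActsBy (f i) fun m => f' m i)
    (hh : ∀ i, ActsBy (h i) fun m => h' m i) (H : ∀ m, IsSl2Pair (e' m) (f' m) (h' m)) :
    IsSl2Pair e f h where
  ef i := ((he i).lie (hf i)).eq_of_forall_eq (hh i) fun m => (H m).ef i
  he i := ((hh i).lie (he i)).eq_of_forall_eq ((he i).zsmul _) fun m => (H m).he i
  hf i := ((hh i).lie (hf i)).eq_of_forall_eq ((hf i).zsmul _).neg fun m => (H m).hf i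
  ee := ((he 0).lie (he 1)).eq_of_forall_eq ActsBy.zero fun m => (H m).ee
  ef' := ((he 0).lie (hf 1)).eq_of_forall_eq ActsBy.zero fun m => (H m).ef'
  fe' := ((hf 0).lie (he 1)).eq_of_forall_eq ActsBy.zero fun m => (H m).fe'
  ff' := ((hf 0).lie (hf 1)).eq_of_forall_eq ActsBy.zero fun m => (H m).ff'

end ActsBy

/-! ### Homomorphisms defined by generators and relations -/

section LieHom

theorem IsSl2Pair.lie_h_eq_zero {L : Type*} [LieRing L] {e f h : Fin 2 → L} (H : IsSl2Pair e f h) :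
    ⁅h 0, e 1⁆ = 0 ∧ ⁅h 0, f 1⁆ = 0 ∧ ⁅e 0, h 1⁆ = 0 ∧ ⁅f 0, h 1⁆ = 0 ∧ ⁅h 0, h 1⁆ = 0 := by
  have h1 : ⁅h 0, e 1⁆ = 0 := by rw [← H.ef, lie_lie, H.fe', H.ee, lie_zero, lie_zero, sub_zero]
  have h2 : ⁅h 0, f 1⁆ = 0 := by rw [← H.ef, lie_lie, H.ff', H.ef', lie_zero, lie_zero, sub_zero]
  refine ⟨h1, h2, ?_, ?_, ?_⟩
  · rw [← H.ef 1, leibniz_lie, H.ee, H.ef', zero_lie, lie_zero, add_zero]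
  · rw [← H.ef 1, leibniz_lie, H.fe', H.ff', zero_lie, lie_zero, add_zero]
  · rw [← H.ef 1, leibniz_lie, h1, h2, zero_lie, lie_zero, add_zero]

variable {L : Type*} [LieRing L] [LieAlgebra ℂ L]

/-- A solution of the Chevalley-Serre relations defines a homomorphism of the affine Lie algebra. -/
theorem ChevalleySerre.exists_lieHom {e f h : Fin 4 → L}
    (H : ChevalleySerre affineCartan e f h) : ∃ ρ : AffineSl4 →ₗ⁅ℂ⁆ L,
      ∀ i, ρ (AffineSl4.e i) = e i ∧ ρ (AffineSl4.f i) = f i ∧ ρ (AffineSl4.h i) = h i := by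
  let g : CartanMatrix.Generators (Fin 4) → L
    | .H i => h i
    | .E i => e i
    | .F i => f i
  let φ := FreeLieAlgebra.lift ℂ g
  have hφ : ∀ x, φ (FreeLieAlgebra.of ℂ x) = g x := fun x => FreeLieAlgebra.lift_of_apply ..
  have had : ∀ (x y : FreeLieAlgebra ℂ (CartanMatrix.Generators (Fin 4))) (k : ℕ),
      φ (((LieAlgebra.ad ℂ _ x) ^ k) y) = (fun z => ⁅φ x, z⁆)^[k] (φ y) := fun x y k => by
    induction k with
    | zero => simp
    | succ k ih =>
      rw [pow_succ', Module.End.mul_apply, LieAlgebra.ad_apply, LieHom.map_lie, ih,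
        Function.iterate_succ_apply']
  have hz : ∀ (x : L) (k : ℕ), (fun z => ⁅x, z⁆)^[k] (0 : L) = 0 := fun x k =>
    Function.iterate_fixed (lie_zero x) k
  -- The Serre relations of `CartanMatrix.Relations` start from the bracket of the two generators,
  -- so their exponent is `(-A i j).toNat`, one less than here. Truncation is harmless since
  -- off-diagonal entries are nonpositive.
  have hcartan : ∀ i j, i ≠ j → (1 - affineCartan i j).toNat = (-affineCartan i j).toNat + 1 := by
    decide
  have hker : (CartanMatrix.Relations.toIdeal ℂ affineCartan : LieIdeal ℂ _) ≤ φ.ker := by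
    refine LieSubmodule.lieSpan_le.2 ?_
    rintro _ (((((⟨⟨i, j⟩, rfl⟩ | ⟨⟨i, j⟩, rfl⟩) | ⟨⟨i, j⟩, rfl⟩) | ⟨⟨i, j⟩, rfl⟩) |
      ⟨⟨i, j⟩, rfl⟩) | ⟨⟨i, j⟩, rfl⟩) <;> refine LieHom.mem_ker.2 ?_
    · simp only [CartanMatrix.Relations.HH, Function.uncurry_apply_pair, Function.comp_apply,
        LieHom.map_lie, hφ]
      exact H.lie_h_h i j
    · simp only [CartanMatrix.Relations.EF, Function.uncurry_apply_pair, Function.comp_apply]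
      split_ifs with hij
      · rw [map_sub, LieHom.map_lie, hφ, hφ, hφ]
        exact sub_eq_zero.2 (H.lie_e_f_same i)
      · rw [LieHom.map_lie, hφ, hφ]
        exact H.lie_e_f_ne i j hij
    · simp only [CartanMatrix.Relations.HE, Function.uncurry_apply_pair, Function.comp_apply,
        map_sub, map_zsmul, LieHom.map_lie, hφ]
      exact sub_eq_zero.2 (H.lie_h_e i j)
    · simp only [CartanMatrix.Relations.HF, Function.uncurry_apply_pair, Function.comp_apply,
        map_add, map_zsmul, LieHom.map_lie, hφ]
      exact add_eq_zero_iff_eq_neg.2 (H.lie_h_f i j)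
    · simp only [CartanMatrix.Relations.adE, Function.uncurry_apply_pair, Function.comp_apply, had,
        LieHom.map_lie, hφ]
      -- The presentation includes the case `i = j`, where the initial bracket is already zero.
      rcases eq_or_ne i j with rfl | hij
      · rw [lie_self, hz]
      · have := H.serre_e i j hij
        rwa [hcartan i j hij, Function.iterate_succ_apply] at this
    · simp only [CartanMatrix.Relations.adF, Function.uncurry_apply_pair, Function.comp_apply, had,
        LieHom.map_lie, hφ]
      rcases eq_or_ne i j with rfl | hij
      · rw [lie_self, hz]
      · have := H.serre_f i j hij
        rwa [hcartan i j hij, Function.iterate_succ_apply] at this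
  let ρ : (FreeLieAlgebra ℂ (CartanMatrix.Generators (Fin 4)) ⧸
      CartanMatrix.Relations.toIdeal ℂ affineCartan) →ₗ⁅ℂ⁆ L :=
    { Submodule.liftQ (CartanMatrix.Relations.toIdeal ℂ affineCartan).toSubmodule
        (φ : FreeLieAlgebra ℂ (CartanMatrix.Generators (Fin 4)) →ₗ[ℂ] L) hker with
      map_lie' := by
        intro x y
        induction x using Submodule.Quotient.induction_on
        induction y using Submodule.Quotient.induction_on
        exact LieHom.map_lie φ _ _ }
  exact ⟨ρ, fun i => ⟨hφ _, hφ _, hφ _⟩⟩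

/-- The linear map of `sl₂ × sl₂` with prescribed values on the standard generators. -/
def sl2PairMap (e f h : Fin 2 → L) : (Sl2 × Sl2) →ₗ[ℂ] L where
  toFun x := x.1.1 0 1 • e 0 + x.1.1 1 0 • f 0 + x.1.1 0 0 • h 0 +
    (x.2.1 0 1 • e 1 + x.2.1 1 0 • f 1 + x.2.1 0 0 • h 1)
  map_add' x y := by
    have h1 : (x + y).1.1 = x.1.1 + y.1.1 := rfl
    have h2 : (x + y).2.1 = x.2.1 + y.2.1 := rfl
    simp only [h1, h2, Matrix.add_apply]
    module
  map_smul' c x := by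
    have h1 : (c • x).1.1 = c • x.1.1 := rfl
    have h2 : (c • x).2.1 = c • x.2.1 := rfl
    simp only [h1, h2, Matrix.smul_apply, RingHom.id_apply, smul_eq_mul]
    module

theorem Sl2.apply_one_one (x : Sl2) : x.1 1 1 = -x.1 0 0 := by
  have h : x.1.trace = 0 := LinearMap.mem_ker.1 x.2
  rw [Matrix.trace_fin_two] at h
  linear_combination h

theorem IsSl2Pair.sl2PairMap_lie {e f h : Fin 2 → L} (H : IsSl2Pair e f h) (x y : Sl2 × Sl2) :
    sl2PairMap e f h ⁅x, y⁆ = ⁅sl2PairMap e f h x, sl2PairMap e f h y⁆ := by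
  obtain ⟨h1, h2, h3, h4, h5⟩ := H.lie_h_eq_zero
  have sk : ∀ {a b : L}, ⁅a, b⁆ = 0 → ⁅b, a⁆ = 0 := fun h => by rw [← lie_skew, h, neg_zero]
  have fe : ∀ i, ⁅f i, e i⁆ = -h i := fun i => by rw [← lie_skew, H.ef]
  have eh : ∀ i, ⁅e i, h i⁆ = -((2 : ℤ) • e i) := fun i => by rw [← lie_skew, H.he]
  have fh : ∀ i, ⁅f i, h i⁆ = (2 : ℤ) • f i := fun i => by rw [← lie_skew, H.hf, neg_neg]
  have hx := Sl2.apply_one_one x.1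
  have hx' := Sl2.apply_one_one x.2
  have hy := Sl2.apply_one_one y.1
  have hy' := Sl2.apply_one_one y.2
  have b1 : (⁅x, y⁆.1).1 = x.1.1 * y.1.1 - y.1.1 * x.1.1 := rfl
  have b2 : (⁅x, y⁆.2).1 = x.2.1 * y.2.1 - y.2.1 * x.2.1 := rfl
  simp only [sl2PairMap, LinearMap.coe_mk, AddHom.coe_mk, b1, b2, Matrix.sub_apply,
    Matrix.mul_apply, Fin.sum_univ_two, hx, hx', hy, hy', add_lie, lie_add, smul_lie, lie_smul,
    h1, h2, h3, h4, h5, sk h1, sk h2, sk h3, sk h4, sk h5, H.ee, H.ef', H.fe', H.ff', sk H.ee,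
    sk H.ef', sk H.fe', sk H.ff', fe, eh, fh, H.ef, H.he, H.hf, lie_self]
  module

theorem IsSl2Pair.exists_lieHom {e f h : Fin 2 → L} (H : IsSl2Pair e f h) :
    ∃ σ : (Sl2 × Sl2) →ₗ⁅ℂ⁆ L, ∀ x, σ x = sl2PairMap e f h x :=
  ⟨{ sl2PairMap e f h with map_lie' := fun {x y} => H.sl2PairMap_lie x y }, fun _ => rfl⟩

theorem sl2PairMap_gen (e f h : Fin 2 → L) :
    sl2PairMap e f h (Sl2.e, 0) = e 0 ∧ sl2PairMap e f h (Sl2.f, 0) = f 0 ∧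
    sl2PairMap e f h (Sl2.h, 0) = h 0 ∧ sl2PairMap e f h (0, Sl2.e) = e 1 ∧
    sl2PairMap e f h (0, Sl2.f) = f 1 ∧ sl2PairMap e f h (0, Sl2.h) = h 1 := by
  simp [sl2PairMap, Sl2.e, Sl2.f, Sl2.h]

/-- A pair of commuting `sl₂`-triples with linearly independent `h` spans a copy of
`sl₂ × sl₂`. -/
theorem IsSl2Pair.sl2PairMap_injective {e f h : Fin 2 → L} (H : IsSl2Pair e f h)
    (hh : ∀ s t : ℂ, s • h 0 + t • h 1 = 0 → s = 0 ∧ t = 0) :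
    Function.Injective (sl2PairMap e f h) := by
  obtain ⟨h1, h2, h3, h4, h5⟩ := H.lie_h_eq_zero
  have sk : ∀ {a b : L}, ⁅a, b⁆ = 0 → ⁅b, a⁆ = 0 := fun h => by rw [← lie_skew, h, neg_zero]
  have fe : ∀ i, ⁅f i, e i⁆ = -h i := fun i => by rw [← lie_skew, H.ef]
  have eh : ∀ i, ⁅e i, h i⁆ = -((2 : ℤ) • e i) := fun i => by rw [← lie_skew, H.he]
  have fh : ∀ i, ⁅f i, h i⁆ = (2 : ℤ) • f i := fun i => by rw [← lie_skew, H.hf, neg_neg]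
  have hh0 : ∀ i, h i ≠ 0 := Fin.forall_fin_two.2
    ⟨fun hi => one_ne_zero (hh 1 0 (by simp [hi])).1,
      fun hi => one_ne_zero (hh 0 1 (by simp [hi])).2⟩
  have he0 : ∀ i, e i ≠ 0 := fun i hi => hh0 i (by rw [← H.ef, hi, zero_lie])
  have hf0 : ∀ i, f i ≠ 0 := fun i hi => hh0 i (by rw [← H.ef, hi, lie_zero])
  have he2 : ∀ i, (2 : ℤ) • e i ≠ 0 := fun i => by
    rw [ofNat_zsmul, ← Nat.cast_smul_eq_nsmul ℂ]
    exact smul_ne_zero (by norm_num) (he0 i)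
  have hf2 : ∀ i, (2 : ℤ) • f i ≠ 0 := fun i => by
    rw [ofNat_zsmul, ← Nat.cast_smul_eq_nsmul ℂ]
    exact smul_ne_zero (by norm_num) (hf0 i)
  rw [injective_iff_map_eq_zero]
  rintro ⟨x, y⟩ hxy
  have hsum : x.1 0 1 • e 0 + x.1 1 0 • f 0 + x.1 0 0 • h 0 +
    (y.1 0 1 • e 1 + y.1 1 0 • f 1 + y.1 0 0 • h 1) = 0 := hxy
  -- The square of `ad (e 0)` sends `f 0` to `-2 e 0` and kills the other five generators, so it
  -- isolates one coefficient. The same device with `f 0`, `e 1` and `f 1` isolates three more; the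
  -- two coefficients of the `h`s are left to the independence hypothesis.
  have a1 : x.1 1 0 = 0 := by
    have := congrArg (fun z => ⁅e 0, ⁅e 0, z⁆⁆) hsum
    simp only [lie_add, lie_smul, lie_self, H.ef, eh, H.ee, H.ef', h3, lie_zero, smul_zero,
      add_zero, zero_add, lie_neg] at this
    simpa only [smul_neg, smul_zero, neg_zero, add_zero, neg_eq_zero, smul_eq_zero, he2, or_false]
      using this
  have a2 : x.1 0 1 = 0 := by
    have := congrArg (fun z => ⁅f 0, ⁅f 0, z⁆⁆) hsum
    simp only [lie_add, lie_smul, lie_self, fe, fh, H.fe', H.ff', h4, lie_zero, smul_zero,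
      add_zero, lie_neg] at this
    simpa only [smul_neg, smul_zero, neg_zero, add_zero, neg_eq_zero, smul_eq_zero, hf2, or_false]
      using this
  have a3 : y.1 1 0 = 0 := by
    have := congrArg (fun z => ⁅e 1, ⁅e 1, z⁆⁆) hsum
    simp only [lie_add, lie_smul, lie_self, H.ef, eh, sk H.ee, sk H.fe', sk h1, lie_zero, smul_zero,
      add_zero, zero_add, lie_neg] at this
    simpa only [smul_neg, smul_zero, neg_zero, add_zero, neg_eq_zero, smul_eq_zero, he2, or_false]
      using this
  have a4 : y.1 0 1 = 0 := by
    have := congrArg (fun z => ⁅f 1, ⁅f 1, z⁆⁆) hsum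
    simp only [lie_add, lie_smul, lie_self, fe, fh, sk H.ef', sk H.ff', sk h2, lie_zero, smul_zero,
      add_zero, zero_add, lie_neg] at this
    simpa only [smul_neg, smul_zero, neg_zero, add_zero, neg_eq_zero, smul_eq_zero, hf2, or_false]
      using this
  rw [a1, a2, a3, a4] at hsum
  simp only [zero_smul, zero_add] at hsum
  obtain ⟨a5, a6⟩ := hh _ _ hsum
  have ext0 : ∀ z : Sl2, z.1 0 1 = 0 → z.1 1 0 = 0 → z.1 0 0 = 0 → z = 0 := fun z z1 z2 z3 => by
    have z4 := Sl2.apply_one_one z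
    rw [z3, neg_zero] at z4
    ext i j
    fin_cases i <;> fin_cases j <;> simp [z1, z2, z3, z4]
  exact Prod.ext (ext0 x a2 a1 a5) (ext0 y a4 a3 a6)

end LieHom

/-! ### Derivations on the bigraded pieces -/

section Bidegree

variable {Y : Type*} [AddCommGroup Y] [Module ℂ Y]

theorem count_one (C : Module.End ℂ Y) : count C 1 = 0 := by
  have h := count_mul C 1 1
  simpa using h

/-- Eigenvalues of a derivation add under products, so `r` factors of eigenvalue `c` give `r * c`.
-/
theorem count_of_mem_pow {C : Module.End ℂ Y} {S : Submodule ℂ (ExteriorAlgebra ℂ Y)} {c : ℂ}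
    (hS : ∀ y ∈ S, count C y = c • y) (r : ℕ) : ∀ y ∈ S ^ r, count C y = ((r : ℂ) * c) • y := by
  induction r with
  | zero =>
    intro y hy
    rw [pow_zero] at hy
    obtain ⟨a, rfl⟩ := Submodule.mem_one.1 hy
    rw [Algebra.algebraMap_eq_smul_one, map_smul, count_one]
    simp
  | succ r ih =>
    intro y hy
    rw [pow_succ] at hy
    induction hy using Submodule.mul_induction_on' with
    | mem_mul_mem a ha b hb =>
      rw [count_mul, ih a ha, hS b hb, mul_smul_comm, smul_mul_assoc]
      push_cast
      module
    | add a _ b _ ha hb => rw [map_add, ha, hb, smul_add]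

theorem count_of_mem_bidegree {P C : Module.End ℂ Y} {a b : ℂ} (ha : ∀ y, C (P y) = a • P y)
    (hb : ∀ y, C ((1 - P) y) = b • (1 - P) y) {r s : ℕ} {y : ExteriorAlgebra ℂ Y}
    (hy : y ∈ bidegree P r s) : count C y = (r * a + s * b) • y := by
  have h : ∀ {D : Module.End ℂ Y} {c : ℂ}, (∀ y, C (D y) = c • D y) →
      ∀ z ∈ Submodule.map (ExteriorAlgebra.ι ℂ) (LinearMap.range D), count C z = c • z := by
    rintro D c hD _ ⟨_, ⟨v, rfl⟩, rfl⟩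
    rw [count_ι, hD, map_smul]
  rw [bidegree] at hy
  induction hy using Submodule.mul_induction_on' with
  | mem_mul_mem u hu v hv =>
    rw [count_mul, count_of_mem_pow (h ha) r u hu, count_of_mem_pow (h hb) s v hv, mul_smul_comm,
      smul_mul_assoc]
    module
  | add u _ v _ hu hv => rw [map_add, hu, hv, smul_add]

theorem count_of_mem_bidegree_self {P : Module.End ℂ Y} (hP : P * P = P) {r s : ℕ}
    {y : ExteriorAlgebra ℂ Y} (hy : y ∈ bidegree P r s) :
    count P y = (r : ℂ) • y ∧ count (1 - P) y = (s : ℂ) • y := by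
  have h : ∀ v, P (P v) = P v := fun v => LinearMap.congr_fun hP v
  constructor
  · have := count_of_mem_bidegree (C := P) (a := 1) (b := 0) (by simp [h]) (by simp [h]) hy
    simpa using this
  · have := count_of_mem_bidegree (C := 1 - P) (a := 0) (b := 1) (by simp [h]) (by simp [h]) hy
    simpa using this

end Bidegree

theorem equivExterior_ι {X : Type*} [AddCommGroup X] [Module ℂ X] (Q : QuadraticForm ℂ X) (v : X) :
    CliffordAlgebra.equivExterior Q (CliffordAlgebra.ι Q v) = ExteriorAlgebra.ι ℂ v :=
  CliffordAlgebra.changeForm_ι CliffordAlgebra.changeForm.associated_neg_proof v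

/-! ### The degree operators on graded components -/

section Component

variable {W : Type*} [AddCommGroup W] [Module ℝ W] {Q : QuadraticForm ℝ W} {J : Module.End ℝ W}
variable {T : Type*} [AddCommGroup T] [Module ℝ T] (θ : T ≃ₗ[ℝ] W)

theorem cliffordDegree_tmul (P : Module.End ℂ (ℂ ⊗[ℝ] W)) (a : Cl Q) (α : Forms T) :
    cliffordDegree Q P (a ⊗ₜ α) = (CliffordAlgebra.equivExterior (Q.baseChange ℂ)).symm
      (count P (CliffordAlgebra.equivExterior (Q.baseChange ℂ) a)) ⊗ₜ α := rfl

variable (Q) in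
theorem formDegree_tmul (C : Module.End ℂ (ℂ ⊗[ℝ] Module.Dual ℝ T)) (a : Cl Q) (α : Forms T) :
    formDegree Q C (a ⊗ₜ α) = a ⊗ₜ count C α := rfl

theorem cotangentJ_sq (hJ : IsCompatibleComplexStructure Q J) (α : Module.Dual ℝ T) :
    cotangentJ J θ (cotangentJ J θ α) = -α := by
  ext u
  simp [cotangentJ, hJ.sq]

theorem degree_of_mem_component (hJ : IsCompatibleComplexStructure Q J) {p p' q q' : ℕ}
    {x : CliffordFormAt Q T} (hx : x ∈ component Q J θ p p' q q') :
    degree Q J θ 0 x = (p : ℂ) • x ∧ degree Q J θ 1 x = (p' : ℂ) • x ∧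
    degree Q J θ 2 x = (q : ℂ) • x ∧ degree Q J θ 3 x = (q' : ℂ) • x := by
  have hc : ∀ (D : Module.End ℂ (CliffordFormAt Q T)) (c : ℂ),
      (∀ a : Cl Q, CliffordAlgebra.equivExterior (Q.baseChange ℂ) a ∈ bidegree (projI J) p p' →
        ∀ α ∈ bidegree (projI (cotangentJ J θ)) q q', D (a ⊗ₜ α) = c • a ⊗ₜ α) →
      D x = c • x := fun D c h => by
    -- The component is spanned by pure tensors, so the eigenvalue equation is checked on these by
    -- placing them in a kernel.
    have h1 : component Q J θ p p' q q' ≤ LinearMap.ker (D - c • 1) := by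
      refine Submodule.map₂_le.2 fun a ha α hα => ?_
      rw [LinearMap.mem_ker, LinearMap.sub_apply, sub_eq_zero]
      exact h a ha α hα
    have h2 := h1 hx
    rw [LinearMap.mem_ker, LinearMap.sub_apply, sub_eq_zero] at h2
    exact h2
  have hP := projI_mul_self hJ.sq
  have hP' := projI_mul_self (cotangentJ_sq θ hJ)
  refine ⟨hc _ _ fun a ha α hα => ?_, hc _ _ fun a ha α hα => ?_, hc _ _ fun a ha α hα => ?_,
    hc _ _ fun a ha α hα => ?_⟩
  · change cliffordDegree Q (projI J) _ = _
    rw [cliffordDegree_tmul, (count_of_mem_bidegree_self hP ha).1, map_smul,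
      LinearEquiv.symm_apply_apply]
    rfl
  · change cliffordDegree Q (1 - projI J) _ = _
    rw [cliffordDegree_tmul, (count_of_mem_bidegree_self hP ha).2, map_smul,
      LinearEquiv.symm_apply_apply]
    rfl
  · change formDegree Q (projI (cotangentJ J θ)) _ = _
    rw [formDegree_tmul, (count_of_mem_bidegree_self hP' hα).1, TensorProduct.tmul_smul]
  · change formDegree Q (1 - projI (cotangentJ J θ)) _ = _
    rw [formDegree_tmul, (count_of_mem_bidegree_self hP' hα).2, TensorProduct.tmul_smul]

theorem opH_of_mem_component (hJ : IsCompatibleComplexStructure Q J) (n : ℕ) {p p' q q' : ℕ}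
    {x : CliffordFormAt Q T} (hx : x ∈ component Q J θ p p' q q') :
    opH Q J θ n 0 x = ((p : ℂ) + q - n) • x ∧ opH Q J θ n 1 x = ((p' : ℂ) - q) • x ∧
    opH Q J θ n 2 x = ((n : ℂ) - p' - q') • x ∧ opH Q J θ n 3 x = ((q' : ℂ) - p) • x := by
  obtain ⟨h0, h1, h2, h3⟩ := degree_of_mem_component θ hJ hx
  simp only [opH, Matrix.cons_val, LinearMap.sub_apply, LinearMap.add_apply, LinearMap.smul_apply,
    Module.End.one_apply, h0, h1, h2, h3]
  refine ⟨?_, ?_, ?_, ?_⟩ <;> module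

/-- The augmentation of the exterior algebra on the second factor recovers `a`. -/
theorem tmul_one_ne_zero {a : Cl Q} (ha : a ≠ 0) : (a ⊗ₜ 1 : CliffordFormAt Q T) ≠ 0 := by
  intro h
  have h1 := congrArg (fun z => TensorProduct.rid ℂ (Cl Q)
    (LinearMap.lTensor (Cl Q) (ExteriorAlgebra.algebraMapInv (R := ℂ)).toLinearMap z)) h
  simp at h1
  exact ha h1

theorem realH_one : realH Q T 0 (1 ⊗ₜ 1) = (-(Module.finrank ℝ W : ℂ)) • (1 ⊗ₜ 1) ∧
    realH Q T 1 (1 ⊗ₜ 1) = 0 := by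
  have h : CliffordAlgebra.equivExterior (Q.baseChange ℂ) 1 = 1 := by simp
  simp only [realH, Matrix.cons_val, LinearMap.sub_apply, LinearMap.add_apply,
    LinearMap.smul_apply, Module.End.one_apply, cliffordDegree_tmul, formDegree_tmul, h, count_one,
    map_zero, TensorProduct.zero_tmul, TensorProduct.tmul_zero]
  constructor <;> module

theorem realH_ι (v : ℂ ⊗[ℝ] W) : realH Q T 1 (CliffordAlgebra.ι (Q.baseChange ℂ) v ⊗ₜ 1) =
    -(CliffordAlgebra.ι (Q.baseChange ℂ) v ⊗ₜ 1) := by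
  have h := equivExterior_ι (Q.baseChange ℂ) v
  simp only [realH, Matrix.cons_val, LinearMap.sub_apply, cliffordDegree_tmul, formDegree_tmul,
    h, count_one, count_ι, TensorProduct.tmul_zero, Module.End.one_apply, zero_sub]
  rw [← h, LinearEquiv.symm_apply_apply]

end Component

/-! ### Linear independence of the two real Cartan operators -/

section Independence

variable {E : Type*} [NormedAddCommGroup E] [NormedSpace ℝ E]
variable {M : Type*} [TopologicalSpace M] [ChartedSpace E M] [IsManifold 𝓘(ℝ, E) ∞ M]
variable {W : Type*} [AddCommGroup W] [Module ℝ W] {Q : QuadraticForm ℝ W}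

variable (E M) in
theorem tmul_one_mem_cliffordForms (a : Cl Q) :
    (fun _ => a ⊗ₜ 1 : ∀ m : M, CliffordFormAt Q (TangentSpace 𝓘(ℝ, E) m)) ∈
      cliffordForms E M Q := fun _ _ => by
  simp only [pullback_tmul, map_one]
  exact contMDiffAt_const

/-- A basis vector pairs to `1` with its dual vector, and the canonical isomorphism embeds vectors
into the Clifford algebra. -/
theorem ι_complexBasis_ne_zero [FiniteDimensional ℝ W]
    (hQ : (QuadraticMap.associated (R := ℝ) Q).Nondegenerate) (k : Fin (Module.finrank ℝ W)) :
    CliffordAlgebra.ι (Q.baseChange ℂ) (complexBasis W k) ≠ 0 := fun h0 => by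
  have h1 := congrArg (CliffordAlgebra.equivExterior (Q.baseChange ℂ)) h0
  rw [map_zero] at h1
  have h2 := (ExteriorAlgebra.ι_eq_zero_iff _).1 ((equivExterior_ι _ _).symm.trans h1)
  have h3 := metric_tmul (Q := Q) 1 1 (dualVector hQ k) (Module.finBasis ℝ W k)
  rw [associated_dualVector] at h3
  change metric Q (1 ⊗ₜ _) (complexBasis W k) = _ at h3
  rw [h2] at h3
  simp at h3

/-- On `1 ⊗ 1` the operator `H` is `-dim W` and `H'` is zero, which forces `s = 0`; on `v ⊗ 1` with
`v ≠ 0` the operator `H'` is `-1`, which forces `t = 0`. -/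
theorem realH_smul_add_eq_zero [FiniteDimensional ℝ W]
    (hQ : (QuadraticMap.associated (R := ℝ) Q).Nondegenerate) (hW : 0 < Module.finrank ℝ W)
    {T : Type*} [AddCommGroup T] [Module ℝ T] {s t : ℂ}
    (h : ∀ a : Cl Q, s • realH Q T 0 (a ⊗ₜ 1) + t • realH Q T 1 (a ⊗ₜ 1) = 0) :
    s = 0 ∧ t = 0 := by
  have hι := ι_complexBasis_ne_zero hQ ⟨0, hW⟩
  have h1 : (1 : Cl Q) ≠ 0 := fun h0 => hι (by rw [← mul_one (CliffordAlgebra.ι _ _), h0, mul_zero])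
  have hs : s = 0 := by
    have h2 := h 1
    rw [realH_one.1, realH_one.2, smul_zero, add_zero, smul_smul] at h2
    have h3 := (smul_eq_zero.1 h2).resolve_right (tmul_one_ne_zero h1)
    simpa [hW.ne'] using h3
  refine ⟨hs, ?_⟩
  have h2 := h (CliffordAlgebra.ι _ (complexBasis W ⟨0, hW⟩))
  rw [hs, zero_smul, zero_add, realH_ι, smul_neg, neg_eq_zero] at h2
  exact (smul_eq_zero.1 h2).resolve_right (tmul_one_ne_zero hι)

theorem independent_of_actsBy_realH [FiniteDimensional ℝ W] (m : M)
    (hQ : (QuadraticMap.associated (R := ℝ) Q).Nondegenerate) (hW : 0 < Module.finrank ℝ W)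
    {h : Fin 2 → Module.End ℂ (cliffordForms E M Q)}
    (hh : ∀ i, ActsBy (h i) fun m => realH Q (TangentSpace 𝓘(ℝ, E) m) i) (s t : ℂ)
    (hst : s • h 0 + t • h 1 = 0) : s = 0 ∧ t = 0 := by
  refine realH_smul_add_eq_zero hQ hW (T := TangentSpace 𝓘(ℝ, E) m) fun a => ?_
  rw [← hh 0 ⟨_, tmul_one_mem_cliffordForms E M a⟩ m,
    ← hh 1 ⟨_, tmul_one_mem_cliffordForms E M a⟩ m]
  exact congrArg (fun S : Module.End ℂ (cliffordForms E M Q) =>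
    (S ⟨_, tmul_one_mem_cliffordForms E M a⟩).1 m) hst

end Independence

/-- Since `H_i = [E_i, F_i]` pointwise, smoothness is inherited from the `E`s and `F`s, without a
local study of the degree operators. -/
theorem preserves_opH {E : Type*} [NormedAddCommGroup E] [NormedSpace ℝ E] [FiniteDimensional ℝ E]
    {M : Type*} [TopologicalSpace M] [ChartedSpace E M] [IsManifold 𝓘(ℝ, E) ∞ M]
    {W : Type*} [AddCommGroup W] [Module ℝ W] [FiniteDimensional ℝ W] {Q : QuadraticForm ℝ W}
    (hQ : (QuadraticMap.associated (R := ℝ) Q).Nondegenerate) (θ : Vielbein E M W)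
    (J : Module.End ℝ W) (ν : UnitVolume (Q.baseChange ℂ)) {n : ℕ}
    (hJ : IsCompatibleComplexStructure Q J) (hn : Module.finrank ℝ W = 2 * n) (i : Fin 4) :
    Preserves fun m : M => opH Q J (θ.toEquiv m) n i := by
  simp only [← (chevalleySerre_op (θ.toEquiv _) hQ ν hJ hn).lie_e_f_same]
  exact (preserves_opE hQ θ J ν i).lie (preserves_opF hQ θ J ν i)

/-- Chevalley generators whose combinations form two commuting `sl₂`-triples define an action of the
affine Lie algebra, and an action of `sl₂ × sl₂` with values in its image. -/
theorem ChevalleySerre.exists_actions {V : Type*} [AddCommGroup V] [Module ℂ V]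
    (S : Submodule ℂ V) {e f h : Fin 4 → Module.End ℂ S} (H : ChevalleySerre affineCartan e f h)
    (H' : IsSl2Pair ![e 0 + f 2, f 1 + e 3] ![f 0 + e 2, e 1 + f 3] ![h 0 - h 2, h 3 - h 1]) :
    ∃ ρ : AffineSl4 →ₗ⁅ℂ⁆ Module.End ℂ S,
      (∀ i, ρ (AffineSl4.e i) = e i ∧ ρ (AffineSl4.f i) = f i ∧ ρ (AffineSl4.h i) = h i) ∧
      ∃ σ : (Sl2 × Sl2) →ₗ⁅ℂ⁆ Module.End ℂ S,
        σ (Sl2.e, 0) = e 0 + f 2 ∧ σ (Sl2.f, 0) = f 0 + e 2 ∧ σ (Sl2.h, 0) = h 0 - h 2 ∧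
        σ (0, Sl2.e) = f 1 + e 3 ∧ σ (0, Sl2.f) = e 1 + f 3 ∧ σ (0, Sl2.h) = h 3 - h 1 ∧
        σ.range ≤ ρ.range ∧
        ((∀ s t : ℂ, s • (h 0 - h 2) + t • (h 3 - h 1) = 0 → s = 0 ∧ t = 0) →
          Function.Injective σ) := by
  obtain ⟨ρ, hρ⟩ := H.exists_lieHom
  obtain ⟨σ, hσ⟩ := H'.exists_lieHom
  obtain ⟨s1, s2, s3, s4, s5, s6⟩ := sl2PairMap_gen
    ![e 0 + f 2, f 1 + e 3] ![f 0 + e 2, e 1 + f 3] ![h 0 - h 2, h 3 - h 1]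
  refine ⟨ρ, hρ, σ, (hσ _).trans s1, (hσ _).trans s2, (hσ _).trans s3, (hσ _).trans s4,
    (hσ _).trans s5, (hσ _).trans s6, ?_, fun hh => ?_⟩
  -- Every value of `σ` is a combination of the six sums of Chevalley generators, each of which lies
  -- in the image of `ρ`.
  · rintro _ ⟨x, rfl⟩
    have me : ∀ i, e i ∈ ρ.range := fun i => ⟨_, (hρ i).1⟩
    have mf : ∀ i, f i ∈ ρ.range := fun i => ⟨_, (hρ i).2.1⟩
    have mh : ∀ i, h i ∈ ρ.range := fun i => ⟨_, (hρ i).2.2⟩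
    have ms : ∀ (c : ℂ) {z}, z ∈ ρ.range → c • z ∈ ρ.range := fun c _ hz => ρ.range.smul_mem c hz
    change σ x ∈ ρ.range
    rw [hσ]
    exact add_mem (add_mem (add_mem (ms _ (add_mem (me 0) (mf 2))) (ms _ (add_mem (mf 0) (me 2))))
      (ms _ (sub_mem (mh 0) (mh 2)))) (add_mem (add_mem (ms _ (add_mem (mf 1) (me 3)))
      (ms _ (add_mem (me 1) (mf 3)))) (ms _ (sub_mem (mh 3) (mh 1))))
  · rw [show (σ : _ → _) = sl2PairMap _ _ _ from funext hσ]
    exact H'.sl2PairMap_injective hh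

end CliffordForms

end

/-! ### Assembly on the space of smooth Clifford forms -/

theorem proposition4 {E : Type*} [NormedAddCommGroup E] [NormedSpace ℝ E] [FiniteDimensional ℝ E]
    {M : Type*} [TopologicalSpace M] [ChartedSpace E M] [IsManifold 𝓘(ℝ, E) ∞ M]
    {W : Type*} [AddCommGroup W] [Module ℝ W] [FiniteDimensional ℝ W]
    (n : ℕ) (hn : Module.finrank ℝ W = 2 * n)
    (Q : QuadraticForm ℝ W) (hQ : (QuadraticMap.associated (R := ℝ) Q).Nondegenerate)
    (J : Module.End ℝ W) (hJ : CliffordForms.IsCompatibleComplexStructure Q J)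
    (θ : CliffordForms.Vielbein E M W)
    (ν : CliffordForms.UnitVolume (Q.baseChange ℂ)) :
    -- the operators `H_i` are the asserted multiples of the identity on each graded component
    (∀ (m : M) (p p' q q' : ℕ), ∀ x ∈ CliffordForms.component Q J (θ.toEquiv m) p p' q q',
      CliffordForms.opH Q J (θ.toEquiv m) n 0 x = ((p : ℂ) + q - n) • x ∧
      CliffordForms.opH Q J (θ.toEquiv m) n 1 x = ((p' : ℂ) - q) • x ∧
      CliffordForms.opH Q J (θ.toEquiv m) n 2 x = ((n : ℂ) - p' - q') • x ∧
      CliffordForms.opH Q J (θ.toEquiv m) n 3 x = ((q' : ℂ) - p) • x) ∧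
    -- there are operators on smooth Clifford forms that act pointwise by `E_i`, `F_i`, `H_i`
    ∃ eOp fOp hOp : Fin 4 → Module.End ℂ (CliffordForms.cliffordForms E M Q),
      (∀ i, CliffordForms.ActsBy (eOp i)
        fun m => CliffordForms.opE J (θ.toEquiv m) hQ ν i) ∧
      (∀ i, CliffordForms.ActsBy (fOp i)
        fun m => CliffordForms.opF J (θ.toEquiv m) hQ ν i) ∧
      (∀ i, CliffordForms.ActsBy (hOp i)
        fun m => CliffordForms.opH Q J (θ.toEquiv m) n i) ∧
      -- they satisfy the Chevalley-Serre relations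
      CliffordForms.ChevalleySerre CliffordForms.affineCartan eOp fOp hOp ∧
      -- hence they define an action `ρ` of the affine Lie algebra
      ∃ ρ : CliffordForms.AffineSl4 →ₗ⁅ℂ⁆ Module.End ℂ (CliffordForms.cliffordForms E M Q),
        (∀ i, ρ (CliffordForms.AffineSl4.e i) = eOp i ∧
          ρ (CliffordForms.AffineSl4.f i) = fOp i ∧
          ρ (CliffordForms.AffineSl4.h i) = hOp i) ∧
        -- the action `σ` of `sl₂ × sl₂` takes values in the image of `ρ`
        ∃ σ : (CliffordForms.Sl2 × CliffordForms.Sl2) →ₗ⁅ℂ⁆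
            Module.End ℂ (CliffordForms.cliffordForms E M Q),
          CliffordForms.ActsBy (σ (CliffordForms.Sl2.e, 0))
            (fun m => CliffordForms.realE (θ.toEquiv m) ν 0) ∧
          CliffordForms.ActsBy (σ (CliffordForms.Sl2.f, 0))
            (fun m => CliffordForms.realF (θ.toEquiv m) hQ ν 0) ∧
          CliffordForms.ActsBy (σ (CliffordForms.Sl2.h, 0))
            (fun m => CliffordForms.realH Q (TangentSpace 𝓘(ℝ, E) m) 0) ∧
          CliffordForms.ActsBy (σ (0, CliffordForms.Sl2.e))
            (fun m => CliffordForms.realE (θ.toEquiv m) ν 1) ∧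
          CliffordForms.ActsBy (σ (0, CliffordForms.Sl2.f))
            (fun m => CliffordForms.realF (θ.toEquiv m) hQ ν 1) ∧
          CliffordForms.ActsBy (σ (0, CliffordForms.Sl2.h))
            (fun m => CliffordForms.realH Q (TangentSpace 𝓘(ℝ, E) m) 1) ∧
          σ (CliffordForms.Sl2.e, 0) = eOp 0 + fOp 2 ∧
          σ (CliffordForms.Sl2.f, 0) = fOp 0 + eOp 2 ∧
          σ (CliffordForms.Sl2.h, 0) = hOp 0 - hOp 2 ∧
          σ (0, CliffordForms.Sl2.e) = fOp 1 + eOp 3 ∧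
          σ (0, CliffordForms.Sl2.f) = eOp 1 + fOp 3 ∧
          σ (0, CliffordForms.Sl2.h) = hOp 3 - hOp 1 ∧
          σ.range ≤ ρ.range ∧
          (0 < n → Nonempty M → Function.Injective σ) := by
  refine ⟨fun m p p' q q' x hx => CliffordForms.opH_of_mem_component (θ.toEquiv m) hJ n hx, ?_⟩
  have hcs := fun m => CliffordForms.chevalleySerre_op (θ.toEquiv m) hQ ν hJ hn
  have hreal := fun m => CliffordForms.real_eq_op (θ.toEquiv m) hQ ν hJ hn
  choose eOp he using fun i => (CliffordForms.preserves_opE hQ θ J ν i).exists_actsBy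
  choose fOp hf using fun i => (CliffordForms.preserves_opF hQ θ J ν i).exists_actsBy
  choose hOp hh using fun i => (CliffordForms.preserves_opH hQ θ J ν hJ hn i).exists_actsBy
  have hCS : CliffordForms.ChevalleySerre CliffordForms.affineCartan eOp fOp hOp :=
    CliffordForms.ChevalleySerre.of_actsBy he hf hh hcs
  have hE : ∀ i, CliffordForms.ActsBy (![eOp 0 + fOp 2, fOp 1 + eOp 3] i)
      fun m => CliffordForms.realE (θ.toEquiv m) ν i := Fin.forall_fin_two.2
    ⟨((he 0).add (hf 2)).congr rfl fun m => (hreal m).1,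
      ((hf 1).add (he 3)).congr rfl fun m => (hreal m).2.2.2.1⟩
  have hF : ∀ i, CliffordForms.ActsBy (![fOp 0 + eOp 2, eOp 1 + fOp 3] i)
      fun m => CliffordForms.realF (θ.toEquiv m) hQ ν i := Fin.forall_fin_two.2
    ⟨((hf 0).add (he 2)).congr rfl fun m => (hreal m).2.1,
      ((he 1).add (hf 3)).congr rfl fun m => (hreal m).2.2.2.2.1⟩
  have hH : ∀ i, CliffordForms.ActsBy (![hOp 0 - hOp 2, hOp 3 - hOp 1] i)
      fun m => CliffordForms.realH Q (TangentSpace 𝓘(ℝ, E) m) i := Fin.forall_fin_two.2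
    ⟨((hh 0).sub (hh 2)).congr rfl fun m => (hreal m).2.2.1,
      ((hh 3).sub (hh 1)).congr rfl fun m => (hreal m).2.2.2.2.2⟩
  choose ρ hρ σ s1 s2 s3 s4 s5 s6 hrange hinj using hCS.exists_actions
    (CliffordForms.cliffordForms E M Q) (CliffordForms.IsSl2Pair.of_actsBy hE hF hH
      fun m => CliffordForms.isSl2Pair_real (θ.toEquiv m) hQ ν)
  refine ⟨eOp, fOp, hOp, he, hf, hh, hCS, ρ, hρ, σ, ?_, ?_, ?_, ?_, ?_, ?_,
    s1, s2, s3, s4, s5, s6, hrange, ?_⟩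
  · exact (hE 0).congr s1 fun _ => rfl
  · exact (hF 0).congr s2 fun _ => rfl
  · exact (hH 0).congr s3 fun _ => rfl
  · exact (hE 1).congr s4 fun _ => rfl
  · exact (hF 1).congr s5 fun _ => rfl
  · exact (hH 1).congr s6 fun _ => rfl
  · intro hn0 hM
    -- The test sections are constant along `M`; one point of `M` suffices to evaluate them, and `0
    -- < n` makes `W` nonzero, so that a nonzero vector exists and `dim W` is nonzero.
    exact hinj (CliffordForms.independent_of_actsBy_realH hM.some hQ (by omega) hH)
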